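/- **Setting.** Let $\hbar>0$, $n\ge 1$, and let $\vec Q=(Q_1,\dots,Q_n)$, $\vec P=(P_1,\dots,P_n)$ be the position and momentum operators in the Schrödinger representation on $\mathcal H=L^2(\mathbb R^n)$ (the irreducible representation of $[Q_i,P_j]=i\hbar\delta_{ij}$, unique up to unitary equivalence). Let $W(\vec x,\vec p)=\exp\{\frac i\hbar(\vec p\cdot\vec Q-\vec x\cdot\vec P)\}$ be the Weyl operators, written also $W(z)$ for the column vector $z=\binom{\vec x}{\vec p}\in\mathbb R^{2n}$, and $\Omega=\begin{pmatrix}0&\hbar\mathbb 1\\-\hbar\mathbb 1&0\end{pmatrix}$. Let $\vec u,\vec v\in\mathbb R^n$ with $|\vec u|=|\vec v|=1$ and $\vec u\cdot\vec v=\cos\alpha$, and let $\mathsf Q_{\vec u}$, $\mathsf P_{\vec v}$ be the spectral measures of $\vec u\cdot\vec Q$ and $\vec v\cdot\vec P$. For a state $\rho$ (positive operator of trace one) and a POVM $\mathsf M$, let $\mathsf M_\rho(A)=\mathrm{Tr}\{\rho\,\mathsf M(A)\}$. *Gaussian states.* $\mathcal G$ is the set of states with $\mathrm{Tr}\{\rho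 W(-\Omega w)\}=\exp\{i\,w^T\mu-\tfrac12 w^TVw\}$ for all $w\in\mathbb R^{2n}$, for some $\mu\in\mathbb R^{2n}$ and some real matrix $V$ with $V+\frac i2\Omega\ge0$. For $\varepsilon_1,\varepsilon_2>0$, $\mathcal G_{\varepsilon}$ is the set of $\rho\in\mathcal G$ with $\mathrm{Var}(\mathsf Q_{\vec u,\rho})\ge\varepsilon_1$ and $\mathrm{Var}(\mathsf P_{\vec v,\rho})\ge\varepsilon_2$. *Gaussian covariant bi-observables.* $\mathcal C^G$ is the set of POVMs $\mathsf M$ on $\mathbb R^2$ such that $W(\vec x,\vec p)\mathsf M(Z)W(\vec x,\vec p)^*=\mathsf M\big(Z+\binom{\vec u\cdot\vec x}{\vec v\cdot\vec p}\big)$ for all Borel $Z\subset\mathbb R^2$ and $\vec x,\vec p\in\mathbb R^n$, and such that for all $k,l\in\mathbb R$, with $\kappa=\binom kl$, $$\int_{\mathbb R^2}e^{i(kx+lp)}\,\mathsf M(dx\,dp)=W(-\Omega J^T\kappa)\,\exp\Big\{i(ka+lb)-\tfrac12\,\kappa^TV\kappa\Big\}$$ for some $a,b\in\mathbb R$, a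 real $2\times 2n$ matrix $J$ and a real symmetric $2\times2$ matrix $V$ with $V\pm\frac i2J\Omega J^T\ge0$. The numbers $a^{\mathsf M}=a$, $b^{\mathsf M}=b$ and the matrix $V^{\mathsf M}=V$ are the parameters of $\mathsf M$. Let $\mathsf M_1,\mathsf M_2$ be the two marginals of $\mathsf M$. *Entropic quantities.* With $\log=\log_2$ and the relative entropy $S(p\|q)=\int f\log(f/g)$ ($f,g$ the densities of $p,q$; value $+\infty$ allowed), put $$S(\rho,\mathsf M)=S(\mathsf Q_{\vec u,\rho}\|\mathsf M_{1,\rho})+S(\mathsf P_{\vec v,\rho}\|\mathsf M_{2,\rho}),\qquad D^G_\varepsilon(\mathsf M)=\sup_{\rho\in\mathcal G_\varepsilon}S(\rho,\mathsf M),\qquad c^G_{\rm inc}=\inf_{\mathsf M\in\mathcal C^G}D^G_\varepsilon(\mathsf M).$$ **Theorem.** Let $\varepsilon_1,\varepsilon_2>0$. (i) If $\varepsilon_1\varepsilon_2\ge\frac{\hbar^2}4(\cos\alpha)^2$, then $$c^G_{\rm inc}=(\log e)\left\{\ln\left(1+\frac{\hbar|\cos\alpha|}{2\sqrt{\varepsilon_1\varepsilon_2}}\right)-\frac{\hbar|\cos\alpha|}{2\sqrt{\varepsilon_1\varepsilon_2}+\hbar|\cos\alpha|}\right\}.$$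 There is a unique $\mathsf M\in\mathcal C^G$ with $D^G_\varepsilon(\mathsf M)=c^G_{\rm inc}$, and it is characterized among the elements of $\mathcal C^G$ by the parameters $$a^{\mathsf M}=b^{\mathsf M}=0,\quad V^{\mathsf M}_{11}=\frac\hbar2\sqrt{\frac{\varepsilon_1}{\varepsilon_2}}\,|\cos\alpha|,\quad V^{\mathsf M}_{22}=\frac\hbar2\sqrt{\frac{\varepsilon_2}{\varepsilon_1}}\,|\cos\alpha|,\quad V^{\mathsf M}_{12}=0.$$ (ii) If $\varepsilon_1\varepsilon_2<\frac{\hbar^2}4(\cos\alpha)^2$, then $c^G_{\rm inc}\ge(\log e)\{\ln2-\frac12\}$. Moreover, there exist states $\rho_\varepsilon\in\mathcal G$ with $\mathrm{Var}(\mathsf Q_{\vec u,\rho_\varepsilon})=\varepsilon_1$ and $\mathrm{Var}(\mathsf P_{\vec v,\rho_\varepsilon})=\frac{\hbar^2}{4\varepsilon_1}(\cos\alpha)^2$; there is exactly one $\mathsf M_\varepsilon\in\mathcal C^G$ with parameters $a=b=0$, $V_{11}=\varepsilon_1$, $V_{22}=\frac{\hbar^2}{4\varepsilon_1}(\cos\alpha)^2$,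 $V_{12}=0$; and for every such $\rho_\varepsilon$ $$(\log e)\left\{\ln2-\tfrac12\right\}=S(\rho_\varepsilon,\mathsf M_\varepsilon)=\inf_{\mathsf M\in\mathcal C^G}S(\rho_\varepsilon,\mathsf M).$$ -/

import Mathlib

open MeasureTheory ProbabilityTheory
open scoped ENNReal InnerProductSpace

noncomputable section

namespace PosMom

/-! ### Trace, statistical operators, POVMs on a Hilbert space -/

section Abstract

set_option linter.unusedSectionVars false

variable {H : Type*} [NormedAddCommGroup H] [InnerProductSpace ℂ H] [CompleteSpace H]

theorem hasSum_norm_inner_sq {ι : Type*} (b : HilbertBasis ι ℂ H) (x : H) :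
    HasSum (fun i => ‖⟪b i, x⟫_ℂ‖ ^ 2) (‖x‖ ^ 2) := by
  have h := Complex.hasSum_re (b.hasSum_inner_mul_inner x x)
  have e : (⟪x, x⟫_ℂ).re = ‖x‖ ^ 2 := by
    rw [inner_self_eq_norm_sq_to_K]
    norm_cast
  rw [e] at h
  refine h.congr_fun fun i => ?_
  rw [← inner_conj_symm x (b i), ← Complex.normSq_eq_conj_mul_self, Complex.normSq_eq_norm_sq]
  norm_cast

/-- Auxiliary computation behind the basis independence of the trace: for a self-adjoint
Hilbert--Schmidt operator `S` and a bounded operator `T`, summing the diagonal of `S * S * T` in one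
basis gives the same as summing the diagonal of `S * T * S` in any other basis. -/
theorem hasSum_diag_swap {ι κ : Type*} (b : HilbertBasis ι ℂ H) (b' : HilbertBasis κ ℂ H)
    (S T : H →L[ℂ] H) (hS : IsSelfAdjoint S) (hs : Summable fun i => ‖S (b i)‖ ^ 2) :
    ∃ t : ℂ, HasSum (fun i => ⟪b i, (S * S * T) (b i)⟫_ℂ) t ∧
      HasSum (fun j => ⟪S (b' j), T (S (b' j))⟫_ℂ) t := by
  have sa : ∀ x y : H, ⟪S x, y⟫_ℂ = ⟪x, S y⟫_ℂ := fun x y =>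
    (ContinuousLinearMap.isSelfAdjoint_iff_isSymmetric.mp hS) x y
  obtain ⟨T', hT⟩ : ∃ T' : H →L[ℂ] H, ∀ x y : H, ⟪T' x, y⟫_ℂ = ⟪x, T y⟫_ℂ :=
    ⟨ContinuousLinearMap.adjoint T, fun x y => ContinuousLinearMap.adjoint_inner_left T y x⟩
  have swap : ∀ (F : ι × κ → ℂ) (t : ℂ), HasSum F t → HasSum (fun p : κ × ι => F (p.2, p.1)) t :=
    fun F t h => (Equiv.prodComm κ ι).hasSum_iff.mpr h
  have s1 : Summable fun p : ι × κ => ‖⟪b' p.2, S (b p.1)⟫_ℂ‖ ^ 2 := by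
    rw [summable_prod_of_nonneg (fun p => by positivity)]
    refine ⟨fun i => (hasSum_norm_inner_sq b' (S (b i))).summable, ?_⟩
    refine hs.congr fun i => ?_
    exact (hasSum_norm_inner_sq b' (S (b i))).tsum_eq.symm
  have hs' : Summable fun j => ‖S (b' j)‖ ^ 2 := by
    have s1' : Summable fun p : κ × ι => ‖⟪b' p.1, S (b p.2)⟫_ℂ‖ ^ 2 :=
      (Equiv.prodComm κ ι).summable_iff.mpr s1
    rw [summable_prod_of_nonneg (fun p => by positivity)] at s1'
    refine s1'.2.congr fun j => ?_
    rw [← (hasSum_norm_inner_sq b (S (b' j))).tsum_eq]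
    refine tsum_congr fun i => ?_
    rw [← sa, norm_inner_symm]
  have s2 : Summable fun p : ι × κ => ‖⟪b' p.2, S (T (b p.1))⟫_ℂ‖ ^ 2 := by
    have : Summable fun p : κ × ι => ‖⟪b' p.1, S (T (b p.2))⟫_ℂ‖ ^ 2 := by
      have e : ∀ j : κ, ∀ i : ι, ‖⟪b' j, S (T (b i))⟫_ℂ‖ ^ 2
          = ‖⟪b i, T' (S (b' j))⟫_ℂ‖ ^ 2 := by
        intro j i
        rw [← sa, ← hT, norm_inner_symm]
      rw [summable_prod_of_nonneg (fun p => by positivity)]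
      simp only [e]
      refine ⟨fun j => (hasSum_norm_inner_sq b _).summable, ?_⟩
      simp only [fun j => (hasSum_norm_inner_sq b (T' (S (b' j)))).tsum_eq]
      refine Summable.of_nonneg_of_le (fun j => by positivity) (fun j => ?_)
        (hs'.mul_left (‖T'‖ ^ 2))
      rw [← mul_pow]
      exact pow_le_pow_left₀ (norm_nonneg _) (ContinuousLinearMap.le_opNorm _ _) 2
    exact (Equiv.prodComm ι κ).summable_iff.mpr this
  have sF : Summable fun p : ι × κ => ⟪S (b p.1), b' p.2⟫_ℂ * ⟪b' p.2, S (T (b p.1))⟫_ℂ := by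
    refine Summable.of_norm_bounded (s1.add s2) fun p => ?_
    rw [norm_mul, norm_inner_symm]
    nlinarith [sq_nonneg (‖⟪b' p.2, S (b p.1)⟫_ℂ‖ - ‖⟪b' p.2, S (T (b p.1))⟫_ℂ‖),
      sq_nonneg (‖⟪b' p.2, S (b p.1)⟫_ℂ‖), sq_nonneg (‖⟪b' p.2, S (T (b p.1))⟫_ℂ‖)]
  obtain ⟨t, ht⟩ := sF
  refine ⟨t, ?_, ?_⟩
  · refine (ht.prod_fiberwise fun i =>
      b'.hasSum_inner_mul_inner (S (b i)) (S (T (b i)))).congr_fun fun i => ?_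
    simp [sa]
  · have sF' : HasSum (fun p : κ × ι => ⟪S (b p.2), b' p.1⟫_ℂ * ⟪b' p.1, S (T (b p.2))⟫_ℂ) t :=
      swap (fun p => ⟪S (b p.1), b' p.2⟫_ℂ * ⟪b' p.2, S (T (b p.1))⟫_ℂ) t ht
    refine HasSum.prod_fiberwise sF' fun j => ?_
    have h := b.hasSum_inner_mul_inner (T' (S (b' j))) (S (b' j))
    rw [hT] at h
    have e : ∀ i : ι, ⟪S (b i), b' j⟫_ℂ * ⟪b' j, S (T (b i))⟫_ℂ
        = ⟪T' (S (b' j)), b i⟫_ℂ * ⟪b i, S (b' j)⟫_ℂ := by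
      intro i
      rw [hT, sa (b i), sa (b' j), mul_comm]
    exact h.congr_fun e

variable (H) in
/-- A fixed Hilbert basis of `H`, used to write down the trace. -/
def basis : HilbertBasis (exists_hilbertBasis ℂ H).choose ℂ H :=
  (exists_hilbertBasis ℂ H).choose_spec.choose

/-- The trace of an operator, as the sum of its diagonal entries. It is used below only for trace
class operators, for which it does not depend on the basis. -/
def tr (T : H →L[ℂ] H) : ℂ := ∑' i, ⟪basis H i, T (basis H i)⟫_ℂ

variable (H) in
/-- Statistical operators: positive operators of trace one. -/
structure State where
  op : H →L[ℂ] H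
  pos : op.IsPositive
  trace_one : HasSum (fun i => ⟪basis H i, op (basis H i)⟫_ℂ) 1

theorem State.exists_sqrt (ρ : State H) : ∃ S : H →L[ℂ] H, S = CFC.sqrt ρ.op ∧ S * S = ρ.op ∧
    IsSelfAdjoint S ∧ Summable fun i => ‖S (basis H i)‖ ^ 2 := by
  have hρ : 0 ≤ ρ.op := (ContinuousLinearMap.nonneg_iff_isPositive _).mpr ρ.pos
  have hSS : CFC.sqrt ρ.op * CFC.sqrt ρ.op = ρ.op := CFC.sqrt_mul_sqrt_self ρ.op hρ
  have hS : IsSelfAdjoint (CFC.sqrt ρ.op) := (CFC.sqrt_nonneg ρ.op).isSelfAdjoint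
  refine ⟨CFC.sqrt ρ.op, rfl, hSS, hS, ?_⟩
  generalize CFC.sqrt ρ.op = S at hSS hS
  refine (Complex.hasSum_re ρ.trace_one).summable.congr fun i => ?_
  have h := (ContinuousLinearMap.isSelfAdjoint_iff_isSymmetric.mp hS) (basis H i) (S (basis H i))
  rw [← hSS]
  change (⟪basis H i, S (S (basis H i))⟫_ℂ).re = _
  rw [show ⟪basis H i, S (S (basis H i))⟫_ℂ = ⟪S (basis H i), S (basis H i)⟫_ℂ from h.symm,
    inner_self_eq_norm_sq_to_K]
  norm_cast

/-- `Tr{ρ T}` may be computed in any Hilbert basis. -/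
theorem State.hasSum_tr (ρ : State H) (T : H →L[ℂ] H) {ι : Type*} (b : HilbertBasis ι ℂ H) :
    HasSum (fun i => ⟪b i, (ρ.op * T) (b i)⟫_ℂ) (tr (ρ.op * T)) := by
  obtain ⟨S, -, hSS, hS, hs⟩ := ρ.exists_sqrt
  have hs' : Summable fun i => ‖S (b i)‖ ^ 2 := by
    obtain ⟨t, -, h⟩ := hasSum_diag_swap (basis H) b S 1 hS hs
    refine (Complex.hasSum_re h).summable.congr fun i => ?_
    change (⟪S (b i), S (b i)⟫_ℂ).re = _
    rw [inner_self_eq_norm_sq_to_K]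
    norm_cast
  obtain ⟨t, h1, h2⟩ := hasSum_diag_swap (basis H) (basis H) S T hS hs
  obtain ⟨t', h1', h2'⟩ := hasSum_diag_swap b (basis H) S T hS hs'
  rw [hSS] at h1 h1'
  rw [tr, h1.tsum_eq, h2.unique h2']
  exact h1'

variable (H) in
/-- Positive operator valued measures on a measurable space `X`; the value on non-measurable sets is
fixed to be `0`, so that two POVMs are equal as soon as they agree on measurable sets. -/
structure POVM (X : Type*) [MeasurableSpace X] where
  eff : Set X → H →L[ℂ] H
  pos : ∀ A, MeasurableSet A → (eff A).IsPositive
  univ : eff Set.univ = 1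
  iUnion : ∀ A : ℕ → Set X, (∀ i, MeasurableSet (A i)) → Pairwise (Function.onFun Disjoint A) →
    ∀ ψ : H, HasSum (fun i => ⟪ψ, eff (A i) ψ⟫_ℂ) ⟪ψ, eff (⋃ i, A i) ψ⟫_ℂ
  not_measurable : ∀ A, ¬ MeasurableSet A → eff A = 0

namespace POVM

variable {X Y : Type*} [MeasurableSpace X] [MeasurableSpace Y]

theorem inner_empty (M : POVM H X) (ψ : H) : ⟪ψ, M.eff ∅ ψ⟫_ℂ = 0 := by
  have h := M.iUnion (fun _ => ∅) (fun _ => MeasurableSet.empty)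
    (fun i j _ => by simp [Function.onFun]) ψ
  exact tendsto_nhds_unique tendsto_const_nhds h.summable.tendsto_atTop_zero

/-- The finite measure `A ↦ ⟪ψ, M(A) ψ⟫`. -/
def vecMeasure (M : POVM H X) (ψ : H) : Measure X :=
  Measure.ofMeasurable (fun A _ => ENNReal.ofReal (⟪ψ, M.eff A ψ⟫_ℂ).re)
    (by simp [M.inner_empty]) (by
      intro A hA hd
      have h := Complex.hasSum_re (M.iUnion A hA hd ψ)
      change ENNReal.ofReal (⟪ψ, M.eff (⋃ i, A i) ψ⟫_ℂ).re = _
      rw [← h.tsum_eq]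
      exact ENNReal.ofReal_tsum_of_nonneg (fun i => (M.pos _ (hA i)).re_inner_nonneg_right ψ)
        h.summable)

theorem vecMeasure_apply (M : POVM H X) (ψ : H) {A : Set X} (hA : MeasurableSet A) :
    M.vecMeasure ψ A = ENNReal.ofReal (⟪ψ, M.eff A ψ⟫_ℂ).re :=
  Measure.ofMeasurable_apply A hA

theorem ofReal_tr_eq (M : POVM H X) (ρ : State H) {A : Set X} (hA : MeasurableSet A) :
    ENNReal.ofReal (tr (ρ.op * M.eff A)).re =
      Measure.sum (fun i => M.vecMeasure (CFC.sqrt ρ.op (basis H i))) A := by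
  obtain ⟨S, hS0, hSS, hS, hs⟩ := ρ.exists_sqrt
  rw [← hS0]
  obtain ⟨t, h1, h2⟩ := hasSum_diag_swap (basis H) (basis H) S (M.eff A) hS hs
  rw [hSS] at h1
  have h3 := Complex.hasSum_re h2
  rw [tr, h1.tsum_eq, Measure.sum_apply _ hA, ← h3.tsum_eq]
  simp only [fun i => M.vecMeasure_apply (S (basis H i)) hA]
  exact ENNReal.ofReal_tsum_of_nonneg (fun i => (M.pos _ hA).re_inner_nonneg_right _) h3.summable

/-- The distribution `A ↦ Tr{ρ M(A)}` of the outcomes of `M` in the state `ρ`. -/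
def dist (M : POVM H X) (ρ : State H) : Measure X :=
  Measure.ofMeasurable (fun A _ => ENNReal.ofReal (tr (ρ.op * M.eff A)).re)
    (by rw [M.ofReal_tr_eq ρ MeasurableSet.empty, measure_empty]) (by
      intro A hA hd
      rw [M.ofReal_tr_eq ρ (MeasurableSet.iUnion hA), measure_iUnion hd hA]
      exact tsum_congr fun i => (M.ofReal_tr_eq ρ (hA i)).symm)

theorem dist_apply (M : POVM H X) (ρ : State H) {A : Set X} (hA : MeasurableSet A) :
    M.dist ρ A = ENNReal.ofReal (tr (ρ.op * M.eff A)).re :=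
  Measure.ofMeasurable_apply A hA

open scoped Classical in
/-- The image of a POVM under a measurable map of the outcomes: `A ↦ M(f⁻¹(A))`. -/
def map (M : POVM H X) (f : X → Y) (hf : Measurable f) : POVM H Y where
  eff A := if MeasurableSet A then M.eff (f ⁻¹' A) else 0
  pos A hA := by simpa [hA] using M.pos _ (hf hA)
  univ := by simp [M.univ]
  iUnion A hA hd ψ := by
    simp only [hA, MeasurableSet.iUnion hA, if_true, Set.preimage_iUnion]
    exact M.iUnion _ (fun i => hf (hA i)) (fun i j h => (hd h).preimage f) ψ
  not_measurable A hA := by simp [hA]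

/-- The POVM `A ↦ U⁻¹ M(A) U` for a unitary operator `U`. -/
def conj (M : POVM H X) (U : H ≃ₗᵢ[ℂ] H) : POVM H X where
  eff A := (U.symm : H →L[ℂ] H) ∘L M.eff A ∘L (U : H →L[ℂ] H)
  pos A hA := by
    have h := (M.pos A hA).adjoint_conj (U : H →L[ℂ] H)
    rwa [LinearIsometryEquiv.adjoint_eq_symm] at h
  univ := by ext ψ; simp [M.univ]
  iUnion A hA hd ψ := by
    have e : ∀ B, ⟪ψ, ((U.symm : H →L[ℂ] H) ∘L M.eff B ∘L (U : H →L[ℂ] H)) ψ⟫_ℂ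
        = ⟪U ψ, M.eff B (U ψ)⟫_ℂ := by
      intro B
      rw [← U.inner_map_map ψ]
      simp
    simp only [e]
    exact M.iUnion A hA hd (U ψ)
  not_measurable A hA := by ext ψ; simp [M.not_measurable A hA]

/-- `T` is the operator `∫ exp(i(k x + l p)) M(dx dp)`, the integral being taken in the weak sense. -/
def HasCharOp (M : POVM H (ℝ × ℝ)) (k l : ℝ) (T : H →L[ℂ] H) : Prop :=
  ∀ ψ : H, ∫ z : ℝ × ℝ, Complex.exp (Complex.I * (k * z.1 + l * z.2)) ∂(M.vecMeasure ψ)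
    = ⟪ψ, T ψ⟫_ℂ

/-- The two marginals of a bi-observable. -/
def fst (M : POVM H (ℝ × ℝ)) : POVM H ℝ := M.map Prod.fst measurable_fst

def snd (M : POVM H (ℝ × ℝ)) : POVM H ℝ := M.map Prod.snd measurable_snd

end POVM

end Abstract

/-- Relative entropy in bits: `(log₂ e)` times the Kullback--Leibler divergence in nats. -/
def relEntropy {X : Type*} [MeasurableSpace X] (p q : Measure X) : ℝ≥0∞ :=
  ENNReal.ofReal (Real.logb 2 (Real.exp 1)) * InformationTheory.klDiv p q

/-! ### Position, momentum and Weyl operators on `L²(ℝⁿ)` -/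

/-- Configuration space `ℝⁿ` with its Euclidean norm. -/
abbrev E (n : ℕ) := EuclideanSpace ℝ (Fin n)

/-- The Hilbert space `L²(ℝⁿ)`. -/
abbrev L2 (n : ℕ) := Lp (α := E n) ℂ 2 volume

/-- Phase space `ℝⁿ × ℝⁿ` (and its dual) as column vectors with a position and a momentum block. -/
abbrev Phase (n : ℕ) := Fin n ⊕ Fin n → ℝ

/-- Multiplication by an essentially bounded function. -/
def mulOp {n : ℕ} (g : E n → ℂ) (hg : MemLp g ∞ volume) : L2 n →L[ℂ] L2 n :=
  (ContinuousLinearMap.mul ℂ ℂ).holderL volume ∞ 2 2 hg.toLp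

theorem mulOp_coeFn {n : ℕ} (g : E n → ℂ) (hg : MemLp g ∞ volume) (ψ : L2 n) :
    mulOp g hg ψ =ᵐ[volume] fun y => g y * ψ y := by
  have h1 := (ContinuousLinearMap.mul ℂ ℂ).coeFn_holder (r := 2) hg.toLp ψ
  filter_upwards [h1, hg.coeFn_toLp] with y h2 h3
  rw [h3] at h2
  exact h2

theorem inner_mulOp {n : ℕ} (g : E n → ℂ) (hg : MemLp g ∞ volume) (ψ : L2 n) :
    ⟪ψ, mulOp g hg ψ⟫_ℂ = ∫ y, g y * (‖ψ y‖ ^ 2 : ℝ) := by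
  rw [L2.inner_def]
  refine integral_congr_ae ?_
  filter_upwards [mulOp_coeFn g hg ψ] with y hy
  rw [hy, RCLike.inner_apply, mul_assoc, Complex.mul_conj, Complex.normSq_eq_norm_sq]

theorem memLp_indicator {n : ℕ} {A : Set (E n)} (hA : MeasurableSet A) :
    MemLp (A.indicator (fun _ => (1 : ℂ))) ∞ (volume : Measure (E n)) :=
  (memLp_top_const 1).indicator hA

theorem memLp_phase {n : ℕ} (ħ : ℝ) (x p : E n) :
    MemLp (fun y : E n => Complex.exp ((Complex.I / ħ) * ((⟪p, y⟫_ℝ - ⟪x, p⟫_ℝ / 2 : ℝ) : ℂ)))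
      ∞ volume := by
  refine memLp_top_of_bound (by fun_prop) 1 (Filter.Eventually.of_forall fun y => ?_)
  rw [Complex.norm_exp]
  simp

/-- The Weyl operator `exp{(i/ħ)(p·Q - x·P)}`, which acts as
`(W(x,p)ψ)(y) = exp{(i/ħ)(p·y - x·p/2)} ψ(y - x)`. -/
def weyl {n : ℕ} (ħ : ℝ) (x p : E n) : L2 n →L[ℂ] L2 n :=
  mulOp _ (memLp_phase ħ x p) ∘L
    (Lp.compMeasurePreservingₗᵢ ℂ (fun y : E n => y - x)
      (measurePreserving_sub_right volume x)).toContinuousLinearMap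

theorem weyl_coeFn {n : ℕ} (ħ : ℝ) (x p : E n) (ψ : L2 n) :
    weyl ħ x p ψ =ᵐ[volume] fun y =>
      Complex.exp ((Complex.I / ħ) * ((⟪p, y⟫_ℝ - ⟪x, p⟫_ℝ / 2 : ℝ) : ℂ)) * ψ (y - x) := by
  refine (mulOp_coeFn _ (memLp_phase ħ x p) _).trans ?_
  filter_upwards [Lp.coeFn_compMeasurePreserving ψ (measurePreserving_sub_right volume x)] with y hy
  exact congrArg _ hy

/-- The Weyl operator of a phase-space column vector. -/
def weylPhase {n : ℕ} (ħ : ℝ) (z : Phase n) : L2 n →L[ℂ] L2 n :=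
  weyl ħ (WithLp.toLp 2 fun i => z (Sum.inl i)) (WithLp.toLp 2 fun i => z (Sum.inr i))

open scoped Classical in
/-- The joint spectral measure of the position operators `Q₁, …, Qₙ`: `Q(A)` is the multiplication by
the indicator function of `A`. -/
def position (n : ℕ) : POVM (L2 n) (E n) where
  eff A := if hA : MeasurableSet A then mulOp _ (memLp_indicator hA) else 0
  pos A hA := by
    rw [dif_pos hA, ContinuousLinearMap.isPositive_iff_complex]
    intro ψ
    rw [← inner_conj_symm, inner_mulOp]
    have e : ∫ y, A.indicator (fun _ => (1 : ℂ)) y * ((‖ψ y‖ ^ 2 : ℝ) : ℂ)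
        = ((∫ y, A.indicator (fun _ => (1 : ℝ)) y * ‖ψ y‖ ^ 2 : ℝ) : ℂ) := by
      rw [← integral_complex_ofReal]
      congr 1 with y
      by_cases hy : y ∈ A <;> simp [hy]
    rw [e]
    refine ⟨by simp, ?_⟩
    simp only [Complex.conj_ofReal]
    change 0 ≤ ∫ y, A.indicator (fun _ => (1 : ℝ)) y * ‖ψ y‖ ^ 2
    exact integral_nonneg fun y =>
      mul_nonneg (Set.indicator_nonneg (fun _ _ => zero_le_one) y) (by positivity)
  univ := by
    rw [dif_pos MeasurableSet.univ]
    ext1 ψ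
    apply Lp.ext
    filter_upwards [mulOp_coeFn _ (memLp_indicator MeasurableSet.univ) ψ] with y hy
    rw [hy]
    simp
  iUnion A hA hd ψ := by
    have hint : Integrable (fun y => ((‖ψ y‖ ^ 2 : ℝ) : ℂ)) (volume : Measure (E n)) :=
      ((memLp_two_iff_integrable_sq_norm (Lp.memLp ψ).1).mp (Lp.memLp ψ)).ofReal
    have e : ∀ (B : Set (E n)) (hB : MeasurableSet B),
        ⟪ψ, mulOp _ (memLp_indicator hB) ψ⟫_ℂ = ∫ y in B, ((‖ψ y‖ ^ 2 : ℝ) : ℂ) := by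
      intro B hB
      rw [inner_mulOp, ← integral_indicator hB]
      congr 1 with y
      by_cases hy : y ∈ B <;> simp [hy]
    simp only [dif_pos (hA _), dif_pos (MeasurableSet.iUnion hA)]
    rw [e _ (MeasurableSet.iUnion hA), funext fun i => e _ (hA i)]
    exact hasSum_integral_iUnion hA hd hint.integrableOn
  not_measurable A hA := by rw [dif_neg hA]

/-- The joint spectral measure of the momentum operators `P₁, …, Pₙ`. The unitary Fourier transform
is normalized as `∫ exp(-2πi ξ·y) ψ(y) dy`, so that it turns `P` into multiplication by `2πħ ξ`. -/
def momentum (n : ℕ) (ħ : ℝ) : POVM (L2 n) (E n) :=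
  ((position n).conj (Lp.fourierTransformₗᵢ (E n) ℂ)).map (fun ξ => (2 * Real.pi * ħ) • ξ)
    (by fun_prop)

/-- The spectral measure of `Q_u = u · Q`. -/
def positionAlong {n : ℕ} (u : E n) : POVM (L2 n) ℝ :=
  (position n).map (fun x => ⟪u, x⟫_ℝ) (by fun_prop)

/-- The spectral measure of `P_v = v · P`. -/
def momentumAlong {n : ℕ} (ħ : ℝ) (v : E n) : POVM (L2 n) ℝ :=
  (momentum n ħ).map (fun p => ⟪v, p⟫_ℝ) (by fun_prop)

/-- The variance of the distribution of `Q_u` in the state `ρ`. -/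
def varQ {n : ℕ} (u : E n) (ρ : State (L2 n)) : ℝ := Var[id; (positionAlong u).dist ρ]

/-- The variance of the distribution of `P_v` in the state `ρ`. -/
def varP {n : ℕ} (ħ : ℝ) (v : E n) (ρ : State (L2 n)) : ℝ := Var[id; (momentumAlong ħ v).dist ρ]

/-! ### Gaussian states and Gaussian covariant bi-observables -/

/-- The matrix `Ω = (0, ħ1; -ħ1, 0)`. -/
def Omega (n : ℕ) (ħ : ℝ) : Matrix (Fin n ⊕ Fin n) (Fin n ⊕ Fin n) ℝ :=
  Matrix.fromBlocks 0 (ħ • 1) (-(ħ • 1)) 0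

/-- The characteristic function `w ↦ Tr{ρ W(-Ω w)}` of a state. -/
def charFn {n : ℕ} (ħ : ℝ) (ρ : State (L2 n)) (w : Phase n) : ℂ :=
  tr (ρ.op * weylPhase ħ (-(Omega n ħ).mulVec w))

open scoped ComplexOrder in
/-- Gaussian states: `ρ̂(w) = exp{i wᵀμ - wᵀVw/2}` with `V + (i/2)Ω ≥ 0`. -/
def IsGaussianState {n : ℕ} (ħ : ℝ) (ρ : State (L2 n)) : Prop :=
  ∃ (μ : Phase n) (V : Matrix (Fin n ⊕ Fin n) (Fin n ⊕ Fin n) ℝ),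
    (V.map Complex.ofReal + (Complex.I / 2) • (Omega n ħ).map Complex.ofReal).PosSemidef ∧
    ∀ w : Phase n, charFn ħ ρ w =
      Complex.exp (Complex.I * ((w ⬝ᵥ μ : ℝ) : ℂ) - ((w ⬝ᵥ V.mulVec w : ℝ) : ℂ) / 2)

open scoped ComplexOrder in
/-- `M` is a Gaussian bi-observable with parameters `((a, b), V, J)`: the real symmetric matrix `V`
satisfies `V ± (i/2) J Ω Jᵀ ≥ 0`, and the characteristic function of `M` is
`W(-Ω Jᵀ (k,l)) exp{i (k a + l b) - (k,l) V (k,l)ᵀ / 2}`. -/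
def IsGaussianBiObs {n : ℕ} (ħ : ℝ) (M : POVM (L2 n) (ℝ × ℝ)) (a b : ℝ)
    (V : Matrix (Fin 2) (Fin 2) ℝ) (J : Matrix (Fin 2) (Fin n ⊕ Fin n) ℝ) : Prop :=
  V.IsSymm ∧
  (V.map Complex.ofReal
    + (Complex.I / 2) • (J * Omega n ħ * J.transpose).map Complex.ofReal).PosSemidef ∧
  (V.map Complex.ofReal
    - (Complex.I / 2) • (J * Omega n ħ * J.transpose).map Complex.ofReal).PosSemidef ∧
  ∀ k l : ℝ, M.HasCharOp k l
    (Complex.exp (Complex.I * (k * a + l * b) - ((![k, l] ⬝ᵥ V.mulVec ![k, l] : ℝ) : ℂ) / 2) •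
      weylPhase ħ (-(Omega n ħ).mulVec (J.transpose.mulVec ![k, l])))

/-- `(u,v)`-covariance: `W(x,p) M(Z) W(x,p)* = M(Z + (u·x, v·p))`. -/
def IsCovariant {n : ℕ} (ħ : ℝ) (u v : E n) (M : POVM (L2 n) (ℝ × ℝ)) : Prop :=
  ∀ Z : Set (ℝ × ℝ), MeasurableSet Z → ∀ x p : E n,
    weyl ħ x p ∘L M.eff Z ∘L ContinuousLinearMap.adjoint (weyl ħ x p)
      = M.eff ((fun z => z + (⟪u, x⟫_ℝ, ⟪v, p⟫_ℝ)) '' Z)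

/-- Gaussian `(u,v)`-covariant bi-observables. -/
def gaussCov {n : ℕ} (ħ : ℝ) (u v : E n) : Set (POVM (L2 n) (ℝ × ℝ)) :=
  {M | IsCovariant ħ u v M ∧ ∃ a b V J, IsGaussianBiObs ħ M a b V J}

/-- `M` has parameters `(a, b)` and `V` (for some `J`, which covariance determines). -/
def HasParams {n : ℕ} (ħ : ℝ) (M : POVM (L2 n) (ℝ × ℝ)) (a b : ℝ)
    (V : Matrix (Fin 2) (Fin 2) ℝ) : Prop :=
  ∃ J, IsGaussianBiObs ħ M a b V J

/-! ### Error function, entropic divergence and incompatibility degree -/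

/-- The error function `S(ρ,M)`. -/
def errorFn {n : ℕ} (ħ : ℝ) (u v : E n) (ρ : State (L2 n)) (M : POVM (L2 n) (ℝ × ℝ)) : ℝ≥0∞ :=
  relEntropy ((positionAlong u).dist ρ) (M.fst.dist ρ)
    + relEntropy ((momentumAlong ħ v).dist ρ) (M.snd.dist ρ)

/-- Gaussian states with position variance at least `ε₁` and momentum variance at least `ε₂`. -/
def gaussStates {n : ℕ} (ħ : ℝ) (u v : E n) (ε₁ ε₂ : ℝ) : Set (State (L2 n)) :=
  {ρ | IsGaussianState ħ ρ ∧ ε₁ ≤ varQ u ρ ∧ ε₂ ≤ varP ħ v ρ}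

/-- The Gaussian entropic divergence of `Q_u, P_v` from `M`. -/
def divergence {n : ℕ} (ħ : ℝ) (u v : E n) (ε₁ ε₂ : ℝ) (M : POVM (L2 n) (ℝ × ℝ)) : ℝ≥0∞ :=
  ⨆ ρ ∈ gaussStates ħ u v ε₁ ε₂, errorFn ħ u v ρ M

/-- The Gaussian entropic incompatibility degree of `Q_u, P_v`. -/
def incDegree {n : ℕ} (ħ : ℝ) (u v : E n) (ε₁ ε₂ : ℝ) : ℝ≥0∞ :=
  ⨅ M ∈ gaussCov ħ u v, divergence ħ u v ε₁ ε₂ M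

end PosMom

end

/-!
In a Gaussian state `ρ` the observables `u·Q` and `v·P` have Gaussian distributions, of variances
`q₁, q₂` say, and the marginals of a Gaussian covariant bi-observable `M` with parameters
`(a, b), V` are the same Gaussians convolved with `N(a, V₁₁)` and `N(b, V₂₂)`. The relative entropy
of two Gaussians is explicit, and with `r(x) = ln(1 + x) - x / (1 + x)` (`noiseFn`) the error is
(`errorFn_eq`)

  `S(ρ, M) = (log₂ e) / 2 * (r(V₁₁/q₁) + a²/(q₁ + V₁₁) + r(V₂₂/q₂) + b²/(q₂ + V₂₂))`.

*Lower bound.* Covariance forces the matrix `J` of `M` to be the one with rows `(u, 0)` and `(0, v)`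
(`IsGaussianBiObs.eq_covMatrix`), so that positivity of `V ± (i/2) J Ω Jᵀ` becomes the uncertainty
relation `V₁₂² + (ħ/2 ⟪u, v⟫)² ≤ V₁₁ V₂₂` for the noise (`IsGaussianBiObs.noise_ineq`). Along a
hyperbola `x y = c²` the sum `r(x) + r(y)` has its strict minimum at `x = y = c`, and `r` is strictly
increasing; hence `2 r(c) ≤ r(x) + r(y)` for `c² ≤ x y`, with equality only at `x = y = c`
(`two_mul_noiseFn_le`). The error decreases in `q₁, q₂`, so when a Gaussian state with variances
`ε₁, ε₂` exists it realizes the divergence, and this gives value and minimizer in the first case.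
In the second case the same bound with `c = 1` is used at a state of minimal uncertainty, for which
`r(1) = ln 2 - 1/2`.

*Existence.* Both states and bi-observables come from Gaussian wave functions
`φ_L(x) ∝ exp(-‖L x‖²)` with `L` a linear automorphism adapted to the pair `u, v`. A pure state `φ_L`,
multiplied by a quadratic phase (`chirp`) to increase the momentum variance, has any variances
allowed by the uncertainty relation (`exists_gaussianState`). The bi-observable is the image under
`(x, p) ↦ (⟪u, x⟫, ⟪v, p⟫)` of the coherent state observable obtained from the isometry
`ψ ↦ 𝓕(φ_L(· - x) ψ)(ξ)` of `L²(ℝⁿ)` into `L²(ℝ²ⁿ)` (`exists_coherent`). When `⟪u, v⟫ = 0`, the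
optimal noise vanishes and the bi-observable is the joint spectral measure of the commuting
`u·Q` and `v·P`; it is written down directly, by conjugating the position observable with
chirps and Fourier transforms (`exists_sharp_joint`).

*Uniqueness.* Since `J` is forced, the parameters `(a, b), V` determine the characteristic operators
of `M`, and these determine `M` by uniqueness of the characteristic function of a finite measure
(`eq_of_hasParams`). Conversely a POVM with characteristic operators of this form is covariant, by
the Weyl relations (`isCovariant_of_hasCharOp`).
-/

noncomputable section

namespace PosMom

set_option linter.unusedSectionVars false

section Abstract

variable {H : Type*} [NormedAddCommGroup H] [InnerProductSpace ℂ H] [CompleteSpace H]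

/-! ### Vector measures and outcome distributions of a POVM -/

namespace POVM

variable {X Y : Type*} [MeasurableSpace X] [MeasurableSpace Y]

theorem ofReal_re_inner_eff (M : POVM H X) (ψ : H) {A : Set X} (hA : MeasurableSet A) :
    (((⟪ψ, M.eff A ψ⟫_ℂ).re : ℝ) : ℂ) = ⟪ψ, M.eff A ψ⟫_ℂ := by
  have h := ((ContinuousLinearMap.isPositive_iff_complex _).mp (M.pos A hA) ψ).1
  rw [← inner_conj_symm, ← h]
  simp

theorem inner_eff_eq (M : POVM H X) (ψ : H) {A : Set X} (hA : MeasurableSet A) :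
    ⟪ψ, M.eff A ψ⟫_ℂ = (((M.vecMeasure ψ A).toReal : ℝ) : ℂ) := by
  have h : 0 ≤ (⟪ψ, M.eff A ψ⟫_ℂ).re := (M.pos A hA).re_inner_nonneg_right ψ
  rw [M.vecMeasure_apply ψ hA, ENNReal.toReal_ofReal h, M.ofReal_re_inner_eff ψ hA]

instance (M : POVM H X) (ψ : H) : IsFiniteMeasure (M.vecMeasure ψ) :=
  ⟨by rw [M.vecMeasure_apply ψ MeasurableSet.univ]; exact ENNReal.ofReal_lt_top⟩

/-- A POVM is determined by its vector measures. -/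
theorem ext_of_vecMeasure {M N : POVM H X} (h : ∀ ψ, M.vecMeasure ψ = N.vecMeasure ψ) : M = N := by
  have key : M.eff = N.eff := by
    funext A
    by_cases hA : MeasurableSet A
    · apply ContinuousLinearMap.coe_injective
      refine (ext_inner_map _ _).mp fun ψ => ?_
      change ⟪M.eff A ψ, ψ⟫_ℂ = ⟪N.eff A ψ, ψ⟫_ℂ
      rw [← inner_conj_symm, ← inner_conj_symm (N.eff A ψ)]
      exact congrArg _ (by rw [M.inner_eff_eq ψ hA, N.inner_eff_eq ψ hA, h])
    · rw [M.not_measurable A hA, N.not_measurable A hA]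
  cases M; cases N; congr

theorem vecMeasure_map (M : POVM H X) (f : X → Y) (hf : Measurable f) (ψ : H) :
    (M.map f hf).vecMeasure ψ = (M.vecMeasure ψ).map f := by
  ext A hA
  rw [Measure.map_apply hf hA, vecMeasure_apply _ _ hA, vecMeasure_apply _ _ (hf hA)]
  simp [map, hA]

theorem vecMeasure_conj (M : POVM H X) (U : H ≃ₗᵢ[ℂ] H) (ψ : H) :
    (M.conj U).vecMeasure ψ = M.vecMeasure (U ψ) := by
  ext A hA
  rw [vecMeasure_apply _ _ hA, vecMeasure_apply _ _ hA]
  congr 2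
  rw [← U.inner_map_map ψ]
  simp [conj]

theorem dist_eq_sum (M : POVM H X) (ρ : State H) :
    M.dist ρ = Measure.sum (fun i => M.vecMeasure (CFC.sqrt ρ.op (basis H i))) := by
  ext A hA
  rw [M.dist_apply ρ hA, M.ofReal_tr_eq ρ hA]

instance (M : POVM H X) (ρ : State H) : IsProbabilityMeasure (M.dist ρ) := by
  refine ⟨?_⟩
  rw [M.dist_apply ρ MeasurableSet.univ, M.univ, mul_one, tr, ρ.trace_one.tsum_eq]
  simp

/-- `T` is the operator `∫ f dM`, the integral being taken in the weak sense. -/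
def HasIntegral (M : POVM H X) (f : X → ℂ) (T : H →L[ℂ] H) : Prop :=
  ∀ ψ : H, ∫ x, f x ∂(M.vecMeasure ψ) = ⟪ψ, T ψ⟫_ℂ

theorem HasIntegral.map {M : POVM H X} {g : X → Y} (hg : Measurable g) {f : Y → ℂ}
    (hf : Measurable f) {T : H →L[ℂ] H} (h : M.HasIntegral (fun x => f (g x)) T) :
    (M.map g hg).HasIntegral f T := by
  intro ψ
  rw [vecMeasure_map, integral_map hg.aemeasurable hf.aestronglyMeasurable]
  exact h ψ

theorem HasIntegral.of_map {M : POVM H X} {g : X → Y} (hg : Measurable g) {f : Y → ℂ}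
    (hf : Measurable f) {T : H →L[ℂ] H} (h : (M.map g hg).HasIntegral f T) :
    M.HasIntegral (fun x => f (g x)) T := by
  intro ψ
  rw [← h ψ, vecMeasure_map, integral_map hg.aemeasurable hf.aestronglyMeasurable]

theorem HasIntegral.conj {M : POVM H X} {f : X → ℂ} {T T' : H →L[ℂ] H} (U : H ≃ₗᵢ[ℂ] H)
    (h : M.HasIntegral f T) (hU : ∀ ψ, T (U ψ) = U (T' ψ)) : (M.conj U).HasIntegral f T' := by
  intro ψ
  rw [vecMeasure_conj, h, hU, U.inner_map_map]

/-- A weak operator integral passes from vectors to statistical operators. -/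
theorem HasIntegral.integral_dist {M : POVM H X} {f : X → ℂ} {T : H →L[ℂ] H}
    (h : M.HasIntegral f T) (hf : Measurable f) {C : ℝ} (hC : ∀ x, ‖f x‖ ≤ C) (ρ : State H) :
    ∫ x, f x ∂(M.dist ρ) = tr (ρ.op * T) := by
  have hint : Integrable f (M.dist ρ) :=
    Integrable.of_bound hf.aestronglyMeasurable C (Filter.Eventually.of_forall hC)
  obtain ⟨S, hS0, hSS, hS, hs⟩ := ρ.exists_sqrt
  obtain ⟨t, h1, h2⟩ := hasSum_diag_swap (basis H) (basis H) S T hS hs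
  rw [hSS] at h1
  rw [M.dist_eq_sum ρ] at hint ⊢
  have h3 := hasSum_integral_measure hint
  simp only [h _, ← hS0] at h3
  rw [← hS0, h3.unique h2, tr, h1.tsum_eq]

/-- Every isometry `V` into an `L²` space compresses the multiplication operators by indicator
functions to a POVM `A ↦ V* 1_A V`, whose vector measures have density `|V ψ|²`. -/
theorem exists_of_isometry {μ : Measure X} (V : H →ₗᵢ[ℂ] Lp ℂ 2 μ) :
    ∃ M : POVM H X, ∀ ψ, M.vecMeasure ψ = μ.withDensity fun x => ‖V ψ x‖ₑ ^ 2 := by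
  classical
  have hmem : ∀ {A : Set X}, MeasurableSet A → MemLp (A.indicator fun _ => (1 : ℂ)) ∞ μ :=
    fun hA => (memLp_top_const 1).indicator hA
  let P : ∀ A : Set X, MeasurableSet A → (Lp ℂ 2 μ →L[ℂ] Lp ℂ 2 μ) := fun A hA =>
    (ContinuousLinearMap.mul ℂ ℂ).holderL μ ∞ 2 2 (hmem hA).toLp
  have hP : ∀ A (hA : MeasurableSet A) (f : Lp ℂ 2 μ),
      P A hA f =ᵐ[μ] fun x => A.indicator (fun _ => (1 : ℂ)) x * f x := by
    intro A hA f
    filter_upwards [(ContinuousLinearMap.mul ℂ ℂ).coeFn_holder (r := 2) (hmem hA).toLp f,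
      (hmem hA).coeFn_toLp] with x h2 h3
    rw [h3] at h2
    exact h2
  have hint : ∀ f : Lp ℂ 2 μ, Integrable (fun x => ‖f x‖ ^ 2) μ := fun f =>
    (memLp_two_iff_integrable_sq_norm (Lp.memLp f).1).mp (Lp.memLp f)
  have hPi : ∀ A (hA : MeasurableSet A) (f : Lp ℂ 2 μ),
      ⟪f, P A hA f⟫_ℂ = ((∫ x in A, ‖f x‖ ^ 2 ∂μ : ℝ) : ℂ) := by
    intro A hA f
    rw [L2.inner_def, ← integral_indicator hA, ← integral_complex_ofReal]
    refine integral_congr_ae ?_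
    filter_upwards [hP A hA f] with x hx
    rw [hx, RCLike.inner_apply, mul_assoc, Complex.mul_conj, Complex.normSq_eq_norm_sq]
    by_cases hxA : x ∈ A <;> simp [hxA]
  have hE : ∀ A (hA : MeasurableSet A) (ψ : H),
      ⟪ψ, (V.toContinuousLinearMap.adjoint ∘L P A hA ∘L V.toContinuousLinearMap) ψ⟫_ℂ
        = ((∫ x in A, ‖V ψ x‖ ^ 2 ∂μ : ℝ) : ℂ) := by
    intro A hA ψ
    simp only [ContinuousLinearMap.comp_apply, ContinuousLinearMap.adjoint_inner_right]
    exact hPi A hA (V ψ)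
  let M : POVM H X :=
    { eff := fun A => if hA : MeasurableSet A then
        V.toContinuousLinearMap.adjoint ∘L P A hA ∘L V.toContinuousLinearMap else 0
      pos := fun A hA => by
        rw [dif_pos hA, ContinuousLinearMap.isPositive_iff_complex]
        intro ψ
        rw [← inner_conj_symm, hE A hA ψ]
        refine ⟨by simp, ?_⟩
        simp only [Complex.conj_ofReal]
        change 0 ≤ ∫ x in A, ‖V ψ x‖ ^ 2 ∂μ
        exact integral_nonneg fun x => by positivity
      univ := by
        rw [dif_pos MeasurableSet.univ]
        apply ContinuousLinearMap.coe_injective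
        refine (ext_inner_map _ _).mp fun ψ => ?_
        rw [← inner_conj_symm]
        change starRingEnd ℂ ⟪ψ, (V.toContinuousLinearMap.adjoint ∘L P _ MeasurableSet.univ ∘L
          V.toContinuousLinearMap) ψ⟫_ℂ = ⟪ψ, ψ⟫_ℂ
        rw [hE _ MeasurableSet.univ ψ, Complex.conj_ofReal, ← V.inner_map_map, L2.inner_def,
          setIntegral_univ, ← integral_complex_ofReal]
        refine integral_congr_ae (Filter.Eventually.of_forall fun x => ?_)
        simp only [RCLike.inner_apply]
        rw [Complex.mul_conj, Complex.normSq_eq_norm_sq]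
      iUnion := fun A hA hd ψ => by
        simp only [dif_pos (hA _), dif_pos (MeasurableSet.iUnion hA)]
        rw [hE _ (MeasurableSet.iUnion hA), funext fun i => hE _ (hA i) ψ]
        exact Complex.hasSum_ofReal.mpr (hasSum_integral_iUnion hA hd (hint (V ψ)).integrableOn)
      not_measurable := fun A hA => by rw [dif_neg hA] }
  refine ⟨M, fun ψ => ?_⟩
  ext A hA
  rw [M.vecMeasure_apply ψ hA, withDensity_apply _ hA]
  have h1 : M.eff A = V.toContinuousLinearMap.adjoint ∘L P A hA ∘L V.toContinuousLinearMap :=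
    dif_pos hA
  rw [h1, hE A hA ψ, Complex.ofReal_re,
    ofReal_integral_eq_lintegral_ofReal (hint (V ψ)).integrableOn
      (Filter.Eventually.of_forall fun x => by positivity)]
  refine lintegral_congr fun x => ?_
  rw [ENNReal.ofReal_pow (norm_nonneg _), ofReal_norm]

end POVM

/-- The pure state `|φ⟩⟨φ|` of a unit vector `φ`. -/
def pureState (φ : H) (hφ : ‖φ‖ = 1) : State H where
  op := InnerProductSpace.rankOne ℂ φ φ
  pos := InnerProductSpace.isPositive_rankOne_self φ
  trace_one := by
    have h := (basis H).hasSum_inner_mul_inner φ φ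
    rw [inner_self_eq_norm_sq_to_K, hφ] at h
    simpa [inner_smul_right] using h

theorem tr_pureState_mul (φ : H) (hφ : ‖φ‖ = 1) (T : H →L[ℂ] H) :
    tr ((pureState φ hφ).op * T) = ⟪φ, T φ⟫_ℂ := by
  have h := (basis H).hasSum_inner_mul_inner (ContinuousLinearMap.adjoint T φ) φ
  rw [ContinuousLinearMap.adjoint_inner_left] at h
  rw [tr, ← h.tsum_eq]
  refine tsum_congr fun i => ?_
  simp [pureState, ContinuousLinearMap.adjoint_inner_left]

namespace POVM

theorem measurable_char (k l : ℝ) :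
    Measurable fun z : ℝ × ℝ => Complex.exp (Complex.I * (k * z.1 + l * z.2)) := by
  fun_prop

/-- A finite measure on the plane is determined by its characteristic function. -/
theorem ext_of_integral_char {μ ν : Measure (ℝ × ℝ)} [IsFiniteMeasure μ] [IsFiniteMeasure ν]
    (h : ∀ k l : ℝ, ∫ z, Complex.exp (Complex.I * (k * z.1 + l * z.2)) ∂μ
      = ∫ z, Complex.exp (Complex.I * (k * z.1 + l * z.2)) ∂ν) : μ = ν := by
  refine Measure.ext_of_charFunDual ?_
  funext L
  have e : ∀ z : ℝ × ℝ, Complex.exp (L z * Complex.I)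
      = Complex.exp (Complex.I * ((L (1, 0) : ℝ) * z.1 + (L (0, 1) : ℝ) * z.2)) := by
    intro z
    have : L z = L (1, 0) * z.1 + L (0, 1) * z.2 := by
      conv_lhs => rw [show z = z.1 • ((1 : ℝ), (0 : ℝ)) + z.2 • ((0 : ℝ), (1 : ℝ)) by ext <;> simp]
      rw [map_add, map_smul, map_smul]; simp [mul_comm]
    rw [this]; push_cast; ring_nf
  rw [charFunDual_apply, charFunDual_apply]
  simp only [e]
  exact h _ _

/-- A bi-observable is determined by its characteristic operators. -/
theorem ext_of_hasCharOp {M N : POVM H (ℝ × ℝ)} {T : ℝ → ℝ → H →L[ℂ] H}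
    (hM : ∀ k l, M.HasCharOp k l (T k l)) (hN : ∀ k l, N.HasCharOp k l (T k l)) : M = N :=
  ext_of_vecMeasure fun ψ => ext_of_integral_char fun k l => by rw [hM, hN]

end POVM

end Abstract

variable {n : ℕ} {ħ : ℝ}

/-! ### Weyl relations -/

theorem ae_comp_sub {f g : E n → ℂ} (h : f =ᵐ[volume] g) (x : E n) :
    ∀ᵐ y ∂(volume : Measure (E n)), f (y - x) = g (y - x) :=
  (measurePreserving_sub_right volume x).quasiMeasurePreserving.tendsto_ae.eventually h

theorem weyl_zero (ħ : ℝ) : weyl ħ (0 : E n) 0 = 1 := by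
  ext1 ψ
  apply Lp.ext
  filter_upwards [weyl_coeFn ħ 0 0 ψ] with y hy
  rw [hy]; simp

theorem weyl_comp (x p x' p' : E n) (ψ : L2 n) :
    weyl ħ x p (weyl ħ x' p' ψ) =
      Complex.exp (Complex.I / ħ * (((⟪p, x'⟫_ℝ - ⟪x, p'⟫_ℝ) / 2 : ℝ) : ℂ)) •
        weyl ħ (x + x') (p + p') ψ := by
  apply Lp.ext
  filter_upwards [weyl_coeFn ħ x p (weyl ħ x' p' ψ), ae_comp_sub (weyl_coeFn ħ x' p' ψ) x,
    weyl_coeFn ħ (x + x') (p + p') ψ, Lp.coeFn_smul (Complex.exp (Complex.I / ħ *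
      (((⟪p, x'⟫_ℝ - ⟪x, p'⟫_ℝ) / 2 : ℝ) : ℂ))) (weyl ħ (x + x') (p + p') ψ)] with y h1 h2 h3 h4
  rw [h1, h2, h4, Pi.smul_apply, h3, smul_eq_mul, ← mul_assoc, ← mul_assoc, ← Complex.exp_add,
    ← Complex.exp_add, sub_sub]
  congr 2
  rw [← mul_add, ← mul_add, ← Complex.ofReal_add, ← Complex.ofReal_add]
  congr 2
  simp only [inner_add_left, inner_add_right, inner_sub_right]
  rw [real_inner_comm x p', real_inner_comm p x']
  ring

theorem weyl_comp_neg (x p : E n) (ψ : L2 n) : weyl ħ x p (weyl ħ (-x) (-p) ψ) = ψ := by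
  rw [weyl_comp]
  simp [weyl_zero, real_inner_comm]

theorem norm_weyl (x p : E n) (ψ : L2 n) : ‖weyl ħ x p ψ‖ = ‖ψ‖ := by
  have h := (Lp.compMeasurePreservingₗᵢ ℂ (fun y : E n => y - x)
      (measurePreserving_sub_right volume x)).norm_map ψ
  rw [← h, Lp.norm_def, Lp.norm_def]
  congr 1
  refine eLpNorm_congr_norm_ae ?_
  filter_upwards [weyl_coeFn ħ x p ψ,
    Lp.coeFn_compMeasurePreserving ψ (measurePreserving_sub_right volume x)] with y h1 h2
  have h3 : (Lp.compMeasurePreservingₗᵢ ℂ (fun y : E n => y - x)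
      (measurePreserving_sub_right volume x) ψ : L2 n) y = ψ (y - x) := h2
  rw [h1, h3, norm_mul, Complex.norm_exp]
  simp

/-- Weyl operators are unitary. -/
theorem inner_weyl_weyl (x p : E n) (ψ χ : L2 n) :
    ⟪weyl ħ x p ψ, weyl ħ x p χ⟫_ℂ = ⟪ψ, χ⟫_ℂ :=
  LinearIsometry.inner_map_map ⟨(weyl ħ x p : L2 n →ₗ[ℂ] L2 n), norm_weyl x p⟩ ψ χ

theorem adjoint_weyl (x p : E n) : ContinuousLinearMap.adjoint (weyl ħ x p) = weyl ħ (-x) (-p) := by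
  refine (ContinuousLinearMap.eq_adjoint_iff _ _).mpr (fun ψ χ => ?_) |>.symm
  conv_rhs => rw [← weyl_comp_neg (ħ := ħ) x p ψ]
  rw [inner_weyl_weyl]

/-- Conjugation of a Weyl operator by a Weyl operator yields a phase. -/
theorem weyl_conj (x p x' p' : E n) (ψ : L2 n) :
    weyl ħ x p (weyl ħ x' p' (weyl ħ (-x) (-p) ψ)) =
      Complex.exp (Complex.I / ħ * ((⟪p, x'⟫_ℝ - ⟪x, p'⟫_ℝ : ℝ) : ℂ)) • weyl ħ x' p' ψ := by
  rw [weyl_comp x' p', map_smul, weyl_comp, smul_smul, ← Complex.exp_add, ← mul_add,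
    ← Complex.ofReal_add]
  congr 1
  · congr 3
    simp only [inner_add_right, inner_neg_right]
    rw [real_inner_comm p' x, real_inner_comm x' p, real_inner_comm p x]
    ring
  · simp

theorem weylPhase_neg_Omega (w : Phase n) :
    weylPhase ħ (-(Omega n ħ).mulVec w) =
      weyl ħ (-ħ • WithLp.toLp 2 fun i => w (Sum.inr i)) (ħ • WithLp.toLp 2 fun i => w (Sum.inl i)) := by
  unfold weylPhase Omega
  rw [← Sum.elim_comp_inl_inr w, Matrix.fromBlocks_mulVec]
  congr 1 <;> ext i <;> simp [Matrix.neg_mulVec, Matrix.smul_mulVec]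

/-! ### Chirps -/

/-- Multiplication by a unimodular function, as a unitary operator. -/
def mulUnitary (θ : E n → ℝ) (hθ : Measurable θ) : L2 n ≃ₗᵢ[ℂ] L2 n :=
  have hm : ∀ θ' : E n → ℝ, Measurable θ' →
      MemLp (fun y => Complex.exp (Complex.I * (θ' y : ℂ))) ∞ volume := fun θ' h =>
    memLp_top_of_bound (by fun_prop) 1 (Filter.Eventually.of_forall fun y => by
      rw [Complex.norm_exp]; simp)
  have hinv : ∀ (θ₁ θ₂ : E n → ℝ) (h₁ : Measurable θ₁) (h₂ : Measurable θ₂),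
      (∀ y, θ₁ y + θ₂ y = 0) → ∀ ψ : L2 n, mulOp _ (hm θ₁ h₁) (mulOp _ (hm θ₂ h₂) ψ) = ψ := by
    intro θ₁ θ₂ h₁ h₂ h0 ψ
    apply Lp.ext
    filter_upwards [mulOp_coeFn _ (hm θ₁ h₁) (mulOp _ (hm θ₂ h₂) ψ),
      mulOp_coeFn _ (hm θ₂ h₂) ψ] with y e1 e2
    rw [e1, e2, ← mul_assoc, ← Complex.exp_add, ← mul_add, ← Complex.ofReal_add, h0]
    simp
  { toFun := mulOp _ (hm θ hθ)
    invFun := mulOp _ (hm (fun y => -θ y) hθ.neg)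
    map_add' := map_add _
    map_smul' := map_smul _
    left_inv := hinv _ _ hθ.neg hθ fun y => by simp
    right_inv := hinv _ _ hθ hθ.neg fun y => by simp
    norm_map' := fun ψ => by
      change ‖mulOp _ (hm θ hθ) ψ‖ = ‖ψ‖
      rw [Lp.norm_def, Lp.norm_def]
      congr 1
      refine eLpNorm_congr_norm_ae ?_
      filter_upwards [mulOp_coeFn _ (hm θ hθ) ψ] with y e
      rw [e, norm_mul, Complex.norm_exp]
      simp }

theorem mulUnitary_coeFn (θ : E n → ℝ) (hθ : Measurable θ) (ψ : L2 n) :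
    mulUnitary θ hθ ψ =ᵐ[volume] fun y => Complex.exp (Complex.I * (θ y : ℂ)) * ψ y :=
  mulOp_coeFn _ _ ψ

/-- The chirp `exp{i t (u·Q)² / (2ħ)}`. -/
def chirp (ħ t : ℝ) (u : E n) : L2 n ≃ₗᵢ[ℂ] L2 n :=
  mulUnitary (fun y => t * ⟪u, y⟫_ℝ ^ 2 / (2 * ħ)) (by fun_prop)

/-- A chirp fixes the positions and shifts the momenta linearly in the positions. -/
theorem weyl_chirp (t : ℝ) (u x p : E n) (ψ : L2 n) :
    weyl ħ x p (chirp ħ t u ψ) = chirp ħ t u (weyl ħ x (p - (t * ⟪u, x⟫_ℝ) • u) ψ) := by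
  apply Lp.ext
  filter_upwards [weyl_coeFn ħ x p (chirp ħ t u ψ), ae_comp_sub (mulUnitary_coeFn _ _ ψ) x,
    mulUnitary_coeFn (fun y => t * ⟪u, y⟫_ℝ ^ 2 / (2 * ħ)) (by fun_prop)
      (weyl ħ x (p - (t * ⟪u, x⟫_ℝ) • u) ψ),
    weyl_coeFn ħ x (p - (t * ⟪u, x⟫_ℝ) • u) ψ] with y h1 h2 h3 h4
  unfold chirp at h1 ⊢
  rw [h1, h2, h3, h4, ← mul_assoc, ← mul_assoc, ← Complex.exp_add, ← Complex.exp_add]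
  congr 2
  simp only [inner_sub_left, inner_sub_right, inner_smul_left, inner_smul_right, real_inner_comm u x]
  push_cast
  by_cases h : (ħ : ℂ) = 0
  · simp [h]
  · field_simp
    simp
    ring

/-! ### The Fourier transform of square integrable functions -/

open FourierTransform in
/-- For integrable, square integrable functions the unitary Fourier transform is given by the
Fourier integral. -/
theorem fourierTransform_toLp {f : E n → ℂ} (hf : Integrable f) (hf2 : MemLp f 2 volume) :
    Lp.fourierTransformₗᵢ (E n) ℂ (hf2.toLp f) =ᵐ[volume] 𝓕 f := by
  refine ae_eq_of_integral_contDiff_smul_eq ((Lp.memLp _).locallyIntegrable one_le_two)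
    (Continuous.locallyIntegrable ?_) fun g hg hgs => ?_
  · exact VectorFourier.fourierIntegral_continuous Real.continuous_fourierChar
      continuous_inner hf
  let G : SchwartzMap (E n) ℂ := HasCompactSupport.toSchwartzMap (f := fun x => (g x : ℂ))
    (hgs.comp_left (g := fun r : ℝ => (r : ℂ)) rfl) (Complex.ofRealCLM.contDiff.comp hg)
  have h := congrArg (fun T => T G) (Lp.fourier_toTemperedDistribution_eq (hf2.toLp f))
  simp only [TemperedDistribution.fourier_apply, Lp.toTemperedDistribution_apply] at h
  have e1 : ∫ x, g x • (Lp.fourierTransformₗᵢ (E n) ℂ (hf2.toLp f)) x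
      = ∫ x, G x • (𝓕 (hf2.toLp f) : L2 n) x := rfl
  rw [e1, ← h]
  have e2 : ∫ x, (𝓕 G : SchwartzMap (E n) ℂ) x • (hf2.toLp f) x
      = ∫ x, (𝓕 G : SchwartzMap (E n) ℂ) x • f x := by
    refine integral_congr_ae ?_
    filter_upwards [hf2.coeFn_toLp] with x hx
    rw [hx]
  rw [e2, SchwartzMap.fourier_coe]
  have h3 := VectorFourier.integral_fourierIntegral_smul_eq_flip (L := innerₗ (E n))
    (μ := volume) (ν := volume) (f := G) (g := f) Real.continuous_fourierChar continuous_inner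
    G.integrable hf
  rw [flip_innerₗ] at h3
  exact h3

open FourierTransform in
/-- The Fourier transform exchanges positions and momenta. -/
theorem weyl_fourier (hħ : ħ ≠ 0) (x p : E n) (ψ : L2 n) :
    weyl ħ x p (Lp.fourierTransformₗᵢ (E n) ℂ ψ) =
      Lp.fourierTransformₗᵢ (E n) ℂ
        (weyl ħ (-(2 * Real.pi * ħ)⁻¹ • p) ((2 * Real.pi * ħ) • x) ψ) := by
  refine (SchwartzMap.denseRange_toLpCLM (F := ℂ) (μ := (volume : Measure (E n)))
    (p := 2) ENNReal.ofNat_ne_top).induction_on ψ (isClosed_eq ?_ ?_) fun f => ?_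
  · exact (weyl ħ x p).continuous.comp (Lp.fourierTransformₗᵢ (E n) ℂ).continuous
  · exact (Lp.fourierTransformₗᵢ (E n) ℂ).continuous.comp (weyl ħ _ _).continuous
  set q : E n := (2 * Real.pi * ħ)⁻¹ • p with hq
  have hp : p = (2 * Real.pi * ħ) • q := by
    rw [hq, smul_smul, mul_inv_cancel₀ (by positivity), one_smul]
  have hf1 : Integrable (f : E n → ℂ) := f.integrable
  have hf2 : MemLp (f : E n → ℂ) 2 volume := f.memLp 2 volume
  let g : E n → ℂ := fun y => Complex.exp ((Complex.I / ħ) *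
    ((⟪(2 * Real.pi * ħ) • x, y⟫_ℝ - ⟪-q, (2 * Real.pi * ħ) • x⟫_ℝ / 2 : ℝ) : ℂ)) * f (y + q)
  have hgn : ∀ y, ‖g y‖ = ‖f (y + q)‖ := fun y => by
    simp only [g]
    rw [norm_mul, Complex.norm_exp]
    simp
  have hgm : AEStronglyMeasurable g volume := by
    have := f.continuous
    exact Continuous.aestronglyMeasurable (by fun_prop)
  have hg1 : Integrable g :=
    (hf1.comp_add_right q).mono hgm (Filter.Eventually.of_forall fun y => (hgn y).le)
  have hg2 : MemLp g 2 volume :=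
    (hf2.comp_measurePreserving (measurePreserving_add_right volume q)).of_le hgm
      (Filter.Eventually.of_forall fun y => (hgn y).le)
  have e1 : SchwartzMap.toLpCLM ℝ ℂ 2 volume f = hf2.toLp f := rfl
  have e2 : weyl ħ (-(2 * Real.pi * ħ)⁻¹ • p) ((2 * Real.pi * ħ) • x) (hf2.toLp f)
      = hg2.toLp g := by
    apply Lp.ext
    rw [neg_smul, ← hq]
    filter_upwards [weyl_coeFn ħ (-q) ((2 * Real.pi * ħ) • x) (hf2.toLp f),
      ae_comp_sub hf2.coeFn_toLp (-q), hg2.coeFn_toLp] with y h1 h2 h3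
    rw [h1, h2, h3, sub_neg_eq_add]
  rw [e1, e2]
  apply Lp.ext
  filter_upwards [weyl_coeFn ħ x p (Lp.fourierTransformₗᵢ (E n) ℂ (hf2.toLp f)),
    ae_comp_sub (fourierTransform_toLp hf1 hf2) x, fourierTransform_toLp hg1 hg2] with ξ h1 h2 h3
  rw [h1, h2, h3, Real.fourier_eq', Real.fourier_eq', ← integral_const_mul,
    ← integral_add_right_eq_self (fun y => _ * _) q]
  refine integral_congr_ae (Filter.Eventually.of_forall fun y => ?_)
  simp only [g, smul_eq_mul]
  rw [← mul_assoc, ← mul_assoc, ← Complex.exp_add, ← Complex.exp_add]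
  congr 2
  simp only [hp, inner_add_left, inner_neg_left, inner_sub_right, inner_smul_left, inner_smul_right,
    real_inner_comm y x, real_inner_comm q x]
  have : (ħ : ℂ) ≠ 0 := by exact_mod_cast hħ
  push_cast
  field_simp
  simp
  ring

/-! ### Position and momentum -/

theorem vecMeasure_position (ψ : L2 n) :
    (position n).vecMeasure ψ = volume.withDensity fun y => ‖ψ y‖ₑ ^ 2 := by
  have hint : Integrable (fun y => ‖ψ y‖ ^ 2) (volume : Measure (E n)) :=
    (memLp_two_iff_integrable_sq_norm (Lp.memLp ψ).1).mp (Lp.memLp ψ)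
  ext A hA
  rw [POVM.vecMeasure_apply _ ψ hA, withDensity_apply _ hA]
  have h1 : (position n).eff A = mulOp _ (memLp_indicator hA) := dif_pos hA
  have h2 : ⟪ψ, (position n).eff A ψ⟫_ℂ = ((∫ y in A, ‖ψ y‖ ^ 2 : ℝ) : ℂ) := by
    rw [h1, inner_mulOp, ← integral_indicator hA, ← integral_complex_ofReal]
    congr 1 with y
    by_cases hy : y ∈ A <;> simp [hy]
  rw [h2, Complex.ofReal_re, ofReal_integral_eq_lintegral_ofReal hint.integrableOn
      (Filter.Eventually.of_forall fun x => by positivity)]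
  refine lintegral_congr fun x => ?_
  rw [ENNReal.ofReal_pow (norm_nonneg _), ofReal_norm]

theorem integral_withDensity_enorm_sq {X : Type*} [MeasurableSpace X] {μ : Measure X} (g f : X → ℂ)
    (hg : AEStronglyMeasurable g μ) :
    ∫ x, f x ∂(μ.withDensity fun x => ‖g x‖ₑ ^ 2) = ∫ x, ((‖g x‖ ^ 2 : ℝ) : ℂ) * f x ∂μ := by
  rw [integral_withDensity_eq_integral_toReal_smul₀ (by fun_prop)
    (Filter.Eventually.of_forall fun x => by simp)]
  refine integral_congr_ae (Filter.Eventually.of_forall fun x => ?_)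
  simp

theorem position_hasIntegral (hħ : ħ ≠ 0) (a : E n) :
    (position n).HasIntegral (fun y => Complex.exp (Complex.I * ⟪a, y⟫_ℝ)) (weyl ħ 0 (ħ • a)) := by
  intro ψ
  have : (ħ : ℂ) ≠ 0 := by exact_mod_cast hħ
  rw [vecMeasure_position, integral_withDensity_enorm_sq _ _ (Lp.memLp ψ).1, L2.inner_def]
  refine integral_congr_ae ?_
  filter_upwards [weyl_coeFn ħ 0 (ħ • a) ψ] with y hy
  rw [hy, RCLike.inner_apply, sub_zero, mul_assoc, Complex.mul_conj, Complex.normSq_eq_norm_sq,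
    mul_comm]
  congr 2
  simp only [inner_smul_left, inner_zero_left]
  push_cast
  field_simp
  simp

theorem momentum_hasIntegral (hħ : ħ ≠ 0) (b : E n) :
    (momentum n ħ).HasIntegral (fun y => Complex.exp (Complex.I * ⟪b, y⟫_ℝ))
      (weyl ħ (-ħ • b) 0) := by
  refine POVM.HasIntegral.map _ (by fun_prop) ?_
  have h := (position_hasIntegral hħ ((2 * Real.pi * ħ) • b)).conj
    (Lp.fourierTransformₗᵢ (E n) ℂ) (T' := weyl ħ (-ħ • b) 0) fun ψ => by
      rw [weyl_fourier hħ]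
      rw [smul_zero, smul_smul, smul_smul]
      congr 3
      field_simp
  simpa only [real_inner_smul_left, real_inner_smul_right] using h

theorem positionAlong_hasIntegral (hħ : ħ ≠ 0) (u : E n) (k : ℝ) :
    (positionAlong u).HasIntegral (fun y => Complex.exp (Complex.I * ((k * y : ℝ) : ℂ)))
      (weyl ħ 0 (ħ • k • u)) := by
  refine POVM.HasIntegral.map _ (by fun_prop) ?_
  simpa only [real_inner_smul_left] using position_hasIntegral hħ (k • u)

theorem momentumAlong_hasIntegral (hħ : ħ ≠ 0) (v : E n) (l : ℝ) :
    (momentumAlong ħ v).HasIntegral (fun y => Complex.exp (Complex.I * ((l * y : ℝ) : ℂ)))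
      (weyl ħ (-ħ • l • v) 0) := by
  refine POVM.HasIntegral.map _ (by fun_prop) ?_
  simpa only [real_inner_smul_left] using momentum_hasIntegral hħ (l • v)

/-! ### Covariance and characteristic operators -/

/-- Covariance in terms of the vector measures. -/
theorem POVM.isCovariant_iff {M : POVM (L2 n) (ℝ × ℝ)} {u v : E n} :
    IsCovariant ħ u v M ↔ ∀ (x p : E n) (ψ : L2 n), M.vecMeasure ψ =
      (M.vecMeasure (weyl ħ (-x) (-p) ψ)).map fun z => z + (⟪u, x⟫_ℝ, ⟪v, p⟫_ℝ) := by
  have key : ∀ (x p : E n) (Z : Set (ℝ × ℝ)) (ψ : L2 n),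
      ⟪ψ, (weyl ħ x p ∘L M.eff Z ∘L ContinuousLinearMap.adjoint (weyl ħ x p)) ψ⟫_ℂ
        = ⟪weyl ħ (-x) (-p) ψ, M.eff Z (weyl ħ (-x) (-p) ψ)⟫_ℂ := by
    intro x p Z ψ
    simp only [ContinuousLinearMap.comp_apply]
    rw [← ContinuousLinearMap.adjoint_inner_left, adjoint_weyl]
  have hsurj : ∀ s : ℝ × ℝ, Function.Surjective fun z : ℝ × ℝ => z + s := fun s z =>
    ⟨z - s, by simp⟩
  have hm : ∀ s : ℝ × ℝ, Measurable fun z : ℝ × ℝ => z + s := fun s => measurable_add_const s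
  constructor
  · intro h x p ψ
    ext A hA
    rw [Measure.map_apply (hm _) hA, M.vecMeasure_apply _ hA, M.vecMeasure_apply _ (hm _ hA),
      ← key x p, h _ (hm _ hA) x p, Set.image_preimage_eq _ (hsurj _)]
  · intro h Z hZ x p
    have hZ' : MeasurableSet ((fun z => z + (⟪u, x⟫_ℝ, ⟪v, p⟫_ℝ)) '' Z) :=
      (MeasurableEquiv.addRight (⟪u, x⟫_ℝ, ⟪v, p⟫_ℝ)).measurableSet_image.mpr hZ
    apply ContinuousLinearMap.coe_injective
    refine (ext_inner_map _ _).mp fun ψ => ?_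
    rw [← inner_conj_symm, ← inner_conj_symm (ContinuousLinearMap.toLinearMap _ ψ)]
    congr 1
    refine (key x p Z ψ).trans ?_
    refine Eq.trans ?_ (M.inner_eff_eq ψ hZ').symm
    rw [M.inner_eff_eq _ hZ, h x p ψ, Measure.map_apply (hm _) hZ',
      Set.preimage_image_eq _ (add_left_injective _)]

theorem integral_char_map_add (μ : Measure (ℝ × ℝ)) (s : ℝ × ℝ) (k l : ℝ) :
    ∫ z, Complex.exp (Complex.I * (k * z.1 + l * z.2)) ∂(μ.map fun z => z + s)
      = Complex.exp (Complex.I * ((k * s.1 + l * s.2 : ℝ) : ℂ)) *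
        ∫ z, Complex.exp (Complex.I * (k * z.1 + l * z.2)) ∂μ := by
  rw [integral_map (measurable_add_const s).aemeasurable
    (POVM.measurable_char k l).aestronglyMeasurable, ← integral_const_mul]
  refine integral_congr_ae (Filter.Eventually.of_forall fun z => ?_)
  simp only [Prod.fst_add, Prod.snd_add]
  rw [← Complex.exp_add]
  congr 1
  push_cast
  ring

/-- The Weyl operator `exp{i (k u·Q + l v·P)}`. -/
def weylUV (ħ : ℝ) (u v : E n) (k l : ℝ) : L2 n →L[ℂ] L2 n := weyl ħ (-ħ • l • v) (ħ • k • u)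

/-- A bi-observable whose characteristic operators are multiples of `exp{i (k u·Q + l v·P)}` is
covariant. -/
theorem isCovariant_of_hasCharOp (hħ : ħ ≠ 0) {M : POVM (L2 n) (ℝ × ℝ)} {u v : E n} (c : ℝ → ℝ → ℂ)
    (h : ∀ k l, M.HasCharOp k l (c k l • weylUV ħ u v k l)) : IsCovariant ħ u v M := by
  rw [POVM.isCovariant_iff]
  intro x p ψ
  refine POVM.ext_of_integral_char fun k l => ?_
  rw [integral_char_map_add, h, h, ← adjoint_weyl, ContinuousLinearMap.adjoint_inner_left,
    adjoint_weyl]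
  simp only [smul_apply, map_smul, weylUV, weyl_conj, inner_smul_right]
  rw [← mul_assoc, mul_comm _ (c k l), mul_assoc, ← mul_assoc (Complex.exp _), ← Complex.exp_add]
  have : Complex.I * ((k * ⟪u, x⟫_ℝ + l * ⟪v, p⟫_ℝ : ℝ) : ℂ) + Complex.I / ħ *
      ((-ħ * (l * ⟪p, v⟫_ℝ) - ħ * (k * ⟪x, u⟫_ℝ) : ℝ) : ℂ) = 0 := by
    have : (ħ : ℂ) ≠ 0 := by exact_mod_cast hħ
    simp only [real_inner_comm v p, real_inner_comm u x]
    push_cast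
    field_simp
    ring
  rw [this, Complex.exp_zero, one_mul]

theorem eq_zero_of_exp_smul {θ : ℝ} (h : ∀ t : ℝ, Complex.exp (Complex.I * ((t * θ : ℝ) : ℂ)) = 1) :
    θ = 0 := by
  by_contra hθ
  have h1 := h (Real.pi / θ)
  rw [div_mul_cancel₀ _ hθ, mul_comm, Complex.exp_pi_mul_I] at h1
  norm_num at h1

theorem exists_L2_ne_zero (n : ℕ) : ∃ ψ : L2 n, ψ ≠ 0 := by
  refine ⟨indicatorConstLp 2 (measurableSet_ball (x := (0 : E n)) (ε := 1))
    measure_ball_lt_top.ne 1, ?_⟩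
  rw [← norm_ne_zero_iff, norm_indicatorConstLp (by simp) (by simp)]
  have := Metric.measure_ball_pos (volume : Measure (E n)) (0 : E n) one_pos
  have h2 : 0 < (volume : Measure (E n)).real (Metric.ball 0 1) :=
    ENNReal.toReal_pos this.ne' measure_ball_lt_top.ne
  exact mul_ne_zero (by simp) (Real.rpow_pos_of_pos h2 _).ne'

/-- Covariance determines which Weyl operators occur as characteristic operators: comparing the
phases picked up under translations by all `(x, p)` identifies the phase space vector. -/
theorem eq_smul_of_isCovariant (hħ : ħ ≠ 0) {M : POVM (L2 n) (ℝ × ℝ)} {u v : E n}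
    (hM : IsCovariant ħ u v M) {k l : ℝ} {c : ℂ} (hc : c ≠ 0) {w₁ w₂ : E n}
    (h : M.HasCharOp k l (c • weyl ħ (-ħ • w₂) (ħ • w₁))) : w₁ = k • u ∧ w₂ = l • v := by
  rw [POVM.isCovariant_iff] at hM
  have h1 : ∀ x p : E n, Complex.exp (Complex.I * ((k * ⟪u, x⟫_ℝ + l * ⟪v, p⟫_ℝ : ℝ) : ℂ)) •
      (weyl ħ x p ∘L (c • weyl ħ (-ħ • w₂) (ħ • w₁)) ∘L weyl ħ (-x) (-p))
        = c • weyl ħ (-ħ • w₂) (ħ • w₁) := by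
    intro x p
    apply ContinuousLinearMap.coe_injective
    refine (ext_inner_map _ _).mp fun ψ => ?_
    rw [← inner_conj_symm, ← inner_conj_symm (ContinuousLinearMap.toLinearMap _ ψ)]
    congr 1
    have e := h ψ
    rw [hM x p ψ, integral_char_map_add, h, ← adjoint_weyl,
      ContinuousLinearMap.adjoint_inner_left, adjoint_weyl] at e
    refine Eq.trans ?_ e
    exact inner_smul_right _ _ _
  have h2 : ∀ x p : E n, Complex.exp (Complex.I * ((⟪u, x⟫_ℝ * k + ⟪v, p⟫_ℝ * l
      - ⟪p, w₂⟫_ℝ - ⟪x, w₁⟫_ℝ : ℝ) : ℂ)) = 1 := by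
    intro x p
    obtain ⟨ψ, hψ⟩ := exists_L2_ne_zero n
    have e := congrArg (fun T : L2 n →L[ℂ] L2 n => T ψ) (h1 x p)
    simp only [smul_apply, ContinuousLinearMap.comp_apply, map_smul,
      weyl_conj, smul_smul] at e
    have hne : weyl ħ (-ħ • w₂) (ħ • w₁) ψ ≠ 0 := by
      rw [← norm_ne_zero_iff, norm_weyl]
      exact norm_ne_zero_iff.mpr hψ
    have e2 := smul_left_injective ℂ hne e
    rw [mul_comm c, ← mul_assoc, ← Complex.exp_add] at e2
    rw [← mul_right_cancel₀ hc (e2.trans (one_mul c).symm)]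
    congr 1
    have : (ħ : ℂ) ≠ 0 := by exact_mod_cast hħ
    simp only [real_inner_smul_right]
    push_cast
    field_simp
    ring
  -- The phase is trivial on the whole line through the difference vector.
  have h3 : ‖k • u - w₁‖ ^ 2 + ‖l • v - w₂‖ ^ 2 = 0 := by
    refine eq_zero_of_exp_smul fun t => ?_
    rw [← h2 (t • (k • u - w₁)) (t • (l • v - w₂))]
    congr 3
    rw [← real_inner_self_eq_norm_sq, ← real_inner_self_eq_norm_sq]
    simp only [inner_sub_left, inner_sub_right, real_inner_smul_left, real_inner_smul_right,
      real_inner_comm u w₁, real_inner_comm v w₂]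
    ring
  have h4 : ‖k • u - w₁‖ = 0 := by nlinarith [sq_nonneg ‖k • u - w₁‖, sq_nonneg ‖l • v - w₂‖]
  have h5 : ‖l • v - w₂‖ = 0 := by nlinarith [sq_nonneg ‖k • u - w₁‖, sq_nonneg ‖l • v - w₂‖]
  exact ⟨(sub_eq_zero.mp (norm_eq_zero.mp h4)).symm, (sub_eq_zero.mp (norm_eq_zero.mp h5)).symm⟩

/-- The matrix `J` of a Gaussian `(u,v)`-covariant bi-observable. -/
def covMatrix (u v : E n) : Matrix (Fin 2) (Fin n ⊕ Fin n) ℝ :=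
  Matrix.of ![Sum.elim u 0, Sum.elim 0 v]

theorem weylPhase_covMatrix (u v : E n) (k l : ℝ) :
    weylPhase ħ (-(Omega n ħ).mulVec ((covMatrix u v).transpose.mulVec ![k, l]))
      = weylUV ħ u v k l := by
  rw [weylPhase_neg_Omega, weylUV]
  congr 2 <;>
  · congr 1
    ext i
    simp [covMatrix, Matrix.mulVec, dotProduct, Fin.sum_univ_two, mul_comm]

theorem covMatrix_mul_Omega (u v : E n) : covMatrix u v * Omega n ħ * (covMatrix u v).transpose
    = !![0, ħ * ⟪u, v⟫_ℝ; -(ħ * ⟪u, v⟫_ℝ), 0] := by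
  have hΩ : ∀ i j, (covMatrix u v * Omega n ħ) i j =
      ![Sum.elim (fun _ => 0) fun m => ħ * u m, Sum.elim (fun m => -(ħ * v m)) fun _ => 0] i j := by
    intro i j
    fin_cases i <;> rcases j with j | j <;>
      simp [Matrix.mul_apply, covMatrix, Omega, Matrix.one_apply, mul_comm]
  ext i j
  rw [Matrix.mul_apply]
  simp only [hΩ]
  fin_cases i <;> fin_cases j <;>
    simp [covMatrix, PiLp.inner_apply, Finset.mul_sum]
  all_goals exact Finset.sum_congr rfl fun _ _ => by ring

/-- The scalar factor `exp{i (k a + l b) - (k,l) V (k,l)ᵀ / 2}`. -/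
def gaussFactor (a b : ℝ) (V : Matrix (Fin 2) (Fin 2) ℝ) (k l : ℝ) : ℂ :=
  Complex.exp (Complex.I * (k * a + l * b) - ((![k, l] ⬝ᵥ V.mulVec ![k, l] : ℝ) : ℂ) / 2)

/-- Covariance determines the matrix `J` of a Gaussian bi-observable. -/
theorem IsGaussianBiObs.eq_covMatrix (hħ : ħ ≠ 0) {M : POVM (L2 n) (ℝ × ℝ)} {u v : E n}
    (hM : IsCovariant ħ u v M) {a b : ℝ} {V : Matrix (Fin 2) (Fin 2) ℝ}
    {J : Matrix (Fin 2) (Fin n ⊕ Fin n) ℝ} (h : IsGaussianBiObs ħ M a b V J) :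
    J = covMatrix u v := by
  have key : ∀ k l : ℝ,
      (WithLp.toLp 2 fun i => J.transpose.mulVec ![k, l] (Sum.inl i) : E n) = k • u ∧
      (WithLp.toLp 2 fun i => J.transpose.mulVec ![k, l] (Sum.inr i) : E n) = l • v := by
    intro k l
    have h1 := h.2.2.2 k l
    rw [weylPhase_neg_Omega] at h1
    exact eq_smul_of_isCovariant hħ hM (Complex.exp_ne_zero _) h1
  ext i j
  rcases j with j | j
  · have h0 := congrArg (fun x : E n => x j) (key 1 0).1
    have h1 := congrArg (fun x : E n => x j) (key 0 1).1
    fin_cases i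
    · simpa [Matrix.mulVec, dotProduct, Fin.sum_univ_two, covMatrix] using h0
    · simpa [Matrix.mulVec, dotProduct, Fin.sum_univ_two, covMatrix] using h1
  · have h0 := congrArg (fun x : E n => x j) (key 1 0).2
    have h1 := congrArg (fun x : E n => x j) (key 0 1).2
    fin_cases i
    · simpa [Matrix.mulVec, dotProduct, Fin.sum_univ_two, covMatrix] using h0
    · simpa [Matrix.mulVec, dotProduct, Fin.sum_univ_two, covMatrix] using h1

theorem IsGaussianBiObs.hasCharOp (hħ : ħ ≠ 0) {M : POVM (L2 n) (ℝ × ℝ)} {u v : E n}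
    (hM : IsCovariant ħ u v M) {a b : ℝ} {V : Matrix (Fin 2) (Fin 2) ℝ}
    {J : Matrix (Fin 2) (Fin n ⊕ Fin n) ℝ} (h : IsGaussianBiObs ħ M a b V J) (k l : ℝ) :
    M.HasCharOp k l (gaussFactor a b V k l • weylUV ħ u v k l) := by
  have h1 := h.2.2.2 k l
  rwa [h.eq_covMatrix hħ hM, weylPhase_covMatrix] at h1

/-- A Gaussian covariant bi-observable is determined by its parameters. -/
theorem eq_of_hasParams (hħ : ħ ≠ 0) {M N : POVM (L2 n) (ℝ × ℝ)} {u v : E n}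
    (hM : IsCovariant ħ u v M) (hN : IsCovariant ħ u v N) {a b : ℝ} {V : Matrix (Fin 2) (Fin 2) ℝ}
    (h : HasParams ħ M a b V) (h' : HasParams ħ N a b V) : M = N := by
  obtain ⟨J, h⟩ := h
  obtain ⟨J', h'⟩ := h'
  exact POVM.ext_of_hasCharOp (h.hasCharOp hħ hM) (h'.hasCharOp hħ hN)

open scoped ComplexOrder in
/-- The uncertainty relation between the noise variances of a covariant bi-observable. -/
theorem IsGaussianBiObs.noise_ineq (hħ : ħ ≠ 0) {M : POVM (L2 n) (ℝ × ℝ)} {u v : E n}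
    (hM : IsCovariant ħ u v M) {a b : ℝ} {V : Matrix (Fin 2) (Fin 2) ℝ}
    {J : Matrix (Fin 2) (Fin n ⊕ Fin n) ℝ} (h : IsGaussianBiObs ħ M a b V J) :
    0 ≤ V 0 0 ∧ 0 ≤ V 1 1 ∧ V 1 0 = V 0 1 ∧
      V 0 1 ^ 2 + (ħ / 2 * ⟪u, v⟫_ℝ) ^ 2 ≤ V 0 0 * V 1 1 := by
  have hs : V 1 0 = V 0 1 := h.1.apply 0 1
  have h1 := h.2.1
  rw [h.eq_covMatrix hħ hM, covMatrix_mul_Omega] at h1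
  have h00 := h1.diag_nonneg (i := 0)
  have h11 := h1.diag_nonneg (i := 1)
  have hdet := h1.det_nonneg
  rw [Matrix.det_fin_two] at hdet
  simp [Complex.le_def] at h00 h11 hdet
  refine ⟨h00, h11, hs, ?_⟩
  rw [hs] at hdet
  nlinarith [hdet.1]

open scoped ComplexOrder in
theorem posSemidef_fin_two {p q s : ℝ} (hp : 0 ≤ p) (hs : 0 ≤ s) (h : q ^ 2 ≤ p * s) :
    (!![(p : ℂ), Complex.I * q; -(Complex.I * q), (s : ℂ)]).PosSemidef := by
  refine Matrix.PosSemidef.of_dotProduct_mulVec_nonneg ?_ fun z => ?_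
  · ext i j
    fin_cases i <;> fin_cases j <;> simp
  · have e : star z ⬝ᵥ (!![(p : ℂ), Complex.I * q; -(Complex.I * q), (s : ℂ)]).mulVec z
        = ((p * ‖z 0‖ ^ 2 + s * ‖z 1‖ ^ 2
          + 2 * q * ((z 0).im * (z 1).re - (z 0).re * (z 1).im) : ℝ) : ℂ) := by
      rw [← Complex.normSq_eq_norm_sq, ← Complex.normSq_eq_norm_sq]
      simp only [Matrix.mulVec, dotProduct, Fin.sum_univ_two]
      apply Complex.ext <;> simp [Complex.normSq_apply] <;> ring
    rw [e]
    norm_cast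
    set d := (z 0).im * (z 1).re - (z 0).re * (z 1).im
    have hd : d ^ 2 ≤ ‖z 0‖ ^ 2 * ‖z 1‖ ^ 2 := by
      rw [← Complex.normSq_eq_norm_sq, ← Complex.normSq_eq_norm_sq]
      simp only [Complex.normSq_apply, d]
      nlinarith [sq_nonneg ((z 0).re * (z 1).re + (z 0).im * (z 1).im)]
    have h1 : (2 * q * d) ^ 2 ≤ (p * ‖z 0‖ ^ 2 + s * ‖z 1‖ ^ 2) ^ 2 := by
      have : q ^ 2 * d ^ 2 ≤ (p * s) * (‖z 0‖ ^ 2 * ‖z 1‖ ^ 2) :=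
        mul_le_mul h hd (sq_nonneg _) (mul_nonneg hp hs)
      nlinarith [sq_nonneg (p * ‖z 0‖ ^ 2 - s * ‖z 1‖ ^ 2)]
    have := abs_le_of_sq_le_sq' h1 (by positivity)
    linarith [this.1]

/-- A bi-observable with the right characteristic operators and uncorrelated noises obeying the
uncertainty relation is Gaussian and covariant. -/
theorem mem_gaussCov_of_hasCharOp (hħ : ħ ≠ 0) {M : POVM (L2 n) (ℝ × ℝ)} {u v : E n} {p s : ℝ}
    (hp : 0 ≤ p) (hs : 0 ≤ s) (hps : (ħ / 2 * ⟪u, v⟫_ℝ) ^ 2 ≤ p * s)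
    (h : ∀ k l, M.HasCharOp k l (gaussFactor 0 0 !![p, 0; 0, s] k l • weylUV ħ u v k l)) :
    M ∈ gaussCov ħ u v ∧ HasParams ħ M 0 0 !![p, 0; 0, s] := by
  have hG : IsGaussianBiObs ħ M 0 0 !![p, 0; 0, s] (covMatrix u v) := by
    refine ⟨?_, ?_, ?_, fun k l => ?_⟩
    · ext i j
      fin_cases i <;> fin_cases j <;> rfl
    · rw [covMatrix_mul_Omega]
      convert! posSemidef_fin_two hp hs hps using 1
      ext i j
      fin_cases i <;> fin_cases j <;> simp <;> ring
    · rw [covMatrix_mul_Omega]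
      convert! posSemidef_fin_two (q := -(ħ / 2 * ⟪u, v⟫_ℝ)) hp hs (by rwa [neg_sq]) using 1
      ext i j
      fin_cases i <;> fin_cases j <;> simp <;> ring
    · rw [weylPhase_covMatrix]
      exact h k l
  exact ⟨⟨isCovariant_of_hasCharOp hħ _ h, _, _, _, _, hG⟩, _, hG⟩

/-! ### The function `r(x) = ln(1 + x) - x / (1 + x)` -/

/-- The function `r(x) = ln(1 + x) - x / (1 + x)`, half of which is the relative entropy (in nats)
between a centred Gaussian of variance `s` and the one of variance `s + x s`. -/
def noiseFn (x : ℝ) : ℝ := Real.log (1 + x) - x / (1 + x)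

theorem noiseFn_lt {x y : ℝ} (hx : 0 ≤ x) (hxy : x < y) : noiseFn x < noiseFn y := by
  have h1 : 0 < 1 + x := by linarith
  have h2 : 0 < 1 + y := by linarith
  have h3 : Real.log ((1 + x) / (1 + y)) < (1 + x) / (1 + y) - 1 :=
    Real.log_lt_sub_one_of_pos (by positivity) (by
      rw [Ne, div_eq_one_iff_eq h2.ne']; linarith)
  rw [Real.log_div h1.ne' h2.ne'] at h3
  have h4 : (1 - (1 + x) / (1 + y)) - (y / (1 + y) - x / (1 + x))
      = x * (y - x) / ((1 + x) * (1 + y)) := by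
    field_simp; ring
  have h5 : 0 ≤ x * (y - x) / ((1 + x) * (1 + y)) := by
    have : 0 ≤ y - x := by linarith
    positivity
  unfold noiseFn
  linarith

theorem noiseFn_le {x y : ℝ} (hx : 0 ≤ x) (hxy : x ≤ y) : noiseFn x ≤ noiseFn y := by
  rcases hxy.eq_or_lt with rfl | h
  · exact le_rfl
  · exact (noiseFn_lt hx h).le

theorem noiseFn_zero : noiseFn 0 = 0 := by simp [noiseFn]

theorem noiseFn_nonneg {x : ℝ} (hx : 0 ≤ x) : 0 ≤ noiseFn x :=
  noiseFn_zero ▸ noiseFn_le le_rfl hx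

theorem eq_of_noiseFn_add {x y : ℝ} (hx : 0 ≤ x) (hy : 0 ≤ y) (h : noiseFn x + noiseFn y = 0) :
    x = 0 ∧ y = 0 := by
  have h1 := noiseFn_nonneg hx
  have h2 := noiseFn_nonneg hy
  constructor
  · rcases hx.eq_or_lt with h3 | h3
    · exact h3.symm
    · have := noiseFn_lt le_rfl h3
      rw [noiseFn_zero] at this; linarith
  · rcases hy.eq_or_lt with h3 | h3
    · exact h3.symm
    · have := noiseFn_lt le_rfl h3
      rw [noiseFn_zero] at this; linarith

/-- On the hyperbola `x y = c²` the sum `r(x) + r(y)` is smallest at `x = y = c`: it equals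
`ln D + (1 - c²) / D - 1` with `D = (1 + x) (1 + y)`, which increases in `D ≥ (1 + c)²`. -/
theorem two_mul_noiseFn_lt {x y c : ℝ} (hx : 0 < x) (hy : 0 < y) (hc : 0 < c) (h : x * y = c ^ 2)
    (hne : x ≠ c) : 2 * noiseFn c < noiseFn x + noiseFn y := by
  have hs : 2 * c < x + y := by
    have hxy : x ≠ y := by
      rintro rfl
      exact hne (by nlinarith [show (x - c) * (x + c) = 0 by ring_nf; linarith])
    have : 0 < (x - y) ^ 2 := by
      have := sub_ne_zero.mpr hxy
      positivity
    nlinarith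
  set D := (1 + x) * (1 + y) with hD
  set D₀ := (1 + c) ^ 2 with hD₀
  have hDD : D₀ < D := by rw [hD, hD₀]; nlinarith
  have hD0 : 0 < D₀ := by positivity
  have hDp : 0 < D := by positivity
  have h3 : Real.log (D₀ / D) < D₀ / D - 1 :=
    Real.log_lt_sub_one_of_pos (by positivity) (by
      rw [Ne, div_eq_one_iff_eq hDp.ne']; linarith)
  rw [Real.log_div hD0.ne' hDp.ne'] at h3
  have e1 : noiseFn x + noiseFn y = Real.log D + (1 - c ^ 2) / D - 1 := by
    rw [hD, Real.log_mul (by positivity) (by positivity), ← h, noiseFn, noiseFn]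
    field_simp; ring
  have e2 : 2 * noiseFn c = Real.log D₀ + (1 - c ^ 2) / D₀ - 1 := by
    rw [hD₀, Real.log_pow, noiseFn]
    field_simp; push_cast; ring
  have e3 : 1 - D₀ / D + ((1 - c ^ 2) / D - (1 - c ^ 2) / D₀)
      = (D - D₀) / D * (2 * c / (1 + c)) := by
    rw [hD₀]; field_simp; ring
  have e4 : 0 < (D - D₀) / D * (2 * c / (1 + c)) := by
    have : 0 < D - D₀ := by linarith
    positivity
  rw [e1, e2]
  linarith

/-- The region `c² ≤ x y` is reduced to its boundary by lowering `y` to `c² / x`. -/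
theorem two_mul_noiseFn_le {x y c : ℝ} (hx : 0 ≤ x) (hy : 0 ≤ y) (hc : 0 ≤ c) (h : c ^ 2 ≤ x * y) :
    2 * noiseFn c ≤ noiseFn x + noiseFn y ∧
      (noiseFn x + noiseFn y = 2 * noiseFn c → x = c ∧ y = c) := by
  rcases hc.eq_or_lt with rfl | hc
  · rw [noiseFn_zero, mul_zero]
    exact ⟨add_nonneg (noiseFn_nonneg hx) (noiseFn_nonneg hy), eq_of_noiseFn_add hx hy⟩
  have hx' : 0 < x := by
    rcases hx.eq_or_lt with h0 | h0
    · rw [← h0, zero_mul] at h; nlinarith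
    · exact h0
  have hy0 : c ^ 2 / x ≤ y := by rw [div_le_iff₀ hx']; linarith
  have hm := noiseFn_le (by positivity) hy0
  by_cases hxc : x = c
  · subst hxc
    have e : x ^ 2 / x = x := by field_simp
    rw [e] at hm hy0
    refine ⟨by linarith, fun h1 => ⟨rfl, ?_⟩⟩
    rcases hy0.eq_or_lt with h2 | h2
    · exact h2.symm
    · have := noiseFn_lt hx h2; linarith
  · have h1 := two_mul_noiseFn_lt hx' (div_pos (by positivity) hx') hc
      (mul_div_cancel₀ (c ^ 2) hx'.ne') hxc
    exact ⟨by linarith, fun h2 => by linarith⟩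

/-! ### Relative entropy of Gaussian measures -/

theorem integral_gaussianReal_sub_sq (m m' : ℝ) (s : NNReal) :
    Integrable (fun x => (x - m') ^ 2) (gaussianReal m s) ∧
      ∫ x, (x - m') ^ 2 ∂(gaussianReal m s) = s + (m - m') ^ 2 := by
  have hL : MemLp (fun x : ℝ => x) 2 (gaussianReal m s) := memLp_id_gaussianReal' 2 (by simp)
  have hL1 : Integrable (fun x : ℝ => x) (gaussianReal m s) := hL.integrable one_le_two
  have hL' : MemLp (fun x : ℝ => x - m') 2 (gaussianReal m s) := hL.sub (memLp_const m')
  refine ⟨hL'.integrable_sq, ?_⟩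
  have hv := variance_fun_id_gaussianReal (μ := m) (v := s)
  rw [variance_eq_integral hL.1.aemeasurable] at hv
  rw [integral_id_gaussianReal] at hv
  have e : ∀ x : ℝ, (x - m') ^ 2 = (x - m) ^ 2 + (2 * (m - m') * (x - m) + (m - m') ^ 2) := by
    intro x; ring
  have hLm : MemLp (fun x : ℝ => x - m) 2 (gaussianReal m s) := hL.sub (memLp_const m)
  have hi1 : Integrable (fun x : ℝ => 2 * (m - m') * (x - m)) (gaussianReal m s) :=
    (hL1.sub (integrable_const m)).const_mul _
  rw [show (fun x : ℝ => (x - m') ^ 2) = (fun x => (x - m) ^ 2) +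
      ((fun x => 2 * (m - m') * (x - m)) + fun _ => (m - m') ^ 2) from funext e,
    integral_add' hLm.integrable_sq (hi1.add (integrable_const _)),
    integral_add' hi1 (integrable_const _), integral_const_mul,
    integral_sub hL1 (integrable_const m), integral_id_gaussianReal, hv]
  simp

theorem klDiv_gaussianReal (m m' : ℝ) {s t : NNReal} (hs : s ≠ 0) (ht : t ≠ 0) :
    InformationTheory.klDiv (gaussianReal m s) (gaussianReal m' t) =
      ENNReal.ofReal ((Real.log (t / s) + (s + (m - m') ^ 2) / t - 1) / 2) := by
  have hs0 : (0 : ℝ) < s := by positivity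
  have ht0 : (0 : ℝ) < t := by positivity
  let g : ℝ → ℝ := fun x => Real.log (t / s) / 2 + (-(x - m) ^ 2 / (2 * s) + (x - m') ^ 2 / (2 * t))
  have hg : Measurable g := by fun_prop
  -- `exp ∘ g` is the quotient of the two densities.
  have hd : gaussianReal m s
      = (gaussianReal m' t).withDensity fun x => ENNReal.ofReal (Real.exp (g x)) := by
    rw [gaussianReal_of_var_ne_zero _ hs, gaussianReal_of_var_ne_zero _ ht,
      ← withDensity_mul _ (measurable_gaussianPDF _ _) (by fun_prop)]
    congr 1
    funext x
    rw [Pi.mul_apply, gaussianPDF, gaussianPDF, ← ENNReal.ofReal_mul (gaussianPDFReal_nonneg _ _ _)]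
    congr 1
    simp only [gaussianPDFReal, g]
    have e1 : Real.exp (Real.log (t / s) / 2) = √(t / s) := by
      rw [← Real.log_sqrt (by positivity), Real.exp_log (by positivity)]
    rw [Real.exp_add, Real.exp_add, e1, Real.sqrt_div (by positivity),
      Real.sqrt_mul (by positivity : (0 : ℝ) ≤ 2 * Real.pi) (s : ℝ),
      Real.sqrt_mul (by positivity : (0 : ℝ) ≤ 2 * Real.pi) (t : ℝ)]
    have e2 : Real.exp (-(x - m') ^ 2 / (2 * t)) * Real.exp ((x - m') ^ 2 / (2 * t)) = 1 := by
      rw [← Real.exp_add, neg_div, neg_add_cancel, Real.exp_zero]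
    have h1 : √(s : ℝ) ≠ 0 := by positivity
    have h2 : √(t : ℝ) ≠ 0 := by positivity
    have h3 : √(2 * Real.pi) ≠ 0 := by positivity
    generalize Real.exp (-(x - m') ^ 2 / (2 * t)) = X at e2 ⊢
    generalize Real.exp ((x - m') ^ 2 / (2 * t)) = Y at e2 ⊢
    generalize Real.exp (-(x - m) ^ 2 / (2 * s)) = Z
    field_simp
    linear_combination (-Z) * e2
  have hac : gaussianReal m s ≪ gaussianReal m' t := hd ▸ withDensity_absolutelyContinuous _ _
  have hr : (gaussianReal m s).rnDeriv (gaussianReal m' t) =ᵐ[gaussianReal m s]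
      fun x => ENNReal.ofReal (Real.exp (g x)) := by
    have h := Measure.rnDeriv_withDensity (gaussianReal m' t)
      (f := fun x => ENNReal.ofReal (Real.exp (g x))) (by fun_prop)
    rw [← hd] at h
    exact hac.ae_le h
  have hl : llr (gaussianReal m s) (gaussianReal m' t) =ᵐ[gaussianReal m s] g := by
    filter_upwards [hr] with x hx
    rw [llr, hx, ENNReal.toReal_ofReal (Real.exp_pos _).le, Real.log_exp]
  obtain ⟨i1, e1⟩ := integral_gaussianReal_sub_sq m m s
  obtain ⟨i2, e2⟩ := integral_gaussianReal_sub_sq m m' s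
  have j1 : Integrable (fun x => -(x - m) ^ 2 / (2 * s)) (gaussianReal m s) := i1.neg.div_const _
  have j2 : Integrable (fun x => (x - m') ^ 2 / (2 * t)) (gaussianReal m s) := i2.div_const _
  have hgi : Integrable g (gaussianReal m s) := (integrable_const _).add (j1.add j2)
  rw [InformationTheory.klDiv_of_ac_of_integrable hac (hgi.congr hl.symm), integral_congr_ae hl]
  congr 1
  rw [show g = (fun _ => Real.log (t / s) / 2) + ((fun x => -(x - m) ^ 2 / (2 * s)) +
    fun x => (x - m') ^ 2 / (2 * t)) from rfl, integral_add' (integrable_const _) (j1.add j2),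
    integral_add' j1 j2, integral_div, integral_div, integral_div, integral_neg, e1, e2]
  simp
  field_simp
  ring

/-- The relative entropy (in nats) of a Gaussian from one with noise variance `x` and bias `d`
added. -/
theorem klDiv_gaussianReal_noise (m d : ℝ) {s x : ℝ} (hs : 0 < s) (hx : 0 ≤ x) :
    InformationTheory.klDiv (gaussianReal m s.toNNReal) (gaussianReal (m + d) (s + x).toNNReal) =
      ENNReal.ofReal ((noiseFn (x / s) + d ^ 2 / (s + x)) / 2) := by
  rw [klDiv_gaussianReal _ _ (by simpa using hs) (by simp; linarith),
    Real.coe_toNNReal _ hs.le, Real.coe_toNNReal _ (by linarith)]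
  congr 2
  rw [noiseFn, show 1 + x / s = (s + x) / s by field_simp]
  have : 0 < s + x := by linarith
  field_simp
  ring

/-! ### Gaussian marginals -/

/-- A probability measure with Gaussian characteristic function is Gaussian; variance `0` (a point
mass) is allowed. -/
theorem eq_gaussianReal_of_integral {μ : Measure ℝ} [IsProbabilityMeasure μ] {m s : ℝ}
    (h : ∀ k : ℝ, ∫ y, Complex.exp (Complex.I * ((k * y : ℝ) : ℂ)) ∂μ
      = Complex.exp (Complex.I * ((k * m : ℝ) : ℂ) - ((k ^ 2 * s : ℝ) : ℂ) / 2)) :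
    0 ≤ s ∧ μ = gaussianReal m s.toNNReal := by
  -- a characteristic function is bounded by one
  have hs : 0 ≤ s := by
    have h1 : ‖∫ y, Complex.exp (Complex.I * (((1 : ℝ) * y : ℝ) : ℂ)) ∂μ‖ ≤ 1 * μ.real Set.univ :=
      norm_integral_le_of_norm_le_const (Filter.Eventually.of_forall fun y => by
        rw [Complex.norm_exp]; simp)
    rw [h 1, Complex.norm_exp] at h1
    simp at h1
    linarith
  refine ⟨hs, Measure.ext_of_charFun ?_⟩
  funext k
  rw [charFun_gaussianReal, charFun_apply_real]
  have e : ∀ y : ℝ, Complex.exp (k * y * Complex.I) = Complex.exp (Complex.I * ((k * y : ℝ) : ℂ)) := by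
    intro y; congr 1; push_cast; ring
  simp only [e]
  rw [h, Real.coe_toNNReal _ hs]
  congr 1
  push_cast
  ring

theorem tr_mul_smul (ρ : State (L2 n)) (c : ℂ) (T : L2 n →L[ℂ] L2 n) :
    tr (ρ.op * (c • T)) = c * tr (ρ.op * T) := by
  rw [tr, tr, ← tsum_mul_left]
  refine tsum_congr fun i => ?_
  rw [mul_smul_comm, smul_apply, inner_smul_right]

theorem weylUV_left (u v : E n) (k : ℝ) :
    weylUV ħ u v k 0 = weylPhase ħ (-(Omega n ħ).mulVec (k • Sum.elim u.ofLp 0)) := by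
  rw [weylPhase_neg_Omega, weylUV]
  congr 2
  ext i; simp

theorem weylUV_right (u v : E n) (l : ℝ) :
    weylUV ħ u v 0 l = weylPhase ħ (-(Omega n ħ).mulVec (l • Sum.elim (0 : Fin n → ℝ) v.ofLp)) := by
  rw [weylPhase_neg_Omega, weylUV]
  congr 2
  ext i; simp

theorem norm_exp_I_mul_ofReal (y : ℝ) : ‖Complex.exp (Complex.I * (y : ℂ))‖ ≤ 1 := by
  rw [Complex.norm_exp]; simp

theorem integral_dist_positionAlong (hħ : ħ ≠ 0) (ρ : State (L2 n)) (u v : E n) (k : ℝ) :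
    ∫ y, Complex.exp (Complex.I * ((k * y : ℝ) : ℂ)) ∂((positionAlong u).dist ρ)
      = tr (ρ.op * weylUV ħ u v k 0) := by
  rw [(positionAlong_hasIntegral hħ u k).integral_dist (by fun_prop) fun y =>
    norm_exp_I_mul_ofReal _]
  simp [weylUV]

theorem integral_dist_momentumAlong (hħ : ħ ≠ 0) (ρ : State (L2 n)) (u v : E n) (l : ℝ) :
    ∫ y, Complex.exp (Complex.I * ((l * y : ℝ) : ℂ)) ∂((momentumAlong ħ v).dist ρ)
      = tr (ρ.op * weylUV ħ u v 0 l) := by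
  rw [(momentumAlong_hasIntegral hħ v l).integral_dist (by fun_prop) fun y =>
    norm_exp_I_mul_ofReal _]
  simp [weylUV]

theorem integral_dist_fst {M : POVM (L2 n) (ℝ × ℝ)} {u v : E n} {a b : ℝ}
    {V : Matrix (Fin 2) (Fin 2) ℝ}
    (h : ∀ k l, M.HasCharOp k l (gaussFactor a b V k l • weylUV ħ u v k l)) (ρ : State (L2 n))
    (k : ℝ) : ∫ y, Complex.exp (Complex.I * ((k * y : ℝ) : ℂ)) ∂(M.fst.dist ρ)
      = gaussFactor a b V k 0 * tr (ρ.op * weylUV ħ u v k 0) := by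
  have h1 : M.fst.HasIntegral (fun y => Complex.exp (Complex.I * ((k * y : ℝ) : ℂ)))
      (gaussFactor a b V k 0 • weylUV ħ u v k 0) := by
    refine POVM.HasIntegral.map _ (by fun_prop) ?_
    simpa [POVM.HasIntegral, POVM.HasCharOp] using h k 0
  rw [h1.integral_dist (by fun_prop) (fun y => norm_exp_I_mul_ofReal _), tr_mul_smul]

theorem integral_dist_snd {M : POVM (L2 n) (ℝ × ℝ)} {u v : E n} {a b : ℝ}
    {V : Matrix (Fin 2) (Fin 2) ℝ}
    (h : ∀ k l, M.HasCharOp k l (gaussFactor a b V k l • weylUV ħ u v k l)) (ρ : State (L2 n))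
    (l : ℝ) : ∫ y, Complex.exp (Complex.I * ((l * y : ℝ) : ℂ)) ∂(M.snd.dist ρ)
      = gaussFactor a b V 0 l * tr (ρ.op * weylUV ħ u v 0 l) := by
  have h1 : M.snd.HasIntegral (fun y => Complex.exp (Complex.I * ((l * y : ℝ) : ℂ)))
      (gaussFactor a b V 0 l • weylUV ħ u v 0 l) := by
    refine POVM.HasIntegral.map _ (by fun_prop) ?_
    simpa [POVM.HasIntegral, POVM.HasCharOp] using h 0 l
  rw [h1.integral_dist (by fun_prop) (fun y => norm_exp_I_mul_ofReal _), tr_mul_smul]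

theorem tr_weylUV_left {ρ : State (L2 n)} {μ : Phase n}
    {V : Matrix (Fin n ⊕ Fin n) (Fin n ⊕ Fin n) ℝ}
    (hρ : ∀ w : Phase n, charFn ħ ρ w =
      Complex.exp (Complex.I * ((w ⬝ᵥ μ : ℝ) : ℂ) - ((w ⬝ᵥ V.mulVec w : ℝ) : ℂ) / 2))
    (u v : E n) (k : ℝ) : tr (ρ.op * weylUV ħ u v k 0) =
      Complex.exp (Complex.I * ((k * (Sum.elim u.ofLp 0 ⬝ᵥ μ) : ℝ) : ℂ)
        - ((k ^ 2 * (Sum.elim u.ofLp 0 ⬝ᵥ V.mulVec (Sum.elim u.ofLp 0)) : ℝ) : ℂ) / 2) := by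
  have h := hρ (k • Sum.elim u.ofLp 0)
  rw [charFn, ← weylUV_left u v] at h
  rw [h, smul_dotProduct, Matrix.mulVec_smul, smul_dotProduct, dotProduct_smul, smul_eq_mul,
    smul_eq_mul, smul_eq_mul, ← mul_assoc, ← sq]

theorem tr_weylUV_right {ρ : State (L2 n)} {μ : Phase n}
    {V : Matrix (Fin n ⊕ Fin n) (Fin n ⊕ Fin n) ℝ}
    (hρ : ∀ w : Phase n, charFn ħ ρ w =
      Complex.exp (Complex.I * ((w ⬝ᵥ μ : ℝ) : ℂ) - ((w ⬝ᵥ V.mulVec w : ℝ) : ℂ) / 2))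
    (u v : E n) (l : ℝ) : tr (ρ.op * weylUV ħ u v 0 l) =
      Complex.exp (Complex.I * ((l * (Sum.elim (0 : Fin n → ℝ) v.ofLp ⬝ᵥ μ) : ℝ) : ℂ)
        - ((l ^ 2 * (Sum.elim (0 : Fin n → ℝ) v.ofLp ⬝ᵥ V.mulVec (Sum.elim (0 : Fin n → ℝ) v.ofLp)) : ℝ) : ℂ) / 2) := by
  have h := hρ (l • Sum.elim (0 : Fin n → ℝ) v.ofLp)
  rw [charFn, ← weylUV_right u v] at h
  rw [h, smul_dotProduct, Matrix.mulVec_smul, smul_dotProduct, dotProduct_smul, smul_eq_mul,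
    smul_eq_mul, smul_eq_mul, ← mul_assoc, ← sq]

/-- In a Gaussian state with covariance matrix `V`, the variances of `u·Q` and `v·P` are the
corresponding values of the quadratic form of `V`. -/
theorem var_of_charFn (hħ : ħ ≠ 0) {ρ : State (L2 n)} {μ : Phase n}
    {V : Matrix (Fin n ⊕ Fin n) (Fin n ⊕ Fin n) ℝ}
    (hρ : ∀ w : Phase n, charFn ħ ρ w =
      Complex.exp (Complex.I * ((w ⬝ᵥ μ : ℝ) : ℂ) - ((w ⬝ᵥ V.mulVec w : ℝ) : ℂ) / 2))
    (u v : E n) : varQ u ρ = Sum.elim u.ofLp 0 ⬝ᵥ V.mulVec (Sum.elim u.ofLp 0) ∧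
      varP ħ v ρ = Sum.elim (0 : Fin n → ℝ) v.ofLp ⬝ᵥ V.mulVec (Sum.elim (0 : Fin n → ℝ) v.ofLp) := by
  constructor
  · obtain ⟨h1, h2⟩ := eq_gaussianReal_of_integral fun k =>
      (integral_dist_positionAlong hħ ρ u v k).trans (tr_weylUV_left hρ u v k)
    rw [varQ, h2, variance_id_gaussianReal, Real.coe_toNNReal _ h1]
  · obtain ⟨h1, h2⟩ := eq_gaussianReal_of_integral fun k =>
      (integral_dist_momentumAlong hħ ρ u v k).trans (tr_weylUV_right hρ u v k)
    rw [varP, h2, variance_id_gaussianReal, Real.coe_toNNReal _ h1]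

/-- The error function of a Gaussian covariant bi-observable in a Gaussian state. -/
theorem errorFn_eq (hħ : ħ ≠ 0) {u v : E n} {ρ : State (L2 n)} (hρ : IsGaussianState ħ ρ)
    {M : POVM (L2 n) (ℝ × ℝ)} (hM : IsCovariant ħ u v M) {a b : ℝ} {V : Matrix (Fin 2) (Fin 2) ℝ}
    {J : Matrix (Fin 2) (Fin n ⊕ Fin n) ℝ} (h : IsGaussianBiObs ħ M a b V J)
    (hQ : 0 < varQ u ρ) (hP : 0 < varP ħ v ρ) :
    errorFn ħ u v ρ M = ENNReal.ofReal (Real.logb 2 (Real.exp 1) *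
      ((noiseFn (V 0 0 / varQ u ρ) + a ^ 2 / (varQ u ρ + V 0 0)) / 2
        + (noiseFn (V 1 1 / varP ħ v ρ) + b ^ 2 / (varP ħ v ρ + V 1 1)) / 2)) := by
  obtain ⟨μ, W, -, hρ⟩ := hρ
  obtain ⟨hv1, hv2⟩ := var_of_charFn hħ hρ u v
  obtain ⟨h0, h1, -, -⟩ := h.noise_ineq hħ hM
  have hc := h.hasCharOp hħ hM
  have d1 := (eq_gaussianReal_of_integral fun k =>
    (integral_dist_positionAlong hħ ρ u v k).trans (tr_weylUV_left hρ u v k)).2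
  have d2 := (eq_gaussianReal_of_integral fun k =>
    (integral_dist_momentumAlong hħ ρ u v k).trans (tr_weylUV_right hρ u v k)).2
  have d3 := (eq_gaussianReal_of_integral (μ := M.fst.dist ρ)
    (m := Sum.elim u.ofLp 0 ⬝ᵥ μ + a)
    (s := Sum.elim u.ofLp 0 ⬝ᵥ W.mulVec (Sum.elim u.ofLp 0) + V 0 0) fun k => by
      rw [integral_dist_fst hc, tr_weylUV_left hρ, gaussFactor, ← Complex.exp_add]
      congr 1
      simp [Matrix.mulVec, dotProduct, Fin.sum_univ_two]
      ring).2
  have d4 := (eq_gaussianReal_of_integral (μ := M.snd.dist ρ)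
    (m := Sum.elim (0 : Fin n → ℝ) v.ofLp ⬝ᵥ μ + b)
    (s := Sum.elim (0 : Fin n → ℝ) v.ofLp ⬝ᵥ W.mulVec (Sum.elim (0 : Fin n → ℝ) v.ofLp) + V 1 1) fun k => by
      rw [integral_dist_snd hc, tr_weylUV_right hρ, gaussFactor, ← Complex.exp_add]
      congr 1
      simp [Matrix.mulVec, dotProduct, Fin.sum_univ_two]
      ring).2
  have hl : 0 ≤ Real.logb 2 (Real.exp 1) := Real.logb_nonneg one_lt_two (by simp)
  rw [← hv1] at d1 d3
  rw [← hv2] at d2 d4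
  have e1 := noiseFn_nonneg (div_nonneg h0 hQ.le)
  have e2 := noiseFn_nonneg (div_nonneg h1 hP.le)
  rw [errorFn, relEntropy, relEntropy, d1, d2, d3, d4, klDiv_gaussianReal_noise _ _ hQ h0,
    klDiv_gaussianReal_noise _ _ hP h1, mul_add, ENNReal.ofReal_add (by positivity) (by positivity),
    ENNReal.ofReal_mul hl, ENNReal.ofReal_mul hl]

/-! ### Gaussian wave functions -/

section GaussianVector

variable {L N : E n →ₗ[ℝ] E n}

/-- The hypothesis `hLN`, here and below, says that `N` is the inverse transpose of `L`. -/
theorem det_ne_zero_of_dual (hLN : ∀ a x, ⟪N a, L x⟫_ℝ = ⟪a, x⟫_ℝ) : LinearMap.det L ≠ 0 := by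
  have hinj : Function.Injective L := by
    rw [injective_iff_map_eq_zero]
    intro x hx
    have h := hLN x x
    rw [hx, inner_zero_right] at h
    exact inner_self_eq_zero.mp h.symm
  exact (LinearEquiv.isUnit_det' (LinearEquiv.ofInjectiveEndo L hinj)).ne_zero

theorem integral_comp_linearMap (hL : LinearMap.det L ≠ 0) (f : E n → ℂ) (hf : Continuous f) :
    ∫ x, f (L x) = |(LinearMap.det L)⁻¹| * ∫ x, f x := by
  have hm : Continuous L := LinearMap.continuous_of_finiteDimensional L
  rw [← integral_map hm.aemeasurable hf.aestronglyMeasurable,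
    Measure.map_linearMap_addHaar_eq_smul_addHaar volume hL, integral_smul_measure,
    ENNReal.toReal_ofReal (abs_nonneg _), Complex.real_smul]

theorem integrable_comp_linearMap (hL : LinearMap.det L ≠ 0) {f : E n → ℂ} (hf : Continuous f)
    (hi : Integrable f) : Integrable fun x => f (L x) := by
  have hm : Continuous L := LinearMap.continuous_of_finiteDimensional L
  refine (integrable_map_measure hf.aestronglyMeasurable hm.aemeasurable).mp ?_
  rw [Measure.map_linearMap_addHaar_eq_smul_addHaar volume hL]
  exact hi.smul_measure (by simp)

theorem integrable_exp_comp (hL : LinearMap.det L ≠ 0) {c : ℝ} (hc : 0 < c) :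
    Integrable fun x : E n => Real.exp (-c * ‖L x‖ ^ 2) := by
  have h := GaussianFourier.integrable_cexp_neg_mul_sq_norm_add (V := E n) (b := c)
    (by simpa using hc) 0 0
  have h2 := (integrable_comp_linearMap hL (by fun_prop) h).norm
  refine h2.congr (Filter.Eventually.of_forall fun x => ?_)
  simp only [Complex.norm_exp]
  congr 1
  simp
  left
  norm_cast

/-- The integral `∫ exp(-2|L x|²) dx`. -/
def gaussNorm (L : E n →ₗ[ℝ] E n) : ℝ := ∫ x, Real.exp (-2 * ‖L x‖ ^ 2)

theorem gaussNorm_pos (hL : LinearMap.det L ≠ 0) : 0 < gaussNorm L :=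
  integral_exp_pos (integrable_exp_comp hL two_pos)

/-- The normalized wave function `x ↦ const · exp(-|L x|²)`. -/
def gaussFn (L : E n →ₗ[ℝ] E n) (x : E n) : ℝ := (√(gaussNorm L))⁻¹ * Real.exp (-1 * ‖L x‖ ^ 2)

theorem continuous_gaussFn (L : E n →ₗ[ℝ] E n) : Continuous (gaussFn L) := by
  have hm : Continuous L := LinearMap.continuous_of_finiteDimensional L
  unfold gaussFn
  fun_prop

theorem integral_char_exp (hLN : ∀ a x, ⟪N a, L x⟫_ℝ = ⟪a, x⟫_ℝ) (a : E n) :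
    ∫ x, Complex.exp (Complex.I * ⟪a, x⟫_ℝ) * Real.exp (-2 * ‖L x‖ ^ 2)
      = gaussNorm L * Real.exp (-‖N a‖ ^ 2 / 8) := by
  have hL := det_ne_zero_of_dual hLN
  have key : ∀ a : E n, ∫ x, Complex.exp (Complex.I * ⟪a, x⟫_ℝ) * Real.exp (-2 * ‖L x‖ ^ 2)
      = |(LinearMap.det L)⁻¹| * ((Real.pi / (2 : ℂ)) ^ (Module.finrank ℝ (E n) / 2 : ℂ) *
        Complex.exp (-‖N a‖ ^ 2 / 8)) := by
    intro a
    have h := GaussianFourier.integral_cexp_neg_mul_sq_norm_add (V := E n) (b := 2) (by simp)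
      Complex.I (N a)
    rw [show Complex.I ^ 2 * (‖N a‖ : ℂ) ^ 2 / (4 * 2) = -‖N a‖ ^ 2 / 8 by
      rw [Complex.I_sq]; ring] at h
    rw [← h, ← integral_comp_linearMap hL _ (by fun_prop)]
    refine integral_congr_ae (Filter.Eventually.of_forall fun x => ?_)
    simp only [hLN]
    rw [Complex.ofReal_exp, ← Complex.exp_add]
    congr 1
    push_cast
    ring
  have h0 := key 0
  simp only [inner_zero_left, Complex.ofReal_zero, mul_zero, Complex.exp_zero, one_mul, map_zero,
    norm_zero] at h0
  have e : ((gaussNorm L : ℝ) : ℂ)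
      = |(LinearMap.det L)⁻¹| * (Real.pi / (2 : ℂ)) ^ (Module.finrank ℝ (E n) / 2 : ℂ) := by
    rw [gaussNorm, ← integral_complex_ofReal, h0]
    simp
  rw [key, e]
  push_cast
  ring

/-- The overlap of a Gaussian wave function with its translates. -/
theorem integral_gaussFn_overlap (hLN : ∀ a x, ⟪N a, L x⟫_ℝ = ⟪a, x⟫_ℝ) (a b : E n) :
    ∫ x, Complex.exp (Complex.I * ⟪a, x⟫_ℝ) * (gaussFn L x * gaussFn L (x + b) : ℝ)
      = Complex.exp (-Complex.I * (⟪a, b⟫_ℝ / 2 : ℝ)) *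
        Real.exp (-‖L b‖ ^ 2 / 2 - ‖N a‖ ^ 2 / 8) := by
  have hL := det_ne_zero_of_dual hLN
  have hpos := gaussNorm_pos hL
  have hsq : (√(gaussNorm L))⁻¹ * (√(gaussNorm L))⁻¹ = (gaussNorm L)⁻¹ := by
    rw [← mul_inv, Real.mul_self_sqrt hpos.le]
  rw [← integral_sub_right_eq_self _ ((2 : ℝ)⁻¹ • b)]
  have e : ∀ x : E n, Complex.exp (Complex.I * ⟪a, x - (2 : ℝ)⁻¹ • b⟫_ℝ) *
      (gaussFn L (x - (2 : ℝ)⁻¹ • b) * gaussFn L (x - (2 : ℝ)⁻¹ • b + b) : ℝ)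
      = (Complex.exp (-Complex.I * (⟪a, b⟫_ℝ / 2 : ℝ)) *
        (((gaussNorm L)⁻¹ * Real.exp (-‖L b‖ ^ 2 / 2) : ℝ) : ℂ)) *
        (Complex.exp (Complex.I * ⟪a, x⟫_ℝ) * Real.exp (-2 * ‖L x‖ ^ 2)) := by
    intro x
    have e1 : gaussFn L (x - (2 : ℝ)⁻¹ • b) * gaussFn L (x - (2 : ℝ)⁻¹ • b + b)
        = (gaussNorm L)⁻¹ * Real.exp (-‖L b‖ ^ 2 / 2) * Real.exp (-2 * ‖L x‖ ^ 2) := by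
      have e2 : x - (2 : ℝ)⁻¹ • b + b = x + (2 : ℝ)⁻¹ • b := by
        rw [sub_add_eq_add_sub, add_sub_assoc]
        congr 1
        module
      rw [e2, gaussFn, gaussFn, mul_mul_mul_comm, hsq, ← Real.exp_add, mul_assoc, ← Real.exp_add]
      congr 2
      have h1 := parallelogram_law_with_norm ℝ (L x) (L ((2 : ℝ)⁻¹ • b))
      have h2 : ‖L ((2 : ℝ)⁻¹ • b)‖ ^ 2 = ‖L b‖ ^ 2 / 4 := by
        rw [map_smul, norm_smul, mul_pow]; norm_num; ring
      rw [map_sub, map_add]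
      nlinarith
    rw [e1, inner_sub_right, real_inner_smul_right]
    have e3 : Complex.exp (Complex.I * ((⟪a, x⟫_ℝ - 2⁻¹ * ⟪a, b⟫_ℝ : ℝ) : ℂ))
        = Complex.exp (-Complex.I * (⟪a, b⟫_ℝ / 2 : ℝ)) * Complex.exp (Complex.I * ⟪a, x⟫_ℝ) := by
      rw [← Complex.exp_add]
      congr 1
      push_cast
      ring
    rw [e3]
    push_cast
    ring
  simp only [e]
  rw [integral_const_mul, integral_char_exp hLN, sub_eq_add_neg, Real.exp_add, ← neg_div]
  have : ((gaussNorm L : ℝ) : ℂ) ≠ 0 := by exact_mod_cast hpos.ne'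
  push_cast
  field_simp

theorem integrable_gaussFn_sq (hL : LinearMap.det L ≠ 0) :
    Integrable fun x : E n => gaussFn L x ^ 2 := by
  have h := (integrable_exp_comp hL two_pos).const_mul ((√(gaussNorm L))⁻¹ ^ 2)
  refine h.congr (Filter.Eventually.of_forall fun x => ?_)
  simp only [gaussFn]
  rw [mul_pow, ← Real.exp_nat_mul]
  congr 2
  push_cast
  ring

theorem memLp_gaussFn (hL : LinearMap.det L ≠ 0) :
    MemLp (fun x : E n => ((gaussFn L x : ℝ) : ℂ)) 2 volume := by
  have hc := continuous_gaussFn L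
  refine (memLp_two_iff_integrable_sq_norm (by fun_prop)).mpr ?_
  simpa using integrable_gaussFn_sq hL

/-- The expectation of a Weyl operator in the state with a Gaussian wave function. -/
theorem inner_weyl_gaussFn (hħ : ħ ≠ 0) (hLN : ∀ a x, ⟪N a, L x⟫_ℝ = ⟪a, x⟫_ℝ)
    (w₁ w₂ : E n) :
    ⟪(memLp_gaussFn (det_ne_zero_of_dual hLN)).toLp,
      weyl ħ (-ħ • w₂) (ħ • w₁) (memLp_gaussFn (det_ne_zero_of_dual hLN)).toLp⟫_ℂ
      = Real.exp (-(ħ ^ 2 * ‖L w₂‖ ^ 2 + ‖N w₁‖ ^ 2 / 4) / 2) := by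
  set hm := memLp_gaussFn (det_ne_zero_of_dual hLN)
  have h0 : (ħ : ℂ) ≠ 0 := by exact_mod_cast hħ
  have h1 : ⟪hm.toLp, weyl ħ (-ħ • w₂) (ħ • w₁) hm.toLp⟫_ℂ
      = Complex.exp (Complex.I * (ħ * ⟪w₁, w₂⟫_ℝ / 2 : ℝ)) *
        ∫ x, Complex.exp (Complex.I * ⟪w₁, x⟫_ℝ) *
          (gaussFn L x * gaussFn L (x + ħ • w₂) : ℝ) := by
    rw [L2.inner_def, ← integral_const_mul]
    refine integral_congr_ae ?_
    filter_upwards [weyl_coeFn ħ (-ħ • w₂) (ħ • w₁) hm.toLp, ae_comp_sub hm.coeFn_toLp (-ħ • w₂),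
      hm.coeFn_toLp] with y e1 e2 e3
    rw [e1, e2, e3, RCLike.inner_apply, neg_smul, sub_neg_eq_add, Complex.conj_ofReal,
      ← mul_assoc, ← Complex.exp_add]
    rw [mul_right_comm, mul_assoc]
    congr 1
    · congr 1
      simp only [inner_neg_left, real_inner_smul_left, real_inner_smul_right, real_inner_comm w₁ w₂]
      push_cast
      field_simp
      ring
    · push_cast; ring
  rw [h1, integral_gaussFn_overlap hLN, ← mul_assoc, ← Complex.exp_add]
  have h2 : Complex.I * ((ħ * ⟪w₁, w₂⟫_ℝ / 2 : ℝ) : ℂ) +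
      -Complex.I * ((⟪w₁, ħ • w₂⟫_ℝ / 2 : ℝ) : ℂ) = 0 := by
    rw [real_inner_smul_right]; ring
  rw [h2, Complex.exp_zero, one_mul, map_smul, norm_smul, mul_pow, Real.norm_eq_abs, sq_abs]
  congr 2
  ring

theorem norm_gaussFn_toLp (hLN : ∀ a x, ⟪N a, L x⟫_ℝ = ⟪a, x⟫_ℝ) :
    ‖(memLp_gaussFn (det_ne_zero_of_dual hLN)).toLp‖ = 1 := by
  have h := inner_weyl_gaussFn one_ne_zero hLN 0 0
  rw [smul_zero, smul_zero, weyl_zero, one_apply_eq_self, inner_self_eq_norm_sq_to_K]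
    at h
  have h2 : ‖(memLp_gaussFn (det_ne_zero_of_dual hLN)).toLp‖ ^ 2 = 1 := by
    refine Complex.ofReal_injective ?_
    rw [Complex.ofReal_pow]
    exact h.trans (by simp)
  nlinarith [norm_nonneg (memLp_gaussFn (det_ne_zero_of_dual hLN)).toLp]

end GaussianVector

/-! ### Existence of Gaussian states with prescribed variances -/

theorem matrix_eq_of_dotProduct {ι : Type*} [Fintype ι] [DecidableEq ι] {A B : Matrix ι ι ℝ}
    (h : ∀ w w', w ⬝ᵥ A.mulVec w' = w ⬝ᵥ B.mulVec w') : A = B := by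
  ext i j
  simpa using h (Pi.single i 1) (Pi.single j 1)

open scoped ComplexOrder in
/-- `AᵀA + BᵀB + (i/2) Ω ≥ 0` as soon as `AᵀB - BᵀA = Ω / 2`, since the left side is
`(A + iB)* (A + iB)`. -/
theorem posSemidef_of_complex_factor {ι κ : Type*} [Fintype ι] [Fintype κ] [DecidableEq ι]
    {A B : Matrix κ ι ℝ} {Ω : Matrix ι ι ℝ}
    (h : A.transpose * B - B.transpose * A = (2 : ℝ)⁻¹ • Ω) :
    ((A.transpose * A + B.transpose * B).map Complex.ofReal
      + (Complex.I / 2) • Ω.map Complex.ofReal).PosSemidef := by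
  set X : Matrix κ ι ℂ := A.map Complex.ofReal + Complex.I • B.map Complex.ofReal with hX
  have e : (A.transpose * A + B.transpose * B).map Complex.ofReal
      + (Complex.I / 2) • Ω.map Complex.ofReal = X.conjTranspose * X := by
    ext i j
    have h1 := congrFun (congrFun h i) j
    simp only [Matrix.sub_apply, Matrix.mul_apply, Matrix.transpose_apply, Matrix.smul_apply,
      smul_eq_mul] at h1
    have h2 : ((Ω i j : ℝ) : ℂ) = 2 * (∑ m, (A m i : ℂ) * B m j - ∑ m, (B m i : ℂ) * A m j) := by
      have : Ω i j = 2 * (∑ m, A m i * B m j - ∑ m, B m i * A m j) := by rw [h1]; ring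
      rw [this]; push_cast; ring
    simp only [Matrix.add_apply, Matrix.map_apply, Matrix.smul_apply, smul_eq_mul, h2,
      Matrix.mul_apply, Matrix.transpose_apply, Matrix.conjTranspose_apply, hX]
    push_cast
    rw [← Finset.sum_sub_distrib, ← Finset.sum_add_distrib, ← mul_assoc, Finset.mul_sum,
      ← Finset.sum_add_distrib]
    refine Finset.sum_congr rfl fun m _ => ?_
    simp
    linear_combination ((B m i : ℂ) * B m j) * Complex.I_sq
  rw [e]
  exact Matrix.posSemidef_conjTranspose_mul_self X

/-- The pure state with wave function `exp(i t (u·y)² / 2ħ) · const · exp(-|L y|²)` is Gaussian; its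
variances are read off from `L` and the inverse transpose `N` of `L`. -/
theorem exists_gaussianState_of_dual (hħ : ħ ≠ 0) {L N : E n →ₗ[ℝ] E n}
    (hLN : ∀ a x, ⟪N a, L x⟫_ℝ = ⟪a, x⟫_ℝ) (t : ℝ) (u v : E n) :
    ∃ ρ : State (L2 n), IsGaussianState ħ ρ ∧ varQ u ρ = ‖N u‖ ^ 2 / 4 ∧
      varP ħ v ρ = ħ ^ 2 * ‖L v‖ ^ 2 + t ^ 2 * ⟪u, v⟫_ℝ ^ 2 * (‖N u‖ ^ 2 / 4) := by
  set φ := (memLp_gaussFn (det_ne_zero_of_dual hLN)).toLp with hφ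
  have hn : ‖chirp ħ t u φ‖ = 1 := by rw [LinearIsometryEquiv.norm_map, norm_gaussFn_toLp hLN]
  let ρ := pureState (chirp ħ t u φ) hn
  let w₁ : Phase n →ₗ[ℝ] E n := (WithLp.linearEquiv 2 ℝ (Fin n → ℝ)).symm.toLinearMap ∘ₗ
    LinearMap.funLeft ℝ ℝ Sum.inl
  let w₂ : Phase n →ₗ[ℝ] E n := (WithLp.linearEquiv 2 ℝ (Fin n → ℝ)).symm.toLinearMap ∘ₗ
    LinearMap.funLeft ℝ ℝ Sum.inr
  let toFun : E n →ₗ[ℝ] (Fin n → ℝ) := (WithLp.linearEquiv 2 ℝ (Fin n → ℝ)).toLinearMap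
  let a : Phase n →ₗ[ℝ] E n :=
    (2 : ℝ)⁻¹ • N ∘ₗ (w₁ + t • ((innerₗ (E n) u) ∘ₗ w₂).smulRight u)
  let b : Phase n →ₗ[ℝ] E n := ħ • L ∘ₗ w₂
  let A := LinearMap.toMatrix' (toFun ∘ₗ a)
  let B := LinearMap.toMatrix' (toFun ∘ₗ b)
  have ha : ∀ w, a w = (2 : ℝ)⁻¹ • N (w₁ w + t • ⟪u, w₂ w⟫_ℝ • u) := fun w => rfl
  have hb : ∀ w, b w = ħ • L (w₂ w) := fun w => rfl
  have hns : ∀ (c : ℝ) (x : E n), ‖c • x‖ ^ 2 = c ^ 2 * ‖x‖ ^ 2 := fun c x => by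
    rw [norm_smul, mul_pow, Real.norm_eq_abs, sq_abs]
  have hdot : ∀ x y : E n, toFun x ⬝ᵥ toFun y = ⟪x, y⟫_ℝ := by
    intro x y
    simp [toFun, PiLp.inner_apply, dotProduct, mul_comm]
  have hAB : ∀ (f g : Phase n →ₗ[ℝ] E n) (w w' : Phase n),
      w ⬝ᵥ ((LinearMap.toMatrix' (toFun ∘ₗ f)).transpose *
        LinearMap.toMatrix' (toFun ∘ₗ g)).mulVec w' = ⟪f w, g w'⟫_ℝ := by
    intro f g w w'
    rw [← Matrix.mulVec_mulVec, Matrix.dotProduct_mulVec, Matrix.vecMul_transpose,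
      LinearMap.toMatrix'_mulVec, LinearMap.toMatrix'_mulVec]
    exact hdot _ _
  have hΩ : ∀ w w' : Phase n, w ⬝ᵥ (Omega n ħ).mulVec w' =
      ħ * (⟪w₁ w, w₂ w'⟫_ℝ - ⟪w₂ w, w₁ w'⟫_ℝ) := by
    intro w w'
    rw [← hdot, ← hdot]
    rw [← Sum.elim_comp_inl_inr w, ← Sum.elim_comp_inl_inr w', Omega, Matrix.fromBlocks_mulVec,
      sumElim_dotProduct_sumElim]
    simp [Matrix.neg_mulVec, Matrix.smul_mulVec, toFun, w₁, w₂, LinearMap.funLeft]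
    ring
  have hcomm : A.transpose * B - B.transpose * A = (2 : ℝ)⁻¹ • Omega n ħ := by
    refine matrix_eq_of_dotProduct fun w w' => ?_
    rw [Matrix.sub_mulVec, dotProduct_sub, hAB, hAB, Matrix.smul_mulVec, dotProduct_smul, hΩ,
      ha, ha, hb, hb]
    simp only [real_inner_smul_left, real_inner_smul_right, hLN, real_inner_comm (N _) (L _),
      inner_add_left, smul_eq_mul]
    rw [real_inner_comm (w₁ w') (w₂ w)]
    ring
  have hchar : ∀ w : Phase n, charFn ħ ρ w = Complex.exp (Complex.I * ((w ⬝ᵥ 0 : ℝ) : ℂ)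
      - ((w ⬝ᵥ (A.transpose * A + B.transpose * B).mulVec w : ℝ) : ℂ) / 2) := by
    intro w
    rw [charFn, tr_pureState_mul, weylPhase_neg_Omega, weyl_chirp, LinearIsometryEquiv.inner_map_map]
    have e1 : ħ • (WithLp.toLp 2 fun i => w (Sum.inl i) : E n) - (t * ⟪u, -ħ • (WithLp.toLp 2
        fun i => w (Sum.inr i) : E n)⟫_ℝ) • u = ħ • (w₁ w + t • ⟪u, w₂ w⟫_ℝ • u) := by
      change ħ • w₁ w - (t * ⟪u, -ħ • w₂ w⟫_ℝ) • u = _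
      rw [real_inner_smul_right]
      module
    rw [e1, inner_weyl_gaussFn hħ hLN, Matrix.add_mulVec, dotProduct_add, hAB, hAB, ha, hb,
      Complex.ofReal_exp]
    congr 1
    simp only [real_inner_self_eq_norm_sq, hns]
    change ((-(ħ ^ 2 * ‖L (w₂ w)‖ ^ 2 + _) / 2 : ℝ) : ℂ) = _
    push_cast
    simp
    ring
  have hG : IsGaussianState ħ ρ := ⟨0, _, posSemidef_of_complex_factor hcomm, hchar⟩
  obtain ⟨h1, h2⟩ := var_of_charFn hħ hchar u v
  have hl : ∀ x y : E n, w₁ (Sum.elim x.ofLp y.ofLp) = x ∧ w₂ (Sum.elim x.ofLp y.ofLp) = y :=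
    fun x y => ⟨rfl, rfl⟩
  refine ⟨ρ, hG, ?_, ?_⟩
  · obtain ⟨e1, e2⟩ := hl u 0
    rw [h1, Matrix.add_mulVec, dotProduct_add, hAB, hAB, ha, hb]
    rw [WithLp.ofLp_zero] at e1 e2
    rw [e1, e2]
    simp only [real_inner_self_eq_norm_sq, hns, inner_zero_right, smul_zero, add_zero, zero_smul,
      map_zero]
    ring
  · obtain ⟨e1, e2⟩ := hl 0 v
    rw [h2, Matrix.add_mulVec, dotProduct_add, hAB, hAB, ha, hb]
    rw [WithLp.ofLp_zero] at e1 e2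
    rw [e1, e2]
    simp only [real_inner_self_eq_norm_sq, hns, zero_add, map_smul]
    ring

/-- If `u·v = c ≠ 0`, some `L` maps `v` to `s u` and its inverse transpose maps `u` to `(c/s) u`. This
is the equality case of the uncertainty relation. -/
theorem exists_dual_of_inner_ne_zero {u v : E n} (hu : ‖u‖ = 1) (hc : ⟪u, v⟫_ℝ ≠ 0) {s : ℝ}
    (hs : s ≠ 0) : ∃ L N : E n →ₗ[ℝ] E n, (∀ a x, ⟪N a, L x⟫_ℝ = ⟪a, x⟫_ℝ) ∧
      ‖N u‖ ^ 2 = ⟪u, v⟫_ℝ ^ 2 / s ^ 2 ∧ ‖L v‖ ^ 2 = s ^ 2 := by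
  have huu : ⟪u, u⟫_ℝ = 1 := by rw [real_inner_self_eq_norm_sq, hu, one_pow]
  let d : E n := s • u - v
  let L : E n →ₗ[ℝ] E n := LinearMap.id + (⟪u, v⟫_ℝ)⁻¹ • (innerₗ (E n) u).smulRight d
  let N : E n →ₗ[ℝ] E n := LinearMap.id - s⁻¹ • (innerₗ (E n) d).smulRight u
  have hL : ∀ x, L x = x + (⟪u, v⟫_ℝ)⁻¹ • ⟪u, x⟫_ℝ • d := fun x => rfl
  have hN : ∀ x, N x = x - s⁻¹ • ⟪d, x⟫_ℝ • u := fun x => rfl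
  have hdu : ⟪d, u⟫_ℝ = s - ⟪u, v⟫_ℝ := by
    simp only [d, inner_sub_left, real_inner_smul_left, huu, real_inner_comm u v]
    ring
  refine ⟨L, N, fun a x => ?_, ?_, ?_⟩
  · rw [hL, hN]
    simp only [inner_sub_left, inner_add_right, real_inner_smul_left, real_inner_smul_right,
      real_inner_comm d u, real_inner_comm d a, hdu]
    field_simp
    ring
  · rw [hN, hdu, show u - s⁻¹ • (s - ⟪u, v⟫_ℝ) • u = (⟪u, v⟫_ℝ / s) • u by
      rw [smul_smul, mul_sub, inv_mul_cancel₀ hs]; module]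
    rw [norm_smul, hu, mul_one, Real.norm_eq_abs, sq_abs, div_pow]
  · rw [hL, smul_smul, inv_mul_cancel₀ hc, one_smul, show v + d = s • u by simp [d], norm_smul, hu,
      mul_one, Real.norm_eq_abs, sq_abs]

/-- If `u` and `v` are orthogonal, the two scales can be chosen independently. -/
theorem exists_dual_of_inner_eq_zero {u v : E n} (hu : ‖u‖ = 1) (hv : ‖v‖ = 1)
    (hc : ⟪u, v⟫_ℝ = 0) {s K : ℝ} (hs : s ≠ 0) (hK : K ≠ 0) :
    ∃ L N : E n →ₗ[ℝ] E n, (∀ a x, ⟪N a, L x⟫_ℝ = ⟪a, x⟫_ℝ) ∧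
      ‖N u‖ ^ 2 = 1 / s ^ 2 ∧ ‖L v‖ ^ 2 = K ^ 2 := by
  have huu : ⟪u, u⟫_ℝ = 1 := by rw [real_inner_self_eq_norm_sq, hu, one_pow]
  let D : ℝ → ℝ → E n →ₗ[ℝ] E n := fun s K =>
    K • LinearMap.id + (s - K) • (innerₗ (E n) u).smulRight u
  have hD : ∀ s K x, D s K x = K • x + (s - K) • ⟪u, x⟫_ℝ • u := fun s K x => rfl
  refine ⟨D s K, D s⁻¹ K⁻¹, fun a x => ?_, ?_, ?_⟩
  · rw [hD, hD]
    simp only [inner_add_left, inner_add_right, real_inner_smul_left, real_inner_smul_right,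
      real_inner_comm u a, huu]
    field_simp
    ring
  · rw [hD, huu, show K⁻¹ • u + (s⁻¹ - K⁻¹) • (1 : ℝ) • u = s⁻¹ • u by module, norm_smul, hu,
      mul_one, Real.norm_eq_abs, sq_abs, one_div, inv_pow]
  · rw [hD, hc, zero_smul, smul_zero, add_zero, norm_smul, hv, mul_one, Real.norm_eq_abs, sq_abs]

/-- Gaussian states realize all pairs of variances allowed by the uncertainty relation. -/
theorem exists_gaussianState (hħ : 0 < ħ) {u v : E n} (hu : ‖u‖ = 1) (hv : ‖v‖ = 1) {ε₁ ε₂ : ℝ}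
    (h₁ : 0 < ε₁) (h₂ : 0 < ε₂) (h : ħ ^ 2 / 4 * ⟪u, v⟫_ℝ ^ 2 ≤ ε₁ * ε₂) :
    ∃ ρ : State (L2 n), IsGaussianState ħ ρ ∧ varQ u ρ = ε₁ ∧ varP ħ v ρ = ε₂ := by
  by_cases hc : ⟪u, v⟫_ℝ = 0
  · obtain ⟨L, N, hLN, h3, h4⟩ := exists_dual_of_inner_eq_zero hu hv hc
      (s := 1 / (2 * √ε₁)) (K := √ε₂ / ħ) (by positivity) (by positivity)
    obtain ⟨ρ, hρ, h5, h6⟩ := exists_gaussianState_of_dual hħ.ne' hLN 0 u v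
    refine ⟨ρ, hρ, ?_, ?_⟩
    · rw [h5, h3, div_pow, mul_pow, Real.sq_sqrt h₁.le]
      field_simp
      norm_num
    · rw [h6, h4, div_pow, Real.sq_sqrt h₂.le]
      field_simp
      ring
  · set c := ⟪u, v⟫_ℝ
    obtain ⟨L, N, hLN, h3, h4⟩ := exists_dual_of_inner_ne_zero hu hc
      (s := c / (2 * √ε₁)) (by positivity)
    have hN : ‖N u‖ ^ 2 / 4 = ε₁ := by
      rw [h3, div_pow, mul_pow, Real.sq_sqrt h₁.le]
      change c ^ 2 / (c ^ 2 / (2 ^ 2 * ε₁)) / 4 = ε₁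
      field_simp
      norm_num
    -- the chirp supplies the momentum variance missing from the minimal one
    have hnn : 0 ≤ (ε₂ - ħ ^ 2 * ‖L v‖ ^ 2) / (c ^ 2 * ε₁) := by
      refine div_nonneg ?_ (by positivity)
      rw [h4, div_pow, mul_pow, Real.sq_sqrt h₁.le, sub_nonneg]
      have : ħ ^ 2 * (c ^ 2 / (2 ^ 2 * ε₁)) = (ħ ^ 2 / 4 * c ^ 2) / ε₁ := by field_simp; norm_num
      rw [this, div_le_iff₀ h₁]
      linarith
    obtain ⟨ρ, hρ, h5, h6⟩ := exists_gaussianState_of_dual hħ.ne' hLN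
      (√((ε₂ - ħ ^ 2 * ‖L v‖ ^ 2) / (c ^ 2 * ε₁))) u v
    refine ⟨ρ, hρ, h5.trans hN, ?_⟩
    rw [h6, hN, Real.sq_sqrt hnn]
    change ħ ^ 2 * ‖L v‖ ^ 2 + (ε₂ - ħ ^ 2 * ‖L v‖ ^ 2) / (c ^ 2 * ε₁) * c ^ 2 * ε₁ = ε₂
    field_simp
    ring

/-! ### The sharp joint observable of commuting `u·Q` and `v·P` -/

theorem weyl_fourier_symm (hħ : ħ ≠ 0) (x p : E n) (ψ : L2 n) :
    weyl ħ x p ((Lp.fourierTransformₗᵢ (E n) ℂ).symm ψ) = (Lp.fourierTransformₗᵢ (E n) ℂ).symm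
      (weyl ħ ((2 * Real.pi * ħ)⁻¹ • p) (-(2 * Real.pi * ħ) • x) ψ) := by
  have h : (2 * Real.pi * ħ) ≠ 0 := by positivity
  rw [LinearIsometryEquiv.eq_symm_apply]
  set χ := (Lp.fourierTransformₗᵢ (E n) ℂ).symm ψ with hχ
  have hψ : ψ = Lp.fourierTransformₗᵢ (E n) ℂ χ := by simp [hχ]
  rw [hψ, weyl_fourier hħ]
  congr 2
  rw [smul_smul, smul_smul]
  rw [neg_mul_neg, inv_mul_cancel₀ h, mul_inv_cancel₀ h, one_smul, one_smul]

/-- If `u` and `v` are orthogonal, a product of Fourier transforms and chirps along `u` carries the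
position operators to operators among which `u·Q` and `v·P` occur. -/
theorem exists_sharp_joint (hħ : ħ ≠ 0) {u v : E n} (hu : ‖u‖ = 1) (hc : ⟪u, v⟫_ℝ = 0) :
    ∃ M : POVM (L2 n) (ℝ × ℝ), ∀ k l, M.HasCharOp k l (weylUV ħ u v k l) := by
  have h0 : (2 * Real.pi * ħ) ≠ 0 := by positivity
  have huu : ⟪u, u⟫_ℝ = 1 := by rw [real_inner_self_eq_norm_sq, hu, one_pow]
  -- On the orthogonal complement of `u` the chirps are trivial and the three Fourier transforms reduce
  -- to one, which yields momenta; along `u` the two shears undo it, which yields positions.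
  let F := Lp.fourierTransformₗᵢ (E n) ℂ
  let M₀ : POVM (L2 n) (E n) := ((((position n).conj F).conj (chirp ħ 1 u)).conj F.symm).conj
    (chirp ħ ((2 * Real.pi * ħ) ^ 2) u) |>.conj F
  have h : ∀ k l : ℝ, M₀.HasIntegral (fun y => Complex.exp (Complex.I *
      ⟪(2 * Real.pi * ħ) • (k • u + l • v), y⟫_ℝ)) (weylUV ħ u v k l) := by
    intro k l
    have h1 := position_hasIntegral hħ ((2 * Real.pi * ħ) • (k • u + l • v))
    have h2 := h1.conj F fun ψ => weyl_fourier hħ _ _ ψ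
    have h3 := h2.conj (chirp ħ 1 u) fun ψ => weyl_chirp _ _ _ _ ψ
    have h4 := h3.conj F.symm fun ψ => weyl_fourier_symm hħ _ _ ψ
    have h5 := h4.conj (chirp ħ ((2 * Real.pi * ħ) ^ 2) u) fun ψ => weyl_chirp _ _ _ _ ψ
    have h6 := h5.conj F fun ψ => weyl_fourier hħ _ _ ψ
    convert! h6 using 1
    rw [weylUV]
    congr 1
    · simp only [inner_add_right, inner_sub_right, real_inner_smul_right, huu, hc, smul_zero]
      simp only [smul_add, smul_sub, smul_smul]
      simp
      match_scalars <;> field_simp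
      ring
    · simp only [inner_add_right, real_inner_smul_right, huu, hc, smul_zero]
      simp
      match_scalars
      field_simp
  refine ⟨M₀.map (fun y => (⟪(2 * Real.pi * ħ) • u, y⟫_ℝ, ⟪(2 * Real.pi * ħ) • v, y⟫_ℝ))
    (by fun_prop), fun k l => ?_⟩
  refine POVM.HasIntegral.map _ (POVM.measurable_char k l) ?_
  convert! h k l using 1
  funext y
  congr 2
  simp only [real_inner_smul_left, inner_add_left]
  push_cast
  ring

/-! ### Coherent state observables -/

section Coherent

open FourierTransform

variable {L N : E n →ₗ[ℝ] E n}

theorem lintegral_fourier_enorm_sq {f : E n → ℂ} (hf : Integrable f) (hf2 : MemLp f 2 volume) :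
    ∫⁻ ξ, ‖𝓕 f ξ‖ₑ ^ 2 = ∫⁻ y, ‖f y‖ₑ ^ 2 := by
  have key : ∀ g : L2 n, ∫⁻ y, ‖g y‖ₑ ^ 2 = ‖g‖ₑ ^ 2 := by
    intro g
    rw [Lp.enorm_def, eLpNorm_eq_lintegral_rpow_enorm_toReal (by simp) (by simp)]
    rw [← ENNReal.rpow_natCast, ← ENNReal.rpow_mul]
    simp
  have h1 : ∫⁻ ξ, ‖𝓕 f ξ‖ₑ ^ 2 = ∫⁻ ξ, ‖Lp.fourierTransformₗᵢ (E n) ℂ (hf2.toLp f) ξ‖ₑ ^ 2 := by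
    refine lintegral_congr_ae ?_
    filter_upwards [fourierTransform_toLp hf hf2] with ξ h
    rw [h]
  have h2 : ∫⁻ y, ‖f y‖ₑ ^ 2 = ∫⁻ y, ‖hf2.toLp f y‖ₑ ^ 2 := by
    refine lintegral_congr_ae ?_
    filter_upwards [hf2.coeFn_toLp] with ξ h
    rw [h]
  rw [h1, h2, key, key]
  congr 1
  rw [← ofReal_norm, ← ofReal_norm, LinearIsometryEquiv.norm_map]

/-- The product of `ψ` with the Gaussian wave function centred at `x`. -/
def window (L : E n →ₗ[ℝ] E n) (ψ : E n → ℂ) (x y : E n) : ℂ := (gaussFn L (y - x) : ℂ) * ψ y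

theorem gaussFn_bounds (L : E n →ₗ[ℝ] E n) (x : E n) :
    0 ≤ gaussFn L x ∧ gaussFn L x ≤ (√(gaussNorm L))⁻¹ := by
  have h1 : Real.exp (-1 * ‖L x‖ ^ 2) ≤ 1 := Real.exp_le_one_iff.mpr (by nlinarith [sq_nonneg ‖L x‖])
  have h2 : 0 ≤ (√(gaussNorm L))⁻¹ := by positivity
  exact ⟨mul_nonneg h2 (Real.exp_pos _).le, mul_le_of_le_one_right h2 h1⟩

theorem memLp_window (L : E n →ₗ[ℝ] E n) (ψ : L2 n) (x : E n) : MemLp (window L ψ x) 2 volume := by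
  have hc := continuous_gaussFn L
  refine (Lp.memLp ψ).of_le_mul (c := (√(gaussNorm L))⁻¹) ?_ (Filter.Eventually.of_forall fun y => ?_)
  · exact (Continuous.aestronglyMeasurable (by fun_prop)).mul (Lp.memLp ψ).1
  · rw [window, norm_mul, Complex.norm_real, Real.norm_of_nonneg (gaussFn_bounds L _).1]
    exact mul_le_mul_of_nonneg_right (gaussFn_bounds L _).2 (norm_nonneg _)

theorem integrable_window (hL : LinearMap.det L ≠ 0) (ψ : L2 n) (x : E n) :
    Integrable (window L ψ x) :=
  ((memLp_gaussFn hL).comp_measurePreserving (measurePreserving_sub_right volume x)).integrable_mul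
    (Lp.memLp ψ)

/-- The windowed Fourier transform of `ψ`; up to a phase, `⟪W(x, 2πħξ) φ, ψ⟫` for the Gaussian wave
function `φ`. -/
def windowFourier (L : E n →ₗ[ℝ] E n) (ψ : E n → ℂ) (z : E n × E n) : ℂ := 𝓕 (window L ψ z.1) z.2

theorem stronglyMeasurable_windowFourier (L : E n →ₗ[ℝ] E n) (ψ : L2 n) :
    StronglyMeasurable (windowFourier L ψ) := by
  have hc := continuous_gaussFn L
  have h : windowFourier L ψ = fun z : E n × E n => ∫ y,
      Complex.exp (↑(-2 * Real.pi * ⟪y, z.2⟫_ℝ) * Complex.I) • ((gaussFn L (y - z.1) : ℂ) * ψ y) := by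
    funext z
    exact Real.fourier_eq' _ _
  rw [h]
  refine StronglyMeasurable.integral_prod_right' (f := fun p : (E n × E n) × E n =>
    Complex.exp (↑(-2 * Real.pi * ⟪p.2, p.1.2⟫_ℝ) * Complex.I) •
      ((gaussFn L (p.2 - p.1.1) : ℂ) * ψ p.2)) ?_
  have h1 : Continuous fun p : (E n × E n) × E n =>
      Complex.exp (↑(-2 * Real.pi * ⟪p.2, p.1.2⟫_ℝ) * Complex.I) := by fun_prop
  have h2 : Continuous fun p : (E n × E n) × E n => (gaussFn L (p.2 - p.1.1) : ℂ) := by fun_prop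
  refine h1.stronglyMeasurable.smul (h2.stronglyMeasurable.mul ?_)
  exact (Lp.stronglyMeasurable ψ).comp_measurable measurable_snd

theorem lintegral_gaussFn_sq (hLN : ∀ a x, ⟪N a, L x⟫_ℝ = ⟪a, x⟫_ℝ) :
    ∫⁻ x, ‖(gaussFn L x : ℂ)‖ₑ ^ 2 = 1 := by
  have h := integral_gaussFn_overlap hLN 0 0
  have h2 : ∫ x, gaussFn L x ^ 2 = 1 := by
    apply Complex.ofReal_injective
    rw [← integral_complex_ofReal]
    simpa [sq] using h
  have h3 := ofReal_integral_eq_lintegral_ofReal (integrable_gaussFn_sq (det_ne_zero_of_dual hLN))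
    (Filter.Eventually.of_forall fun x => sq_nonneg _)
  rw [h2, ENNReal.ofReal_one] at h3
  rw [h3]
  refine lintegral_congr fun x => ?_
  rw [← ofReal_norm, Complex.norm_real, ← ENNReal.ofReal_pow (norm_nonneg _), Real.norm_eq_abs,
    sq_abs]

theorem lintegral_windowFourier (hLN : ∀ a x, ⟪N a, L x⟫_ℝ = ⟪a, x⟫_ℝ) (ψ : L2 n) :
    ∫⁻ z, ‖windowFourier L ψ z‖ₑ ^ 2 ∂(volume.prod volume) = ∫⁻ y, ‖ψ y‖ₑ ^ 2 := by
  have hL := det_ne_zero_of_dual hLN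
  have hc := continuous_gaussFn L
  have hψ : Measurable ψ := (Lp.stronglyMeasurable ψ).measurable
  rw [lintegral_prod _ ((stronglyMeasurable_windowFourier L ψ).measurable.enorm.pow_const 2).aemeasurable]
  have e1 : ∀ x : E n, ∫⁻ ξ, ‖windowFourier L ψ (x, ξ)‖ₑ ^ 2
      = ∫⁻ y, ‖(gaussFn L (y - x) : ℂ)‖ₑ ^ 2 * ‖ψ y‖ₑ ^ 2 := by
    intro x
    refine (lintegral_fourier_enorm_sq (integrable_window hL ψ x) (memLp_window L ψ x)).trans ?_
    refine lintegral_congr fun y => ?_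
    rw [window, enorm_mul, mul_pow]
  simp only [e1]
  rw [lintegral_lintegral_swap (by fun_prop)]
  refine lintegral_congr fun y => ?_
  rw [lintegral_mul_const _ (by fun_prop),
    lintegral_sub_left_eq_self (fun x => ‖(gaussFn L x : ℂ)‖ₑ ^ 2) y, lintegral_gaussFn_sq hLN,
    one_mul]

theorem memLp_windowFourier (hLN : ∀ a x, ⟪N a, L x⟫_ℝ = ⟪a, x⟫_ℝ) (ψ : L2 n) :
    MemLp (windowFourier L ψ) 2 (volume.prod volume) ∧
      eLpNorm (windowFourier L ψ) 2 (volume.prod volume) = eLpNorm ψ 2 volume := by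
  have e : eLpNorm (windowFourier L ψ) 2 (volume.prod volume) = eLpNorm ψ 2 volume := by
    rw [eLpNorm_eq_lintegral_rpow_enorm_toReal (by simp) (by simp),
      eLpNorm_eq_lintegral_rpow_enorm_toReal (by simp) (by simp)]
    simp only [ENNReal.toReal_ofNat, ENNReal.rpow_ofNat, lintegral_windowFourier hLN ψ]
  exact ⟨⟨(stronglyMeasurable_windowFourier L ψ).aestronglyMeasurable, e ▸ (Lp.memLp ψ).2⟩, e⟩

/-- The windowed Fourier transform is an isometry from `L²(ℝⁿ)` to `L²(ℝⁿ × ℝⁿ)`. -/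
def windowIsometry (hLN : ∀ a x, ⟪N a, L x⟫_ℝ = ⟪a, x⟫_ℝ) :
    L2 n →ₗᵢ[ℂ] Lp ℂ 2 ((volume : Measure (E n)).prod (volume : Measure (E n))) where
  toFun ψ := (memLp_windowFourier hLN ψ).1.toLp
  map_add' ψ χ := by
    rw [← MemLp.toLp_add]
    congr 1
    funext z
    have hi := integrable_window (det_ne_zero_of_dual hLN)
    simp only [windowFourier, Pi.add_apply]
    rw [Real.fourier_eq, Real.fourier_eq, Real.fourier_eq, ← integral_add
      ((Real.fourierIntegral_convergent_iff z.2).mpr (hi ψ z.1))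
      ((Real.fourierIntegral_convergent_iff z.2).mpr (hi χ z.1))]
    refine integral_congr_ae ?_
    filter_upwards [Lp.coeFn_add ψ χ] with y hy
    rw [window, hy, window, window, Pi.add_apply, mul_add, smul_add]
  map_smul' c ψ := by
    rw [RingHom.id_apply, ← MemLp.toLp_const_smul]
    congr 1
    funext z
    simp only [windowFourier, Pi.smul_apply]
    rw [Real.fourier_eq, Real.fourier_eq, ← integral_smul]
    refine integral_congr_ae ?_
    filter_upwards [Lp.coeFn_smul c ψ] with y hy
    rw [window, hy, window, Pi.smul_apply, mul_smul_comm, smul_comm]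
  norm_map' ψ := by
    change ‖(memLp_windowFourier hLN ψ).1.toLp‖ = ‖ψ‖
    rw [Lp.norm_toLp, (memLp_windowFourier hLN ψ).2, Lp.norm_def]

/-- The characteristic function, in the momentum variable, of a slice of the windowed Fourier
transform: this is the momentum distribution of the windowed function. -/
theorem integral_windowFourier_slice (hħ : ħ ≠ 0) (hL : LinearMap.det L ≠ 0) (ψ : L2 n) (b x : E n) :
    ∫ ξ, ((‖windowFourier L ψ (x, ξ)‖ ^ 2 : ℝ) : ℂ) *
        Complex.exp (Complex.I * ⟪b, (2 * Real.pi * ħ) • ξ⟫_ℝ)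
      = ∫ y, ((gaussFn L (y - x) * gaussFn L (y - x + ħ • b) : ℝ) : ℂ) *
          (ψ (y + ħ • b) * starRingEnd ℂ (ψ y)) := by
  set hi := integrable_window hL ψ x
  set hm := memLp_window L ψ x
  set f := hm.toLp (window L ψ x)
  have h1 := (momentum_hasIntegral hħ b).of_map _ (by fun_prop) f
  rw [POVM.vecMeasure_conj, vecMeasure_position,
    integral_withDensity_enorm_sq _ _ (Lp.memLp _).1] at h1
  have e1 : ∫ ξ, ((‖windowFourier L ψ (x, ξ)‖ ^ 2 : ℝ) : ℂ) *
        Complex.exp (Complex.I * ⟪b, (2 * Real.pi * ħ) • ξ⟫_ℝ)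
      = ∫ ξ, ((‖Lp.fourierTransformₗᵢ (E n) ℂ f ξ‖ ^ 2 : ℝ) : ℂ) *
        Complex.exp (Complex.I * ⟪b, (2 * Real.pi * ħ) • ξ⟫_ℝ) := by
    refine integral_congr_ae ?_
    filter_upwards [fourierTransform_toLp hi hm] with ξ h
    rw [h, windowFourier]
  rw [e1, h1, L2.inner_def]
  refine integral_congr_ae ?_
  filter_upwards [weyl_coeFn ħ (-ħ • b) 0 f, ae_comp_sub hm.coeFn_toLp (-ħ • b),
    hm.coeFn_toLp] with y e1 e2 e3
  rw [e1, e2, e3, RCLike.inner_apply, neg_smul, sub_neg_eq_add, window, window, map_mul,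
    Complex.conj_ofReal, add_sub_right_comm]
  simp
  ring

theorem norm_exp_I_inner (a x : E n) : ‖Complex.exp (Complex.I * ⟪a, x⟫_ℝ)‖ = 1 := by
  rw [Complex.norm_exp]; simp

/-- Integrating the slices over the centre of the window replaces the window by its overlap with a
translate, which is again Gaussian. -/
theorem integral_window_swap (hLN : ∀ a x, ⟪N a, L x⟫_ℝ = ⟪a, x⟫_ℝ) (a b : E n) {Ψ : E n → ℂ}
    (hΨi : Integrable Ψ) :
    ∫ x, Complex.exp (Complex.I * ⟪a, x⟫_ℝ) *
        ∫ y, ((gaussFn L (y - x) * gaussFn L (y - x + b) : ℝ) : ℂ) * Ψ y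
      = ∫ y, Complex.exp (Complex.I * ⟪a, y⟫_ℝ) * Ψ y *
        (Complex.exp (Complex.I * (⟪a, b⟫_ℝ / 2 : ℝ)) *
          Real.exp (-‖L b‖ ^ 2 / 2 - ‖N a‖ ^ 2 / 8)) := by
  have hL := det_ne_zero_of_dual hLN
  have hc := continuous_gaussFn L
  set G : E n → ℝ := fun x => gaussFn L x * gaussFn L (x + b) with hG
  have hGc : Continuous G := by fun_prop
  have hGi : Integrable G := by
    have h1 := integrable_gaussFn_sq hL
    have h2 := h1.comp_add_right b
    refine (h1.add h2).mono hGc.aestronglyMeasurable (Filter.Eventually.of_forall fun x => ?_)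
    simp only [hG, Pi.add_apply, Real.norm_eq_abs]
    rw [abs_of_nonneg (mul_nonneg (gaussFn_bounds L _).1 (gaussFn_bounds L _).1),
      abs_of_nonneg (by positivity)]
    nlinarith [sq_nonneg (gaussFn L x - gaussFn L (x + b)), sq_nonneg (gaussFn L x),
      sq_nonneg (gaussFn L (x + b))]
  have hint : Integrable (Function.uncurry fun x y : E n =>
      Complex.exp (Complex.I * ⟪a, x⟫_ℝ) * ((G (y - x) : ℂ) * Ψ y)) (volume.prod volume) := by
    rw [integrable_prod_iff' ?_]
    · refine ⟨Filter.Eventually.of_forall fun y => ?_, ?_⟩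
      · have h3 : Integrable fun x => (G (y - x) : ℂ) := (hGi.comp_sub_left y).ofReal
        simp only [Function.uncurry]
        generalize Ψ y = c
        refine (h3.norm.mul_const ‖c‖).mono' (Continuous.aestronglyMeasurable (by fun_prop))
          (Filter.Eventually.of_forall fun x => ?_)
        rw [norm_mul, norm_mul, norm_exp_I_inner, one_mul]
      · simp only [Function.uncurry, norm_mul, norm_exp_I_inner, one_mul, integral_mul_const]
        have h4 : ∀ y, ∫ x, ‖(G (y - x) : ℂ)‖ = ∫ x, ‖(G x : ℂ)‖ := fun y =>
          integral_sub_left_eq_self (fun x => ‖(G x : ℂ)‖) volume y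
        simp only [h4]
        exact hΨi.norm.const_mul _
    · have h5 : Continuous fun z : E n × E n => Complex.exp (Complex.I * ⟪a, z.1⟫_ℝ) := by fun_prop
      have h6 : Continuous fun z : E n × E n => (G (z.2 - z.1) : ℂ) := by fun_prop
      exact h5.aestronglyMeasurable.mul (h6.aestronglyMeasurable.mul hΨi.1.comp_snd)
  simp only [← integral_const_mul]
  rw [integral_integral_swap hint]
  refine integral_congr_ae (Filter.Eventually.of_forall fun y => ?_)
  have h7 := integral_gaussFn_overlap hLN (-a) b
  have h8 : Complex.exp (-Complex.I * ((⟪-a, b⟫_ℝ / 2 : ℝ) : ℂ))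
      = Complex.exp (Complex.I * (⟪a, b⟫_ℝ / 2 : ℝ)) := by
    congr 1; rw [inner_neg_left]; push_cast; ring
  rw [map_neg, norm_neg, h8] at h7
  simp only []
  rw [← h7, ← integral_const_mul, ← integral_sub_left_eq_self (fun x =>
    Complex.exp (Complex.I * ⟪a, y⟫_ℝ) * Ψ y * _) volume y]
  refine integral_congr_ae (Filter.Eventually.of_forall fun x => ?_)
  have h9 : Complex.exp (Complex.I * ⟪a, x⟫_ℝ)
      = Complex.exp (Complex.I * ⟪a, y⟫_ℝ) * Complex.exp (Complex.I * ⟪-a, y - x⟫_ℝ) := by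
    rw [← Complex.exp_add]
    congr 1
    rw [inner_neg_left, inner_sub_right]
    push_cast
    ring
  simp only [h9, hG]
  ring

/-- The characteristic function of the phase space distribution of `ψ`. -/
theorem integral_windowFourier_char (hħ : ħ ≠ 0) (hLN : ∀ a x, ⟪N a, L x⟫_ℝ = ⟪a, x⟫_ℝ) (ψ : L2 n)
    (a b : E n) :
    ∫ z : E n × E n, Complex.exp (Complex.I * ⟪a, z.1⟫_ℝ) * (((‖windowFourier L ψ z‖ ^ 2 : ℝ) : ℂ) *
        Complex.exp (Complex.I * ⟪b, (2 * Real.pi * ħ) • z.2⟫_ℝ)) ∂(volume.prod volume)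
      = Real.exp (-‖L (ħ • b)‖ ^ 2 / 2 - ‖N a‖ ^ 2 / 8) * ⟪ψ, weyl ħ (-ħ • b) (ħ • a) ψ⟫_ℂ := by
  have hL := det_ne_zero_of_dual hLN
  have hWL := (memLp_windowFourier hLN ψ).1
  have hint : Integrable (fun z : E n × E n => Complex.exp (Complex.I * ⟪a, z.1⟫_ℝ) *
      (((‖windowFourier L ψ z‖ ^ 2 : ℝ) : ℂ) *
      Complex.exp (Complex.I * ⟪b, (2 * Real.pi * ħ) • z.2⟫_ℝ))) (volume.prod volume) := by
    have h2 : Integrable (fun z => ‖windowFourier L ψ z‖ ^ 2) (volume.prod volume) :=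
      (memLp_two_iff_integrable_sq_norm hWL.1).mp hWL
    refine h2.mono ?_ (Filter.Eventually.of_forall fun z => ?_)
    · have h3 : Continuous fun z : E n × E n => Complex.exp (Complex.I * ⟪a, z.1⟫_ℝ) := by fun_prop
      have h4 : Continuous fun z : E n × E n =>
        Complex.exp (Complex.I * ⟪b, (2 * Real.pi * ħ) • z.2⟫_ℝ) := by fun_prop
      exact h3.aestronglyMeasurable.mul
        ((Complex.continuous_ofReal.comp_aestronglyMeasurable h2.1).mul h4.aestronglyMeasurable)
    · rw [norm_mul, norm_exp_I_inner, norm_mul, norm_exp_I_inner]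
      simp
  rw [integral_prod _ hint]
  simp only [integral_const_mul, integral_windowFourier_slice hħ hL]
  have hΨi : Integrable fun y => ψ (y + ħ • b) * starRingEnd ℂ (ψ y) :=
    ((Lp.memLp ψ).comp_measurePreserving (measurePreserving_add_right volume (ħ • b))).integrable_mul
      (Lp.memLp ψ).star
  rw [integral_window_swap hLN a (ħ • b) hΨi, L2.inner_def, ← integral_const_mul]
  refine integral_congr_ae ?_
  filter_upwards [weyl_coeFn ħ (-ħ • b) (ħ • a) ψ] with y hy
  have hħ' : (ħ : ℂ) ≠ 0 := by exact_mod_cast hħ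
  rw [hy, RCLike.inner_apply, neg_smul, sub_neg_eq_add]
  have h10 : Complex.exp (Complex.I / ħ *
      ((⟪ħ • a, y⟫_ℝ - ⟪-(ħ • b), ħ • a⟫_ℝ / 2 : ℝ) : ℂ))
      = Complex.exp (Complex.I * ⟪a, y⟫_ℝ) * Complex.exp (Complex.I * (⟪a, ħ • b⟫_ℝ / 2 : ℝ)) := by
    rw [← Complex.exp_add]
    congr 1
    simp only [inner_neg_left, real_inner_smul_left, real_inner_smul_right, real_inner_comm a b]
    push_cast
    field_simp
    ring
  rw [h10]
  ring

/-- The phase space distributions given by the windowed Fourier transform with a Gaussian window form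
a bi-observable whose noise is the one of the window. -/
theorem exists_coherent (hħ : ħ ≠ 0) (hLN : ∀ a x, ⟪N a, L x⟫_ℝ = ⟪a, x⟫_ℝ) (u v : E n) :
    ∃ M : POVM (L2 n) (ℝ × ℝ), ∀ k l, M.HasCharOp k l
      (gaussFactor 0 0 !![‖N u‖ ^ 2 / 4, 0; 0, ħ ^ 2 * ‖L v‖ ^ 2] k l • weylUV ħ u v k l) := by
  obtain ⟨M₀, hM₀⟩ := POVM.exists_of_isometry (windowIsometry hLN)
  refine ⟨M₀.map (fun z => (⟪u, z.1⟫_ℝ, ⟪v, (2 * Real.pi * ħ) • z.2⟫_ℝ)) (by fun_prop),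
    fun k l => ?_⟩
  refine POVM.HasIntegral.map _ (POVM.measurable_char k l) fun ψ => ?_
  have hW := (memLp_windowFourier hLN ψ).1.coeFn_toLp
  rw [hM₀, integral_withDensity_enorm_sq _ _ (Lp.memLp _).1, smul_apply, inner_smul_right]
  have h11 : gaussFactor 0 0 !![‖N u‖ ^ 2 / 4, 0; 0, ħ ^ 2 * ‖L v‖ ^ 2] k l =
      Real.exp (-‖L (ħ • l • v)‖ ^ 2 / 2 - ‖N (k • u)‖ ^ 2 / 8) := by
    have hns : ∀ (c : ℝ) (x : E n), ‖c • x‖ ^ 2 = c ^ 2 * ‖x‖ ^ 2 := fun c x => by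
      rw [norm_smul, mul_pow, Real.norm_eq_abs, sq_abs]
    rw [gaussFactor, Complex.ofReal_exp]
    congr 1
    simp only [map_smul, hns]
    simp [Matrix.mulVec, dotProduct, Fin.sum_univ_two]
    ring
  rw [h11, weylUV, ← integral_windowFourier_char hħ hLN]
  refine integral_congr_ae ?_
  filter_upwards [hW] with z hz
  have hz' : windowIsometry hLN ψ z = windowFourier L ψ z := hz
  rw [hz', mul_left_comm, ← Complex.exp_add]
  congr 2
  rw [real_inner_smul_left, real_inner_smul_left]
  push_cast
  ring

end Coherent

/-! ### Optimal bi-observables -/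

/-- The points `(p, s)` of the hyperbola `p s = (ħ/2 ⟪u, v⟫)²` with positive coordinates, and the
origin if `⟪u, v⟫ = 0`, are the noise variances of unbiased Gaussian covariant bi-observables with
uncorrelated noises. -/
theorem exists_gaussCov (hħ : 0 < ħ) {u v : E n} (hu : ‖u‖ = 1) {p s : ℝ}
    (h : 0 < p ∧ 0 < s ∨ p = 0 ∧ s = 0) (hps : p * s = (ħ / 2 * ⟪u, v⟫_ℝ) ^ 2) :
    ∃ M : POVM (L2 n) (ℝ × ℝ), M ∈ gaussCov ħ u v ∧ HasParams ħ M 0 0 !![p, 0; 0, s] := by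
  rcases h with ⟨hp, hs⟩ | ⟨rfl, rfl⟩
  · have hc : ⟪u, v⟫_ℝ ≠ 0 := by
      intro hc
      rw [hc, mul_zero] at hps
      nlinarith [mul_pos hp hs]
    obtain ⟨L, N, hLN, h3, h4⟩ := exists_dual_of_inner_ne_zero hu hc
      (s := ⟪u, v⟫_ℝ / (2 * √p)) (by positivity)
    have hN : ‖N u‖ ^ 2 / 4 = p := by
      rw [h3, div_pow, mul_pow, Real.sq_sqrt hp.le]
      field_simp
      ring
    have hL : ħ ^ 2 * ‖L v‖ ^ 2 = s := by
      rw [h4, div_pow, mul_pow, Real.sq_sqrt hp.le]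
      field_simp
      linarith
    obtain ⟨M, hM⟩ := exists_coherent hħ.ne' hLN u v
    rw [hN, hL] at hM
    exact ⟨M, mem_gaussCov_of_hasCharOp hħ.ne' hp.le hs.le hps.ge hM⟩
  · have hc : ⟪u, v⟫_ℝ = 0 := by
      by_contra hc
      have : 0 < (ħ / 2 * ⟪u, v⟫_ℝ) ^ 2 := by positivity
      linarith
    obtain ⟨M, hM⟩ := exists_sharp_joint hħ.ne' hu hc
    refine ⟨M, mem_gaussCov_of_hasCharOp hħ.ne' le_rfl le_rfl hps.ge fun k l => ?_⟩
    have h1 : gaussFactor 0 0 !![0, 0; 0, 0] k l = 1 := by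
      simp [gaussFactor, Matrix.mulVec, dotProduct, Fin.sum_univ_two]
    rw [h1, one_smul]
    exact hM k l

/-! ### The error function and its supremum over states -/

/-- The error (in nats) at a Gaussian state with variances `q₁, q₂` of a bi-observable with
biases `a, b` and noise variances `p, s`. -/
def gaussError (a b p s q₁ q₂ : ℝ) : ℝ :=
  (noiseFn (p / q₁) + a ^ 2 / (q₁ + p)) / 2 + (noiseFn (s / q₂) + b ^ 2 / (q₂ + s)) / 2

theorem gaussError_anti (a b : ℝ) {p s q₁ q₂ r₁ r₂ : ℝ} (hp : 0 ≤ p) (hs : 0 ≤ s)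
    (h₁ : 0 < q₁) (h₂ : 0 < q₂) (hr₁ : q₁ ≤ r₁) (hr₂ : q₂ ≤ r₂) :
    gaussError a b p s r₁ r₂ ≤ gaussError a b p s q₁ q₂ := by
  have h1 : noiseFn (p / r₁) ≤ noiseFn (p / q₁) :=
    noiseFn_le (div_nonneg hp (h₁.le.trans hr₁)) (by gcongr)
  have h2 : noiseFn (s / r₂) ≤ noiseFn (s / q₂) :=
    noiseFn_le (div_nonneg hs (h₂.le.trans hr₂)) (by gcongr)
  have h3 : a ^ 2 / (r₁ + p) ≤ a ^ 2 / (q₁ + p) := by gcongr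
  have h4 : b ^ 2 / (r₂ + s) ≤ b ^ 2 / (q₂ + s) := by gcongr
  unfold gaussError
  linarith

/-- The error is smallest for an unbiased bi-observable with equal relative noises. -/
theorem le_gaussError {a b p s q₁ q₂ c : ℝ} (hp : 0 ≤ p) (hs : 0 ≤ s) (h₁ : 0 < q₁) (h₂ : 0 < q₂)
    (hc : 0 ≤ c) (h : c ^ 2 * (q₁ * q₂) ≤ p * s) :
    noiseFn c ≤ gaussError a b p s q₁ q₂ ∧
      (gaussError a b p s q₁ q₂ = noiseFn c → a = 0 ∧ b = 0 ∧ p = q₁ * c ∧ s = q₂ * c) := by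
  have h3 : c ^ 2 ≤ p / q₁ * (s / q₂) := by
    rw [div_mul_div_comm, le_div_iff₀ (by positivity)]
    exact h
  obtain ⟨h4, h5⟩ := two_mul_noiseFn_le (div_nonneg hp h₁.le) (div_nonneg hs h₂.le) hc h3
  have h6 : 0 ≤ a ^ 2 / (q₁ + p) := by positivity
  have h7 : 0 ≤ b ^ 2 / (q₂ + s) := by positivity
  refine ⟨by unfold gaussError; linarith, fun he => ?_⟩
  unfold gaussError at he
  obtain ⟨h8, h9⟩ := h5 (by linarith)
  have ha : a ^ 2 / (q₁ + p) = 0 := by linarith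
  have hb : b ^ 2 / (q₂ + s) = 0 := by linarith
  rw [div_eq_zero_iff] at ha hb
  refine ⟨?_, ?_, ?_, ?_⟩
  · exact pow_eq_zero_iff two_ne_zero |>.mp (ha.resolve_right (by positivity))
  · exact pow_eq_zero_iff two_ne_zero |>.mp (hb.resolve_right (by positivity))
  · rw [← h8, mul_div_cancel₀ _ h₁.ne']
  · rw [← h9, mul_div_cancel₀ _ h₂.ne']

theorem gaussError_mul {q₁ q₂ : ℝ} (h₁ : 0 < q₁) (h₂ : 0 < q₂) (c : ℝ) :
    gaussError 0 0 (q₁ * c) (q₂ * c) q₁ q₂ = noiseFn c := by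
  rw [gaussError, mul_div_cancel_left₀ _ h₁.ne', mul_div_cancel_left₀ _ h₂.ne']
  ring

theorem logb_two_exp_one_pos : 0 < Real.logb 2 (Real.exp 1) :=
  Real.logb_pos one_lt_two (Real.one_lt_exp_iff.mpr one_pos)

/-- When the uncertainty relation allows a Gaussian state with variances exactly `ε₁, ε₂`, the error
is largest at such a state, because it decreases in both variances. -/
theorem divergence_eq (hħ : 0 < ħ) {u v : E n} (hu : ‖u‖ = 1) (hv : ‖v‖ = 1) {ε₁ ε₂ : ℝ}
    (h₁ : 0 < ε₁) (h₂ : 0 < ε₂) (hε : ħ ^ 2 / 4 * ⟪u, v⟫_ℝ ^ 2 ≤ ε₁ * ε₂)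
    {M : POVM (L2 n) (ℝ × ℝ)} (hM : IsCovariant ħ u v M) {a b : ℝ} {V : Matrix (Fin 2) (Fin 2) ℝ}
    (h : HasParams ħ M a b V) :
    divergence ħ u v ε₁ ε₂ M = ENNReal.ofReal
      (Real.logb 2 (Real.exp 1) * gaussError a b (V 0 0) (V 1 1) ε₁ ε₂) := by
  obtain ⟨J, h⟩ := h
  obtain ⟨hp, hs, -, -⟩ := h.noise_ineq hħ.ne' hM
  refine le_antisymm (iSup₂_le fun ρ ⟨hρ, hρ₁, hρ₂⟩ => ?_) ?_
  · rw [errorFn_eq hħ.ne' hρ hM h (h₁.trans_le hρ₁) (h₂.trans_le hρ₂)]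
    exact ENNReal.ofReal_le_ofReal (mul_le_mul_of_nonneg_left
      (gaussError_anti a b hp hs h₁ h₂ hρ₁ hρ₂) logb_two_exp_one_pos.le)
  · obtain ⟨ρ, hρ, hρ₁, hρ₂⟩ := exists_gaussianState hħ hu hv h₁ h₂ hε
    refine le_trans (le_of_eq ?_)
      (le_iSup₂ (f := fun ρ (_ : ρ ∈ gaussStates ħ u v ε₁ ε₂) => errorFn ħ u v ρ M) ρ
        ⟨hρ, hρ₁.ge, hρ₂.ge⟩)
    rw [errorFn_eq hħ.ne' hρ hM h (hρ₁ ▸ h₁) (hρ₂ ▸ h₂), hρ₁, hρ₂]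
    rfl

/-- If the diagonal entries of a noise matrix attain equality in the uncertainty relation, there is
no room for an off-diagonal entry. -/
theorem eq_diagonal_of_noise {V : Matrix (Fin 2) (Fin 2) ℝ} {p s d : ℝ} (hp : V 0 0 = p)
    (hs : V 1 1 = s) (hsymm : V 1 0 = V 0 1) (h : V 0 1 ^ 2 + d ^ 2 ≤ V 0 0 * V 1 1)
    (hd : p * s = d ^ 2) : V = !![p, 0; 0, s] := by
  rw [hp, hs, hd] at h
  have h0 : V 0 1 = 0 := pow_eq_zero_iff two_ne_zero |>.mp
    (le_antisymm (by linarith) (sq_nonneg _))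
  ext i j
  fin_cases i <;> fin_cases j <;> simp [hp, hs, hsymm, h0]

/-! ### The incompatibility degree -/

/-- The minimal divergence and its unique minimizer, in terms of the ratio `c` of the
minimal uncertainty product and `√(ε₁ ε₂)`. -/
theorem incDegree_eq (hħ : 0 < ħ) {u v : E n} (hu : ‖u‖ = 1) (hv : ‖v‖ = 1) {ε₁ ε₂ c : ℝ}
    (h₁ : 0 < ε₁) (h₂ : 0 < ε₂) (hε : ħ ^ 2 / 4 * ⟪u, v⟫_ℝ ^ 2 ≤ ε₁ * ε₂) (hc : 0 ≤ c)
    (hc' : c ^ 2 * (ε₁ * ε₂) = (ħ / 2 * ⟪u, v⟫_ℝ) ^ 2) :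
    incDegree ħ u v ε₁ ε₂ = ENNReal.ofReal (Real.logb 2 (Real.exp 1) * noiseFn c) ∧
      (∃! M, M ∈ gaussCov ħ u v ∧ divergence ħ u v ε₁ ε₂ M = incDegree ħ u v ε₁ ε₂) ∧
      ∀ M ∈ gaussCov ħ u v, divergence ħ u v ε₁ ε₂ M = incDegree ħ u v ε₁ ε₂ ↔
        HasParams ħ M 0 0 !![ε₁ * c, 0; 0, ε₂ * c] := by
  have hps : ε₁ * c * (ε₂ * c) = (ħ / 2 * ⟪u, v⟫_ℝ) ^ 2 := by rw [← hc']; ring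
  have hcase : 0 < ε₁ * c ∧ 0 < ε₂ * c ∨ ε₁ * c = 0 ∧ ε₂ * c = 0 := by
    rcases hc.eq_or_lt with rfl | hc
    · simp
    · exact Or.inl ⟨by positivity, by positivity⟩
  obtain ⟨M₀, hM₀, hP₀⟩ := exists_gaussCov hħ hu hcase hps
  have hdiv : ∀ M ∈ gaussCov ħ u v, HasParams ħ M 0 0 !![ε₁ * c, 0; 0, ε₂ * c] →
      divergence ħ u v ε₁ ε₂ M
        = ENNReal.ofReal (Real.logb 2 (Real.exp 1) * noiseFn c) := by
    intro M hM hP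
    rw [divergence_eq hħ hu hv h₁ h₂ hε hM.1 hP, ← gaussError_mul h₁ h₂ c]
    simp
  have hmin : ∀ M ∈ gaussCov ħ u v,
      ENNReal.ofReal (Real.logb 2 (Real.exp 1) * noiseFn c) ≤ divergence ħ u v ε₁ ε₂ M ∧
      (divergence ħ u v ε₁ ε₂ M = ENNReal.ofReal (Real.logb 2 (Real.exp 1) * noiseFn c) →
        HasParams ħ M 0 0 !![ε₁ * c, 0; 0, ε₂ * c]) := by
    rintro M ⟨hM, a, b, V, J, h⟩
    obtain ⟨hp, hs, hsymm, hV⟩ := h.noise_ineq hħ.ne' hM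
    obtain ⟨h3, h4⟩ := le_gaussError (a := a) (b := b) hp hs h₁ h₂ hc
      (by rw [hc']; nlinarith [sq_nonneg (V 0 1)])
    rw [divergence_eq hħ hu hv h₁ h₂ hε hM ⟨J, h⟩]
    refine ⟨ENNReal.ofReal_le_ofReal (mul_le_mul_of_nonneg_left h3 logb_two_exp_one_pos.le),
      fun he => ?_⟩
    have h5 := noiseFn_nonneg hc
    rw [ENNReal.ofReal_eq_ofReal_iff
      (mul_nonneg logb_two_exp_one_pos.le (h5.trans h3))
      (mul_nonneg logb_two_exp_one_pos.le h5)] at he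
    obtain ⟨rfl, rfl, h6, h7⟩ := h4 (mul_left_cancel₀ logb_two_exp_one_pos.ne' he)
    rw [← eq_diagonal_of_noise h6 h7 hsymm hV hps]
    exact ⟨J, h⟩
  have hinc : incDegree ħ u v ε₁ ε₂
      = ENNReal.ofReal (Real.logb 2 (Real.exp 1) * noiseFn c) :=
    le_antisymm ((iInf₂_le M₀ hM₀).trans_eq (hdiv M₀ hM₀ hP₀))
      (le_iInf₂ fun M hM => (hmin M hM).1)
  refine ⟨hinc, ⟨M₀, ⟨hM₀, by rw [hinc, hdiv M₀ hM₀ hP₀]⟩, fun M ⟨hM, hMd⟩ => ?_⟩,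
    fun M hM => ⟨fun hd => (hmin M hM).2 (hd.trans hinc), fun hP => by rw [hinc, hdiv M hM hP]⟩⟩
  exact eq_of_hasParams hħ.ne' hM.1 hM₀.1 ((hmin M hM).2 (hMd.trans hinc)) hP₀

theorem noiseFn_one : noiseFn 1 = Real.log 2 - 1 / 2 := by norm_num [noiseFn]

/-- At a Gaussian state of minimal uncertainty every Gaussian covariant bi-observable has relative
noises of product at least one. -/
theorem le_errorFn (hħ : 0 < ħ) {u v : E n} {ρ : State (L2 n)} (hρ : IsGaussianState ħ ρ)
    (hQ : 0 < varQ u ρ) (hP : 0 < varP ħ v ρ)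
    (hmin : varQ u ρ * varP ħ v ρ = (ħ / 2 * ⟪u, v⟫_ℝ) ^ 2) {M : POVM (L2 n) (ℝ × ℝ)}
    (hM : M ∈ gaussCov ħ u v) :
    ENNReal.ofReal (Real.logb 2 (Real.exp 1) * (Real.log 2 - 1 / 2)) ≤ errorFn ħ u v ρ M := by
  obtain ⟨hM, a, b, V, J, h⟩ := hM
  obtain ⟨hp, hs, hsymm, hV⟩ := h.noise_ineq hħ.ne' hM
  rw [errorFn_eq hħ.ne' hρ hM h hQ hP, ← noiseFn_one]
  refine ENNReal.ofReal_le_ofReal (mul_le_mul_of_nonneg_left ?_ logb_two_exp_one_pos.le)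
  exact (le_gaussError hp hs hQ hP zero_le_one
    (by rw [hmin]; nlinarith [sq_nonneg (V 0 1)])).1

/-- At a Gaussian state of minimal uncertainty the bi-observable whose noise variances are the
variances of the state attains the lower bound `le_errorFn`. -/
theorem errorFn_eq_of_minimal (hħ : 0 < ħ) {u v : E n} {ρ : State (L2 n)}
    (hρ : IsGaussianState ħ ρ) (hQ : 0 < varQ u ρ) (hP : 0 < varP ħ v ρ)
    {M : POVM (L2 n) (ℝ × ℝ)} (hM : M ∈ gaussCov ħ u v)
    (h : HasParams ħ M 0 0 !![varQ u ρ, 0; 0, varP ħ v ρ]) :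
    errorFn ħ u v ρ M
      = ENNReal.ofReal (Real.logb 2 (Real.exp 1) * (Real.log 2 - 1 / 2)) := by
  obtain ⟨J, h⟩ := h
  rw [errorFn_eq hħ.ne' hρ hM.1 h hQ hP, ← noiseFn_one, ← gaussError_mul hQ hP 1, gaussError]
  simp

end PosMom

end

theorem mainTheorem2 {n : ℕ} {ħ : ℝ} (hħ : 0 < ħ) (u v : PosMom.E n) (hu : ‖u‖ = 1) (hv : ‖v‖ = 1)
    (α : ℝ) (hα : ⟪u, v⟫_ℝ = Real.cos α) (ε₁ ε₂ : ℝ) (hε₁ : 0 < ε₁) (hε₂ : 0 < ε₂) :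
    (ħ ^ 2 / 4 * Real.cos α ^ 2 ≤ ε₁ * ε₂ →
      PosMom.incDegree ħ u v ε₁ ε₂ = ENNReal.ofReal (Real.logb 2 (Real.exp 1) *
        (Real.log (1 + ħ * |Real.cos α| / (2 * √(ε₁ * ε₂)))
          - ħ * |Real.cos α| / (2 * √(ε₁ * ε₂) + ħ * |Real.cos α|))) ∧
      (∃! M, M ∈ PosMom.gaussCov ħ u v ∧
        PosMom.divergence ħ u v ε₁ ε₂ M = PosMom.incDegree ħ u v ε₁ ε₂) ∧
      ∀ M ∈ PosMom.gaussCov ħ u v,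
        PosMom.divergence ħ u v ε₁ ε₂ M = PosMom.incDegree ħ u v ε₁ ε₂ ↔
          PosMom.HasParams ħ M 0 0
            !![ħ / 2 * √(ε₁ / ε₂) * |Real.cos α|, 0; 0, ħ / 2 * √(ε₂ / ε₁) * |Real.cos α|]) ∧
    (ε₁ * ε₂ < ħ ^ 2 / 4 * Real.cos α ^ 2 →
      ENNReal.ofReal (Real.logb 2 (Real.exp 1) * (Real.log 2 - 1 / 2))
        ≤ PosMom.incDegree ħ u v ε₁ ε₂ ∧
      (∃ ρ, PosMom.IsGaussianState ħ ρ ∧ PosMom.varQ u ρ = ε₁ ∧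
        PosMom.varP ħ v ρ = ħ ^ 2 / (4 * ε₁) * Real.cos α ^ 2) ∧
      (∃! M, M ∈ PosMom.gaussCov ħ u v ∧
        PosMom.HasParams ħ M 0 0 !![ε₁, 0; 0, ħ ^ 2 / (4 * ε₁) * Real.cos α ^ 2]) ∧
      ∀ M ∈ PosMom.gaussCov ħ u v,
        PosMom.HasParams ħ M 0 0 !![ε₁, 0; 0, ħ ^ 2 / (4 * ε₁) * Real.cos α ^ 2] →
        ∀ ρ, PosMom.IsGaussianState ħ ρ → PosMom.varQ u ρ = ε₁ →
          PosMom.varP ħ v ρ = ħ ^ 2 / (4 * ε₁) * Real.cos α ^ 2 →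
          PosMom.errorFn ħ u v ρ M
              = ENNReal.ofReal (Real.logb 2 (Real.exp 1) * (Real.log 2 - 1 / 2)) ∧
          ⨅ M' ∈ PosMom.gaussCov ħ u v, PosMom.errorFn ħ u v ρ M'
              = ENNReal.ofReal (Real.logb 2 (Real.exp 1) * (Real.log 2 - 1 / 2))) := by
  refine ⟨fun hε => ?_, fun hε => ?_⟩
  · rw [← hα] at hε
    have hr : 0 < √(ε₁ * ε₂) := by positivity
    have hr₁ : √ε₁ ^ 2 = ε₁ := Real.sq_sqrt hε₁.le
    have hr₂ : √ε₂ ^ 2 = ε₂ := Real.sq_sqrt hε₂.le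
    have hr' : √(ε₁ * ε₂) = √ε₁ * √ε₂ := Real.sqrt_mul hε₁.le _
    set c := ħ * |Real.cos α| / (2 * √(ε₁ * ε₂)) with hc
    have hc0 : 0 ≤ c := by positivity
    have h := PosMom.incDegree_eq hħ hu hv hε₁ hε₂ hε hc0 (by
      rw [hα, hc, div_pow, mul_pow, mul_pow, sq_abs, Real.sq_sqrt (by positivity)]
      field_simp)
    have e₁ : ε₁ * c = ħ / 2 * √(ε₁ / ε₂) * |Real.cos α| := by
      rw [hc, hr', Real.sqrt_div hε₁.le]
      nth_rewrite 1 [← hr₁]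
      field_simp
    have e₂ : ε₂ * c = ħ / 2 * √(ε₂ / ε₁) * |Real.cos α| := by
      rw [hc, hr', Real.sqrt_div hε₂.le]
      nth_rewrite 1 [← hr₂]
      field_simp
    have e₃ : c / (1 + c) = ħ * |Real.cos α| / (2 * √(ε₁ * ε₂) + ħ * |Real.cos α|) := by
      rw [hc]
      field_simp
    rw [e₁, e₂, PosMom.noiseFn, e₃] at h
    exact h
  · have hcos : Real.cos α ≠ 0 := by
      rintro h0
      rw [h0] at hε
      nlinarith [mul_pos hε₁ hε₂]
    set ε := ħ ^ 2 / (4 * ε₁) * Real.cos α ^ 2 with hεdef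
    have hε0 : 0 < ε := by positivity
    have hprod : ε₁ * ε = (ħ / 2 * ⟪u, v⟫_ℝ) ^ 2 := by
      rw [hα, hεdef]
      field_simp
      norm_num
    -- The smallest momentum variance compatible with the position variance `ε₁` exceeds `ε₂`.
    have hlt : ε₂ < ε := by
      refine lt_of_mul_lt_mul_left (a := ε₁) ?_ hε₁.le
      rw [hprod, hα]
      linarith
    obtain ⟨ρ₀, hρ₀, hQ₀, hP₀⟩ := PosMom.exists_gaussianState hħ hu hv hε₁ hε0
      (by rw [hprod]; exact le_of_eq (by ring))
    obtain ⟨M₀, hM₀, hPar₀⟩ := PosMom.exists_gaussCov hħ hu (Or.inl ⟨hε₁, hε0⟩) hprod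
    have hlow : ∀ ρ, PosMom.IsGaussianState ħ ρ → PosMom.varQ u ρ = ε₁ → PosMom.varP ħ v ρ = ε →
        ∀ M ∈ PosMom.gaussCov ħ u v,
          ENNReal.ofReal (Real.logb 2 (Real.exp 1) * (Real.log 2 - 1 / 2))
            ≤ PosMom.errorFn ħ u v ρ M := fun ρ hρ hQ hP M hM =>
      PosMom.le_errorFn hħ hρ (hQ ▸ hε₁) (hP ▸ hε0) (by rw [hQ, hP, hprod]) hM
    refine ⟨le_iInf₂ fun M hM => (hlow ρ₀ hρ₀ hQ₀ hP₀ M hM).trans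
        (le_iSup₂ (f := fun ρ (_ : ρ ∈ PosMom.gaussStates ħ u v ε₁ ε₂) =>
          PosMom.errorFn ħ u v ρ M) ρ₀ ⟨hρ₀, hQ₀.ge, hP₀ ▸ hlt.le⟩),
      ⟨ρ₀, hρ₀, hQ₀, hP₀⟩,
      ⟨M₀, ⟨hM₀, hPar₀⟩, fun M hM => PosMom.eq_of_hasParams hħ.ne' hM.1.1 hM₀.1 hM.2 hPar₀⟩,
      fun M hM hPar ρ hρ hQ hP => ?_⟩
    have heq : PosMom.errorFn ħ u v ρ M
        = ENNReal.ofReal (Real.logb 2 (Real.exp 1) * (Real.log 2 - 1 / 2)) :=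
      PosMom.errorFn_eq_of_minimal hħ hρ (hQ ▸ hε₁) (hP ▸ hε0) hM (by rw [hQ, hP]; exact hPar)
    exact ⟨heq, le_antisymm ((iInf₂_le M hM).trans_eq heq)
      (le_iInf₂ fun M' hM' => hlow ρ hρ hQ hP M' hM')⟩
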